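/- **Theorem 5.1.** Let $d\in\mathbb N$ and let $\mu$ be the Gaussian probability measure $d\mu(x)=\pi^{-d/2}e^{-|x|^2}\,dx$ on $\mathbb R^d$; all functions are real-valued and $L^p=L^p(\mathbb R^d,\mu)$. For $k\in\mathbb N^d$ (where $0\in\mathbb N$) let $|k|=k_1+\dots+k_d$ and $$\tilde H_k(x)=\prod_{i=1}^d\frac{H_{k_i}(x_i)}{\sqrt{2^{k_i}\,k_i!}},\qquad H_n(t)=(-1)^ne^{t^2}\frac{d^n}{dt^n}e^{-t^2},$$ be the $L^2$-normalized Hermite polynomials. They are eigenfunctions of the Ornstein–Uhlenbeck operator $L=-\Delta+2\langle x,\nabla\rangle$, namely $L\tilde H_k=\lambda_k\tilde H_k$ with $\lambda_k=2|k|$. For $f\in L^2$ and $i=1,\dots,d$ the Riesz transform $R_i$ (formally $R_i=\partial_{x_i}L^{-1/2}$ on mean-zero functions) is defined by the series, convergent in $L^2$, $$R_if=\sum_{k\neq0}\lambda_k^{-1/2}\Big(\int f\,\tilde H_k\,d\mu\Big)\,\partial_{x_i}\tilde H_k .$$ Let $1<p<\infty$ and $p^*=\max\big(p,\tfrac p{p-1}\big)$.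 Then the vector of Riesz transforms $\mathbf Rf=(R_1f,\dots,R_df)$, defined in this way on $L^p\cap L^2$, has a unique extension to a bounded linear operator $\mathbf R$ from $L^p$ to $L^p(\mathbb R^d,\mu;\mathbb R^d)$, and for every $f\in L^p$ with $\int f\,d\mu=0$ $$\|\mathbf Rf\|_p\le 24\,(p^*-1)\,\|f\|_p,\qquad\text{where}\quad \|\mathbf Rf\|_p=\bigg(\int_{\mathbb R^d}\Big(\sum_{i=1}^d|R_if(x)|^2\Big)^{p/2}d\mu(x)\bigg)^{1/p}.$$ In particular the bound does not depend on the dimension $d$. -/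

import Mathlib

open MeasureTheory ProbabilityTheory Filter Topology
open scoped ENNReal NNReal

namespace HermiteRiesz

/-- The one-dimensional Gaussian measure `π^{-1/2} e^{-x²} dx` on the real line. -/
noncomputable def gauss : Measure ℝ :=
  volume.withDensity fun x => ENNReal.ofReal ((√Real.pi)⁻¹ * Real.exp (-x ^ 2))

theorem gauss_eq_gaussianReal : gauss = gaussianReal 0 (1 / 2) := by
  rw [gaussianReal_of_var_ne_zero _ (by norm_num), gauss]
  congr 1
  funext x
  have h : ((1 / 2 : ℝ≥0) : ℝ) = 1 / 2 := by norm_num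
  rw [gaussianPDF, gaussianPDFReal, h]
  congr 4 <;> ring

instance : IsProbabilityMeasure gauss := by
  rw [gauss_eq_gaussianReal]
  infer_instance

/-- The product measure `μ = μ₁ ⊗ ⋯ ⊗ μ_d` on `ℝ^d = ℝ × ⋯ × ℝ`, all factors being `gauss`. -/
noncomputable def mu (d : ℕ) : Measure (Fin d → ℝ) :=
  Measure.pi fun _ => gauss

instance (d : ℕ) : IsProbabilityMeasure (mu d) := by
  unfold mu
  infer_instance

/-- The Hermite polynomial of degree `n` normalized in `L²(gauss)`:
`(2^n n!)^{-1/2} H_n` with `H_n(x) = (-1)^n e^{x²} (d/dx)^n e^{-x²}`. -/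
noncomputable def hermite1 (n : ℕ) (x : ℝ) : ℝ :=
  (√(2 ^ n * (n.factorial : ℝ)))⁻¹ *
    ((-1) ^ n * Real.exp (x ^ 2) * iteratedDeriv n (fun y : ℝ => Real.exp (-y ^ 2)) x)

/-- The tensor product Hermite polynomial `H̃_k(x) = ∏ᵢ H̃_{kᵢ}(xᵢ)`. -/
noncomputable def hermiteN {d : ℕ} (k : Fin d → ℕ) (x : Fin d → ℝ) : ℝ :=
  ∏ i, hermite1 (k i) (x i)

/-- The operator `δᵢ = ∂_{xᵢ}`. -/
noncomputable def delta {d : ℕ} (i : Fin d) (F : (Fin d → ℝ) → ℝ) (x : Fin d → ℝ) : ℝ :=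
  deriv (fun s => F (Function.update x i s)) (x i)

/-- The formal adjoint `δᵢ* = -∂_{xᵢ} + 2 xᵢ` of `δᵢ` in `L²(μ)`. -/
noncomputable def deltaStar {d : ℕ} (i : Fin d) (F : (Fin d → ℝ) → ℝ) (x : Fin d → ℝ) : ℝ :=
  -delta i F x + 2 * x i * F x

/-- The Ornstein–Uhlenbeck operator `L = ∑ᵢ δᵢ* δᵢ = -Δ + 2⟨x, ∇⟩`. -/
noncomputable def ouOperator {d : ℕ} (F : (Fin d → ℝ) → ℝ) (x : Fin d → ℝ) : ℝ :=
  ∑ i, deltaStar i (delta i F) x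

/-- The eigenvalue of `L` on `H̃_k`; see `ouOperator_hermiteN`. -/
noncomputable def eigenvalue {d : ℕ} (k : Fin d → ℕ) : ℝ :=
  2 * ∑ i, (k i : ℝ)

theorem hermite1_eq (n : ℕ) (x : ℝ) :
    hermite1 n x =
      (√(n.factorial : ℝ))⁻¹ * Polynomial.aeval (√2 * x) (Polynomial.hermite n) := by
  have h2 : (√2 : ℝ) ^ 2 = 2 := Real.sq_sqrt (by norm_num)
  have e1 : (fun y : ℝ => Real.exp (-y ^ 2)) =
      fun y : ℝ => (fun z : ℝ => Real.exp (-(z ^ 2 / 2))) (√2 * y) := by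
    funext y
    simp only [mul_pow, h2]
    congr 1
    ring
  have e2 : iteratedDeriv n (fun y : ℝ => Real.exp (-y ^ 2)) x =
      (√2) ^ n * iteratedDeriv n (fun z : ℝ => Real.exp (-(z ^ 2 / 2))) (√2 * x) := by
    have hc : ContDiff ℝ n (fun z : ℝ => Real.exp (-(z ^ 2 / 2))) := by fun_prop
    rw [e1, iteratedDeriv_comp_const_mul hc]
  have e3 : Real.exp (-((√2 * x) ^ 2 / 2)) = (Real.exp (x ^ 2))⁻¹ := by
    rw [← Real.exp_neg, mul_pow, h2]
    congr 1
    ring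
  have e4 : √((2 : ℝ) ^ n * (n.factorial : ℝ)) = √2 ^ n * √(n.factorial : ℝ) := by
    rw [Real.sqrt_mul (by positivity)]
    congr 1
    rw [Real.sqrt_eq_iff_mul_self_eq (by positivity) (by positivity), ← mul_pow,
      Real.mul_self_sqrt (by norm_num)]
  rw [hermite1, e2, Polynomial.hermite_eq_deriv_gaussian, iteratedDeriv_eq_iterate, e3, e4]
  have : (√2 : ℝ) ^ n ≠ 0 := by positivity
  have : (√(n.factorial : ℝ)) ≠ 0 := by positivity
  have := Real.exp_ne_zero (x ^ 2)
  field_simp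

theorem derivative_hermite_succ (n : ℕ) :
    Polynomial.derivative (Polynomial.hermite (n + 1)) =
      ((n : Polynomial ℤ) + 1) * Polynomial.hermite n := by
  induction n with
  | zero => simp
  | succ n ih =>
    rw [Polynomial.hermite_succ (n + 1), ih]
    simp only [Polynomial.derivative_sub, Polynomial.derivative_mul, Polynomial.derivative_X, ih,
      Polynomial.derivative_add, Polynomial.derivative_natCast, Polynomial.derivative_one]
    have h := Polynomial.hermite_succ n
    push_cast
    linear_combination (-(n : Polynomial ℤ) - 1) * h

theorem hasDerivAt_hermite1_succ (n : ℕ) (x : ℝ) :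
    HasDerivAt (hermite1 (n + 1)) (√(2 * ((n : ℝ) + 1)) * hermite1 n x) x := by
  have h0 : hermite1 (n + 1) = fun x => (√((n + 1).factorial : ℝ))⁻¹ *
      Polynomial.aeval (√2 * x) (Polynomial.hermite (n + 1)) := funext (hermite1_eq _)
  have h1 := ((Polynomial.hermite (n + 1)).hasDerivAt_aeval (√2 * x)).comp x
    ((hasDerivAt_id x).const_mul √2)
  have h2 := h1.const_mul ((√((n + 1).factorial : ℝ))⁻¹)
  rw [h0]
  refine h2.congr_deriv ?_
  rw [derivative_hermite_succ, hermite1_eq, Real.sqrt_mul (by norm_num), Nat.factorial_succ]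
  push_cast
  rw [Real.sqrt_mul (by positivity)]
  simp only [map_mul, map_add, map_natCast, map_one]
  have a : √(n.factorial : ℝ) ≠ 0 := by positivity
  have b : √((n : ℝ) + 1) ≠ 0 := by positivity
  have c : √((n : ℝ) + 1) ^ 2 = n + 1 := Real.sq_sqrt (by positivity)
  field_simp
  rw [c]

theorem hermite1_zero (x : ℝ) : hermite1 0 x = 1 := by
  simp [hermite1_eq]

theorem deriv_hermite1 (n : ℕ) :
    deriv (hermite1 n) = fun x => √(2 * (n : ℝ)) * hermite1 (n - 1) x := by
  funext x
  cases n with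
  | zero =>
    have : hermite1 0 = fun _ => 1 := funext hermite1_zero
    simp [this]
  | succ n => simpa using (hasDerivAt_hermite1_succ n x).deriv

theorem ode_hermite1 (n : ℕ) (x : ℝ) :
    -deriv (deriv (hermite1 n)) x + 2 * x * deriv (hermite1 n) x = 2 * n * hermite1 n x := by
  cases n with
  | zero => simp [deriv_hermite1]
  | succ n =>
    have h0 : hermite1 n = fun x => (√(n.factorial : ℝ))⁻¹ *
      Polynomial.aeval (√2 * x) (Polynomial.hermite n) := funext (hermite1_eq _)
    have h1 := ((Polynomial.hermite n).hasDerivAt_aeval (√2 * x)).comp x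
      ((hasDerivAt_id x).const_mul √2)
    have h2 := (h1.const_mul ((√(n.factorial : ℝ))⁻¹)).const_mul √(2 * ((n : ℝ) + 1))
    have h3 : deriv (hermite1 (n + 1)) = fun x => √(2 * ((n : ℝ) + 1)) *
        ((√(n.factorial : ℝ))⁻¹ * Polynomial.aeval (√2 * x) (Polynomial.hermite n)) := by
      rw [deriv_hermite1]
      simp only [Nat.add_sub_cancel, h0]
      push_cast
      rfl
    have h4 := h2.deriv
    simp only [Function.comp_def] at h4
    rw [h3, h4, ← h3, deriv_hermite1]
    simp only [Nat.add_sub_cancel, hermite1_eq]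
    rw [Polynomial.hermite_succ, Nat.factorial_succ]
    push_cast
    rw [Real.sqrt_mul (by norm_num), Real.sqrt_mul (by positivity)]
    simp only [map_mul, map_sub, Polynomial.aeval_X]
    have a : √(n.factorial : ℝ) ≠ 0 := by positivity
    have b : √((n : ℝ) + 1) ≠ 0 := by positivity
    have c : √((n : ℝ) + 1) ^ 2 = n + 1 := Real.sq_sqrt (by positivity)
    have e : √(2 : ℝ) ^ 2 = 2 := Real.sq_sqrt (by norm_num)
    field_simp
    rw [c]
    linear_combination
      (-((n : ℝ) + 1) * Polynomial.aeval (√2 * x) (Polynomial.derivative (Polynomial.hermite n))) * e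

theorem hermiteN_update {d : ℕ} (k : Fin d → ℕ) (x : Fin d → ℝ) (i : Fin d) (s : ℝ) :
    hermiteN k (Function.update x i s) =
      hermite1 (k i) s * ∏ j ∈ Finset.univ.erase i, hermite1 (k j) (x j) := by
  rw [hermiteN, ← Finset.mul_prod_erase _ _ (Finset.mem_univ i), Function.update_self]
  congr 1
  refine Finset.prod_congr rfl fun j hj => ?_
  rw [Function.update_of_ne (Finset.ne_of_mem_erase hj)]

theorem delta_hermiteN {d : ℕ} (k : Fin d → ℕ) (i : Fin d) (x : Fin d → ℝ) :
    delta i (hermiteN k) x =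
      deriv (hermite1 (k i)) (x i) * ∏ j ∈ Finset.univ.erase i, hermite1 (k j) (x j) := by
  simp only [delta, hermiteN_update, deriv_mul_const_field]

/-- `L H̃_k = λ_k H̃_k`, which justifies the value of `eigenvalue`. -/
theorem ouOperator_hermiteN {d : ℕ} (k : Fin d → ℕ) (x : Fin d → ℝ) :
    ouOperator (hermiteN k) x = eigenvalue k * hermiteN k x := by
  rw [ouOperator, eigenvalue, Finset.mul_sum, Finset.sum_mul]
  refine Finset.sum_congr rfl fun i _ => ?_
  have h : delta i (delta i (hermiteN k)) x = deriv (deriv (hermite1 (k i))) (x i) *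
      ∏ j ∈ Finset.univ.erase i, hermite1 (k j) (x j) := by
    have : (fun s => delta i (hermiteN k) (Function.update x i s)) = fun s =>
        deriv (hermite1 (k i)) s * ∏ j ∈ Finset.univ.erase i, hermite1 (k j) (x j) := by
      funext s
      rw [delta_hermiteN, Function.update_self]
      congr 1
      refine Finset.prod_congr rfl fun j hj => ?_
      rw [Function.update_of_ne (Finset.ne_of_mem_erase hj)]
    rw [delta, this, deriv_mul_const_field]
  have h' := hermiteN_update k x i (x i)
  rw [Function.update_eq_self] at h'
  rw [deltaStar, h, delta_hermiteN, h', ← mul_assoc (2 * (k i : ℝ)), ← ode_hermite1]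
  ring

/-- The partial sum over `k ∈ s` of the series
`R_i f = ∑_{k ≠ 0} λ_k^{-1/2} ⟨f, H̃_k⟩ δᵢ H̃_k` of the Riesz transform `R_i = δᵢ L^{-1/2} Π`. -/
noncomputable def rieszPartialSum {d : ℕ} (f : (Fin d → ℝ) → ℝ) (i : Fin d)
    (s : Finset {k : Fin d → ℕ // k ≠ 0}) (x : Fin d → ℝ) : ℝ :=
  ∑ k ∈ s, eigenvalue k.1 ^ (-(1 / 2 : ℝ)) * (∫ y, f y * hermiteN k.1 y ∂mu d) *
    delta i (hermiteN k.1) x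

/-- For `f ∈ L²(μ)`: `g = (R_1 f, …, R_d f)`, that is, for every `i` the series defining `R_i f`
converges to `gᵢ` in `L²(μ)` (unconditionally). -/
def IsRieszVector {d : ℕ} (f : (Fin d → ℝ) → ℝ) (g : (Fin d → ℝ) → EuclideanSpace ℝ (Fin d)) :
    Prop :=
  ∀ i, Tendsto (fun s : Finset {k : Fin d → ℕ // k ≠ 0} =>
    eLpNorm (fun x => g x i - rieszPartialSum f i s x) 2 (mu d)) atTop (𝓝 0)

/-- `R` is the vector of Riesz transforms on `L^p(μ)`: the bounded operator from `L^p(μ)` to the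
`ℝ^d`-valued `L^p(μ)` that is given by the defining series on `L^p(μ) ∩ L²(μ)`. -/
def IsLpRiesz {d : ℕ} (p : ℝ≥0∞) [Fact (1 ≤ p)]
    (R : Lp ℝ p (mu d) →L[ℝ] Lp (EuclideanSpace ℝ (Fin d)) p (mu d)) : Prop :=
  ∀ f : Lp ℝ p (mu d), MemLp f 2 (mu d) → IsRieszVector f (R f)

/-- `p* = max (p, p / (p - 1))`. -/
noncomputable def pStar (p : ℝ) : ℝ := max p (p / (p - 1))

end HermiteRiesz

/-!
Dimension-free `L^p` bounds for the Riesz transforms of the Ornstein–Uhlenbeck operator, by the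
Bellman function method.

By duality and the density of polynomials, the bound follows from a bilinear estimate
`∑ᵢ ⟨R_i f, g_i⟩ ≤ 24 (p* - 1) ‖f‖_p ‖g‖_q` for a polynomial `f` and a vector `g` of polynomials,
all of them finite sums of Hermite polynomials. Extend `f` to positive times by
`F = e^{-t √L} f` and the components of `g` by `G_i = e^{-t √(L + 2)} g_i`; these solve
`∂_t² F = L F` and `∂_t² G_i = (L + 2) G_i`. The shift by `2` is forced by the commutation relation
`∂ᵢ L = (L + 2) ∂ᵢ`, through which `W(t) = ∑ᵢ ⟨R_i F, G_i⟩` satisfies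
`W'' = -4 ∑ᵢ ∫ (∂ᵢ F) (∂_t G_i) dμ`. On Hermite polynomials all of this is an explicit finite
computation, and no semigroup theory is needed.

The Bellman function `Φ` (`bellman`, `IsBellman`) is at most a multiple of `|F|^p` plus a multiple
of `|G|^q`, and is so convex that its second derivative along any line dominates
`2 c |∂F| |∂G|` with `c = 1 / (9 (p* - 1))`; the underlying inequality between real numbers is
`hess_bellman_lower`. Hence `∂_t² Φ(F, G) - L Φ(F, G) ≥ 2 c |∑ᵢ ∂ᵢ F ∂_t G_i|`
(`IsBellman.flow`). Integrating against `μ` kills the term with `L`, so that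
`(2 / c) ∫ Φ(F, G) dμ - W` is convex in `t`. It is bounded and its limit at infinity is nonnegative,
so it is nonnegative at `t = 0` (`IsBellman.riesz_le`). The powers in `Φ` are
singular at the origin, which is avoided by adding small positive constants to `|F|²` and `|G|²`,
removed at the end by a scaling argument. Since `|G|` is the Euclidean length, the constants do not
depend on the dimension.

The density of polynomials in `L^r(μ)`, `r < ∞`, comes from the bounded continuous functions that
multiply the closure of the polynomials into itself: they form an algebra which contains the sines
`sin (s xᵢ)`, so the Stone–Weierstrass theorem applies. The bounded extension to `L^p` agrees with
the `L²` series on `L^p ∩ L²` because there it coincides with the extension to `L^{max(p, 2)}`, both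
being limits along the same polynomials, and because the partial sums of the series are contractions
of `L²` (`eLpNorm_rieszPartialSum_le`). It is unique because the series determines it on polynomials.
-/

namespace HermiteRiesz

variable {d : ℕ}

/-! ### Gaussian measure: exponential moments and integration by parts -/

/-- Continuous functions growing at most exponentially on the set `s`, the growth being measured
by the norm of a projection `ρ` to `ℝ^d`. -/
structure ExpGrowth {α : Type*} [TopologicalSpace α] (s : Set α) (ρ : α → Fin d → ℝ) (f : α → ℝ) :
    Prop where
  continuous : Continuous f
  bound : ∃ c, 0 ≤ c ∧ ∀ x ∈ s, |f x| ≤ Real.exp (c * (1 + ‖ρ x‖))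

/-- Continuous functions on `ℝ^d` growing at most exponentially. They are closed under sums and
products and lie in `L^r(μ)` for every `r < ∞`. -/
abbrev Moderate (h : (Fin d → ℝ) → ℝ) : Prop := ExpGrowth Set.univ id h

theorem integrable_exp_mul_abs_gauss (c : ℝ) :
    Integrable (fun x => Real.exp (c * |x|)) gauss := by
  have h : Integrable (fun x => Real.exp (c * x) + Real.exp ((-c) * x)) gauss := by
    rw [gauss_eq_gaussianReal]
    exact (integrable_exp_mul_gaussianReal c).add (integrable_exp_mul_gaussianReal (-c))
  refine h.mono' (by fun_prop) (ae_of_all _ fun x => ?_)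
  rw [Real.norm_of_nonneg (Real.exp_pos _).le]
  rcases abs_cases x with ⟨hx, -⟩ | ⟨hx, -⟩ <;> rw [hx]
  · linarith [Real.exp_pos ((-c) * x)]
  · rw [show c * -x = (-c) * x by ring]
    linarith [Real.exp_pos (c * x)]

theorem integrable_exp_norm (c : ℝ) :
    Integrable (fun x : Fin d → ℝ => Real.exp (c * (1 + ‖x‖))) (mu d) := by
  have h : Integrable (fun x : Fin d → ℝ => ∏ i, Real.exp (|c| * |x i|)) (mu d) :=
    Integrable.fintype_prod (f := fun _ y => Real.exp (|c| * |y|))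
      fun _ => integrable_exp_mul_abs_gauss |c|
  refine (h.const_mul (Real.exp |c|)).mono' (by fun_prop) (ae_of_all _ fun x => ?_)
  rw [Real.norm_of_nonneg (Real.exp_pos _).le, ← Real.exp_sum, ← Real.exp_add, Real.exp_le_exp,
    ← Finset.mul_sum]
  have h1 : ‖x‖ ≤ ∑ i, |x i| :=
    (pi_norm_le_iff_of_nonneg (by positivity)).2 fun i =>
      Finset.single_le_sum (f := fun i => |x i|) (fun _ _ => abs_nonneg _) (Finset.mem_univ i)
  have h2 : c * (1 + ‖x‖) ≤ |c| * (1 + ‖x‖) := by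
    gcongr
    exact le_abs_self c
  nlinarith [abs_nonneg c]

namespace ExpGrowth

variable {α : Type*} [TopologicalSpace α] {s : Set α} {ρ : α → Fin d → ℝ} {f g : α → ℝ}

theorem const (a : ℝ) : ExpGrowth s ρ (fun _ => a) := by
  refine ⟨continuous_const, |a|, abs_nonneg a, fun x _ => ?_⟩
  have h1 := Real.add_one_le_exp (|a| * (1 + ‖ρ x‖))
  nlinarith [norm_nonneg (ρ x), abs_nonneg a]

theorem add (hf : ExpGrowth s ρ f) (hg : ExpGrowth s ρ g) :
    ExpGrowth s ρ (fun x => f x + g x) := by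
  obtain ⟨a, ha, hfa⟩ := hf.bound
  obtain ⟨b, hb, hgb⟩ := hg.bound
  refine ⟨hf.continuous.add hg.continuous, 1 + a + b, by positivity, fun x hxs => ?_⟩
  have hx := norm_nonneg (ρ x)
  have e1 : Real.exp (a * (1 + ‖ρ x‖)) ≤ Real.exp ((a + b) * (1 + ‖ρ x‖)) := by
    apply Real.exp_le_exp.2; nlinarith
  have e2 : Real.exp (b * (1 + ‖ρ x‖)) ≤ Real.exp ((a + b) * (1 + ‖ρ x‖)) := by
    apply Real.exp_le_exp.2; nlinarith
  have e3 : (2 : ℝ) ≤ Real.exp (1 + ‖ρ x‖) := by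
    linarith [Real.add_one_le_exp (1 + ‖ρ x‖)]
  calc |f x + g x| ≤ |f x| + |g x| := abs_add_le _ _
    _ ≤ 2 * Real.exp ((a + b) * (1 + ‖ρ x‖)) := by linarith [hfa x hxs, hgb x hxs]
    _ ≤ Real.exp (1 + ‖ρ x‖) * Real.exp ((a + b) * (1 + ‖ρ x‖)) := by gcongr
    _ = Real.exp ((1 + a + b) * (1 + ‖ρ x‖)) := by rw [← Real.exp_add]; congr 1; ring

theorem mul (hf : ExpGrowth s ρ f) (hg : ExpGrowth s ρ g) :
    ExpGrowth s ρ (fun x => f x * g x) := by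
  obtain ⟨a, ha, hfa⟩ := hf.bound
  obtain ⟨b, hb, hgb⟩ := hg.bound
  refine ⟨hf.continuous.mul hg.continuous, a + b, by positivity, fun x hxs => ?_⟩
  rw [abs_mul, add_mul, Real.exp_add]
  exact mul_le_mul (hfa x hxs) (hgb x hxs) (abs_nonneg _) (Real.exp_pos _).le

theorem const_mul (a : ℝ) (hf : ExpGrowth s ρ f) : ExpGrowth s ρ (fun x => a * f x) :=
  (const a).mul hf

theorem neg (hf : ExpGrowth s ρ f) : ExpGrowth s ρ (fun x => -f x) := by
  simpa using hf.const_mul (-1)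

theorem sub (hf : ExpGrowth s ρ f) (hg : ExpGrowth s ρ g) :
    ExpGrowth s ρ (fun x => f x - g x) := by
  simpa [sub_eq_add_neg] using hf.add hg.neg

theorem sum {ι : Type*} (t : Finset ι) {F : ι → α → ℝ} (h : ∀ i ∈ t, ExpGrowth s ρ (F i)) :
    ExpGrowth s ρ (fun x => ∑ i ∈ t, F i x) := by
  classical
  induction t using Finset.induction_on with
  | empty => simpa using const 0
  | insert a t ha ih =>
    simp only [Finset.sum_insert ha]
    exact (h a (Finset.mem_insert_self a t)).add
      (ih fun i hi => h i (Finset.mem_insert_of_mem hi))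

theorem prod {ι : Type*} (t : Finset ι) {F : ι → α → ℝ} (h : ∀ i ∈ t, ExpGrowth s ρ (F i)) :
    ExpGrowth s ρ (fun x => ∏ i ∈ t, F i x) := by
  classical
  induction t using Finset.induction_on with
  | empty => simpa using const 1
  | insert a t ha ih =>
    simp only [Finset.prod_insert ha]
    exact (h a (Finset.mem_insert_self a t)).mul
      (ih fun i hi => h i (Finset.mem_insert_of_mem hi))

theorem pow (hf : ExpGrowth s ρ f) (n : ℕ) : ExpGrowth s ρ (fun x => f x ^ n) := by
  induction n with
  | zero => simpa using const 1
  | succ n ih => simpa [pow_succ] using ih.mul hf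

/-- Real powers, of either sign, of a function bounded away from zero. -/
theorem rpow (hf : ExpGrowth s ρ f) {m : ℝ} (hm : 0 < m) (hfm : ∀ x, m ≤ f x) (a : ℝ) :
    ExpGrowth s ρ (fun x => f x ^ a) := by
  have hcont : Continuous fun x => f x ^ a :=
    hf.continuous.rpow_const fun x => Or.inl (hm.trans_le (hfm x)).ne'
  rcases le_total 0 a with ha | ha
  · obtain ⟨c, hc, hfc⟩ := hf.bound
    refine ⟨hcont, c * a, by positivity, fun x hxs => ?_⟩
    have h0 : 0 ≤ f x := (hm.trans_le (hfm x)).le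
    rw [abs_of_nonneg (Real.rpow_nonneg h0 a), mul_right_comm, Real.exp_mul]
    exact Real.rpow_le_rpow h0 ((le_abs_self _).trans (hfc x hxs)) ha
  · obtain ⟨c, hc, hfc⟩ := (const (s := s) (ρ := ρ) (m ^ a)).bound
    refine ⟨hcont, c, hc, fun x hxs => ?_⟩
    have h0 : 0 < f x := hm.trans_le (hfm x)
    refine le_trans ?_ (hfc x hxs)
    rw [abs_of_nonneg (Real.rpow_nonneg h0.le a), abs_of_nonneg (Real.rpow_nonneg hm.le a)]
    exact Real.rpow_le_rpow_of_nonpos hm (hfm x) ha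

theorem coord (i : Fin d) : Moderate (fun x : Fin d → ℝ => x i) := by
  refine ⟨continuous_apply i, 1, zero_le_one, fun x _ => ?_⟩
  have h1 := Real.add_one_le_exp (1 * (1 + ‖x‖))
  have h2 : ‖x i‖ ≤ ‖x‖ := norm_le_pi_norm x i
  rw [Real.norm_eq_abs] at h2
  simp only [id]
  linarith

theorem memLp {f : (Fin d → ℝ) → ℝ} (hf : Moderate f) {r : ℝ≥0∞} (hr : r ≠ ∞) :
    MemLp f r (mu d) := by
  by_cases hr0 : r = 0
  · subst hr0
    exact memLp_zero_iff_aestronglyMeasurable.2 hf.continuous.aestronglyMeasurable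
  obtain ⟨c, -, hc⟩ := hf.bound
  rw [← integrable_norm_rpow_iff hf.continuous.aestronglyMeasurable hr0 hr]
  refine (integrable_exp_norm (c * r.toReal)).mono'
    (hf.continuous.norm.rpow_const fun _ => Or.inr ENNReal.toReal_nonneg).aestronglyMeasurable
    (ae_of_all _ fun x => ?_)
  rw [Real.norm_of_nonneg (by positivity), mul_right_comm, Real.exp_mul]
  exact Real.rpow_le_rpow (norm_nonneg _) (hc x trivial) ENNReal.toReal_nonneg

theorem integrable {f : (Fin d → ℝ) → ℝ} (hf : Moderate f) : Integrable f (mu d) :=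
  memLp_one_iff_integrable.1 (hf.memLp ENNReal.one_ne_top)

end ExpGrowth

/-- The density of `mu d` with respect to the Lebesgue measure. -/
noncomputable def density (x : Fin d → ℝ) : ℝ :=
  ∏ i, (√Real.pi)⁻¹ * Real.exp (-(x i) ^ 2)

theorem density_pos (x : Fin d → ℝ) : 0 < density x :=
  Finset.prod_pos fun _ _ => mul_pos (inv_pos.2 (Real.sqrt_pos.2 Real.pi_pos)) (Real.exp_pos _)

theorem continuous_density : Continuous (density : (Fin d → ℝ) → ℝ) := by
  unfold density
  fun_prop

theorem integrable_density1 :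
    Integrable (fun x : ℝ => (√Real.pi)⁻¹ * Real.exp (-x ^ 2)) := by
  have h := integrable_exp_neg_mul_sq (b := 1) one_pos
  simp only [neg_mul, one_mul] at h
  exact h.const_mul _

theorem mu_eq_withDensity :
    mu d = volume.withDensity fun x : Fin d → ℝ => ENNReal.ofReal (density x) := by
  refine Measure.pi_eq fun s hs => ?_
  have hint : ∀ i, Integrable
      ((s i).indicator fun x : ℝ => (√Real.pi)⁻¹ * Real.exp (-x ^ 2)) := fun i =>
    integrable_density1.indicator (hs i)
  have hprod : ∀ x : Fin d → ℝ, (Set.univ.pi s).indicator density x =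
      ∏ i, (s i).indicator (fun x : ℝ => (√Real.pi)⁻¹ * Real.exp (-x ^ 2)) (x i) := by
    intro x
    by_cases hx : x ∈ Set.univ.pi s
    · rw [Set.indicator_of_mem hx, density]
      exact Finset.prod_congr rfl fun i _ => by rw [Set.indicator_of_mem (hx i trivial)]
    · rw [Set.indicator_of_notMem hx]
      simp only [Set.mem_pi, Set.mem_univ, true_imp_iff, not_forall] at hx
      obtain ⟨i, hi⟩ := hx
      exact (Finset.prod_eq_zero (Finset.mem_univ i) (Set.indicator_of_notMem hi _)).symm
  have hnn : ∀ i x, 0 ≤ (s i).indicator (fun x : ℝ => (√Real.pi)⁻¹ * Real.exp (-x ^ 2)) x :=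
    fun i x => Set.indicator_nonneg (fun _ _ => by positivity) x
  have hms := MeasurableSet.univ_pi hs
  rw [withDensity_apply _ hms, ← lintegral_indicator hms]
  have e1 : ∀ x : Fin d → ℝ, (Set.univ.pi s).indicator (fun x => ENNReal.ofReal (density x)) x =
      ENNReal.ofReal (∏ i, (s i).indicator
        (fun x : ℝ => (√Real.pi)⁻¹ * Real.exp (-x ^ 2)) (x i)) := by
    intro x
    rw [← hprod]
    by_cases hx : x ∈ Set.univ.pi s
    · simp only [Set.indicator_of_mem hx]
    · simp only [Set.indicator_of_notMem hx, ENNReal.ofReal_zero]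
  simp only [e1]
  rw [← ofReal_integral_eq_lintegral_ofReal (by
      rw [volume_pi]
      exact Integrable.fintype_prod_dep hint)
    (ae_of_all _ fun x => Finset.prod_nonneg fun i _ => hnn i _)]
  rw [integral_fintype_prod_volume_eq_prod
    (fun i => (s i).indicator fun x : ℝ => (√Real.pi)⁻¹ * Real.exp (-x ^ 2)),
    ENNReal.ofReal_prod_of_nonneg fun i _ => integral_nonneg (hnn i)]
  refine Finset.prod_congr rfl fun i _ => ?_
  rw [gauss, withDensity_apply _ (hs i), ofReal_integral_eq_lintegral_ofReal (hint i)
    (ae_of_all _ (hnn i)), ← lintegral_indicator (hs i)]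
  congr 1
  funext x
  by_cases hx : x ∈ s i
  · simp only [Set.indicator_of_mem hx]
  · simp only [Set.indicator_of_notMem hx, ENNReal.ofReal_zero]

theorem integrable_mu_iff {f : (Fin d → ℝ) → ℝ} :
    Integrable f (mu d) ↔ Integrable (fun x => density x * f x) := by
  rw [mu_eq_withDensity, integrable_withDensity_iff_integrable_smul'
    (continuous_density.measurable.ennreal_ofReal) (ae_of_all _ fun _ => ENNReal.ofReal_lt_top)]
  simp only [ENNReal.toReal_ofReal (density_pos _).le, smul_eq_mul]

theorem integral_mu (f : (Fin d → ℝ) → ℝ) :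
    ∫ x, f x ∂mu d = ∫ x, density x * f x := by
  rw [mu_eq_withDensity, integral_withDensity_eq_integral_toReal_smul
    (continuous_density.measurable.ennreal_ofReal) (ae_of_all _ fun _ => ENNReal.ofReal_lt_top)]
  simp only [ENNReal.toReal_ofReal (density_pos _).le, smul_eq_mul]

theorem hasLineDerivAt_density (x : Fin d → ℝ) (i : Fin d) :
    HasLineDerivAt ℝ density (-(2 * x i) * density x) x (Pi.single i 1) := by
  have h1 : ∀ j : Fin d, HasDerivAt
      (fun t : ℝ => (√Real.pi)⁻¹ * Real.exp (-((x + t • (Pi.single i 1 : Fin d → ℝ)) j) ^ 2))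
      (if j = i then -(2 * x i) * ((√Real.pi)⁻¹ * Real.exp (-(x j) ^ 2)) else 0) 0 := by
    intro j
    by_cases hj : j = i
    · subst hj
      have h2 : HasDerivAt (fun t : ℝ => -(x j + t) ^ 2) (-(2 * x j)) 0 := by
        have := (((hasDerivAt_id' (0 : ℝ)).const_add (x j)).fun_pow 2).fun_neg
        simpa using this
      have h3 := (h2.exp).const_mul ((√Real.pi)⁻¹)
      simp only [Pi.add_apply, Pi.smul_apply, Pi.single_eq_same, smul_eq_mul, mul_one, if_true]
      refine h3.congr_deriv ?_
      simp only [add_zero]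
      ring
    · simp only [Pi.add_apply, Pi.smul_apply, smul_eq_mul, if_neg hj,
        Pi.single_eq_of_ne hj, mul_zero, add_zero]
      exact hasDerivAt_const _ _
  have h4 := HasDerivAt.fun_finsetProd (u := Finset.univ) fun j _ => h1 j
  refine h4.congr_deriv ?_
  rw [Finset.sum_eq_single i]
  · simp only [if_true, zero_smul, add_zero, smul_eq_mul, density]
    rw [← Finset.mul_prod_erase _ _ (Finset.mem_univ i)]
    ring
  · intro j _ hj
    simp [hj]
  · simp

/-- Integration by parts against the Gaussian measure: `δᵢ* K` has integral zero. -/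
theorem integral_deriv_sub_eq_zero {K K' : (Fin d → ℝ) → ℝ} (i : Fin d) (hK : Moderate K)
    (hK' : Moderate K') (h : ∀ x, HasLineDerivAt ℝ K (K' x) x (Pi.single i 1)) :
    ∫ x, (K' x - 2 * x i * K x) ∂mu d = 0 := by
  have hxK : Moderate (fun x => 2 * x i * K x) := ((ExpGrowth.coord i).const_mul 2).mul hK
  have i1 := integrable_mu_iff.1 hK.integrable
  have i2 := integrable_mu_iff.1 hK'.integrable
  have i3 := integrable_mu_iff.1 hxK.integrable
  have key := integral_bilinear_hasLineDerivAt_right_eq_neg_left_of_integrable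
    (μ := (volume : Measure (Fin d → ℝ))) (f := density)
    (f' := fun x => -(2 * x i) * density x) (g := K) (g' := K') (v := Pi.single i 1)
    (B := ContinuousLinearMap.mul ℝ ℝ)
    (by
      refine i3.neg.congr (ae_of_all _ fun x => ?_)
      simp only [Pi.neg_apply, ContinuousLinearMap.mul_apply']
      ring)
    (by simpa using i2) (by simpa using i1)
    (fun x _ => hasLineDerivAt_density x i) (fun x _ => h x)
  simp only [ContinuousLinearMap.mul_apply'] at key
  rw [integral_sub hK'.integrable hxK.integrable, integral_mu, integral_mu, key, ← integral_neg,
    ← integral_sub]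
  · rw [integral_eq_zero_of_ae]
    refine ae_of_all _ fun x => ?_
    simp only [Pi.zero_apply]
    ring
  · refine i3.congr (ae_of_all _ fun x => ?_)
    simp only
    ring
  · exact i3

/-! ### Hermite polynomials: ladder relations, orthonormality, Bessel's inequality -/

/-- The multi-index `k - eᵢ`, truncated at zero. -/
def lower (k : Fin d → ℕ) (i : Fin d) : Fin d → ℕ := Function.update k i (k i - 1)

/-- The multi-index `k + eᵢ`. -/
def raise (k : Fin d → ℕ) (i : Fin d) : Fin d → ℕ := Function.update k i (k i + 1)

theorem raise_lower {k : Fin d → ℕ} {i : Fin d} (h : k i ≠ 0) : raise (lower k i) i = k := by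
  have : k i - 1 + 1 = k i := by omega
  simp [lower, raise, this]

theorem lower_inj {k l : Fin d → ℕ} {i : Fin d} (hk : k i ≠ 0) (hl : l i ≠ 0)
    (h : lower k i = lower l i) : k = l := by
  rw [← raise_lower hk, h, raise_lower hl]

theorem hermiteN_eq_mul (k : Fin d → ℕ) (x : Fin d → ℝ) (i : Fin d) :
    hermiteN k x = hermite1 (k i) (x i) * ∏ j ∈ Finset.univ.erase i, hermite1 (k j) (x j) := by
  simpa using hermiteN_update k x i (x i)

theorem hermiteN_update_index (k : Fin d → ℕ) (x : Fin d → ℝ) (i : Fin d) (n : ℕ) :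
    hermiteN (Function.update k i n) x =
      hermite1 n (x i) * ∏ j ∈ Finset.univ.erase i, hermite1 (k j) (x j) := by
  rw [hermiteN_eq_mul _ _ i, Function.update_self]
  congr 1
  refine Finset.prod_congr rfl fun j hj => ?_
  rw [Function.update_of_ne (Finset.ne_of_mem_erase hj)]

theorem hermiteN_zero (x : Fin d → ℝ) : hermiteN 0 x = 1 := by
  simp [hermiteN, hermite1_zero]

theorem delta_hermiteN_eq (k : Fin d → ℕ) (i : Fin d) (x : Fin d → ℝ) :
    delta i (hermiteN k) x = √(2 * (k i : ℝ)) * hermiteN (lower k i) x := by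
  rw [delta_hermiteN, deriv_hermite1, lower, hermiteN_update_index]
  ring

theorem hasDerivAt_hermite1 (n : ℕ) (y : ℝ) :
    HasDerivAt (hermite1 n) (√(2 * (n : ℝ)) * hermite1 (n - 1) y) y := by
  cases n with
  | zero =>
    have : hermite1 0 = fun _ => 1 := funext hermite1_zero
    rw [this]
    simpa using hasDerivAt_const y (1 : ℝ)
  | succ n => simpa using hasDerivAt_hermite1_succ n y

theorem add_smul_single (x : Fin d → ℝ) (i : Fin d) (s : ℝ) :
    x + s • (Pi.single i 1 : Fin d → ℝ) = Function.update x i (x i + s) := by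
  funext j
  by_cases hj : j = i
  · subst hj; simp
  · simp [hj]

theorem hasLineDerivAt_hermiteN (k : Fin d → ℕ) (i : Fin d) (x : Fin d → ℝ) :
    HasLineDerivAt ℝ (hermiteN k) (√(2 * (k i : ℝ)) * hermiteN (lower k i) x) x
      (Pi.single i 1) := by
  unfold HasLineDerivAt
  simp only [add_smul_single, hermiteN_update]
  have h1 : HasDerivAt (fun s => hermite1 (k i) (x i + s))
      (√(2 * (k i : ℝ)) * hermite1 (k i - 1) (x i + 0)) 0 :=
    (hasDerivAt_hermite1 (k i) (x i + 0)).comp_const_add (x i) 0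
  rw [add_zero] at h1
  refine (h1.mul_const _).congr_deriv ?_
  rw [lower, hermiteN_update_index]
  ring

theorem hermite1_raise (n : ℕ) (y : ℝ) :
    √(2 * ((n : ℝ) + 1)) * hermite1 (n + 1) y =
      2 * y * hermite1 n y - √(2 * (n : ℝ)) * hermite1 (n - 1) y := by
  have h := ode_hermite1 (n + 1) y
  have h1 : deriv (hermite1 (n + 1)) = fun x => √(2 * ((n : ℝ) + 1)) * hermite1 n x := by
    rw [deriv_hermite1]
    simp
  have h2 : deriv (deriv (hermite1 (n + 1))) y =
      √(2 * ((n : ℝ) + 1)) * (√(2 * (n : ℝ)) * hermite1 (n - 1) y) := by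
    rw [h1, deriv_const_mul_field, deriv_hermite1]
  rw [h2, h1] at h
  have h0 : √(2 * ((n : ℝ) + 1)) ≠ 0 := by positivity
  have hs : √(2 * ((n : ℝ) + 1)) * √(2 * ((n : ℝ) + 1)) = 2 * ((n : ℝ) + 1) :=
    Real.mul_self_sqrt (by positivity)
  apply mul_left_cancel₀ h0
  push_cast at h
  linear_combination hermite1 (n + 1) y * hs - h

theorem hermiteN_raise (k : Fin d → ℕ) (i : Fin d) (x : Fin d → ℝ) :
    √(2 * ((k i : ℝ) + 1)) * hermiteN (raise k i) x =
      2 * x i * hermiteN k x - √(2 * (k i : ℝ)) * hermiteN (lower k i) x := by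
  rw [raise, lower, hermiteN_update_index, hermiteN_update_index, hermiteN_eq_mul k x i]
  linear_combination (∏ j ∈ Finset.univ.erase i, hermite1 (k j) (x j)) *
    hermite1_raise (k i) (x i)

theorem moderate_hermiteN (k : Fin d → ℕ) : Moderate (hermiteN k) := by
  refine ExpGrowth.prod _ fun i _ => ?_
  simp only [hermite1_eq, Polynomial.aeval_eq_sum_range]
  refine ExpGrowth.const_mul _ (ExpGrowth.sum _ fun n _ => ?_)
  simp only [zsmul_eq_mul]
  exact (((ExpGrowth.coord i).const_mul _).pow n).const_mul _

theorem integral_hermiteN_mul_lower (k l : Fin d → ℕ) (i : Fin d) (hk : k i ≠ 0) :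
    √(2 * (k i : ℝ)) * ∫ x, hermiteN k x * hermiteN l x ∂mu d =
      √(2 * (l i : ℝ)) * ∫ x, hermiteN (lower k i) x * hermiteN (lower l i) x ∂mu d := by
  have hk1 : ((lower k i) i : ℝ) + 1 = k i := by
    simp only [lower, Function.update_self]
    exact_mod_cast Nat.succ_pred_eq_of_ne_zero hk
  set m := lower k i with hm
  have hr : raise m i = k := raise_lower hk
  have hIBP := integral_deriv_sub_eq_zero (K := fun x => hermiteN m x * hermiteN l x)
    (K' := fun x => √(2 * (m i : ℝ)) * hermiteN (lower m i) x * hermiteN l x +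
      hermiteN m x * (√(2 * (l i : ℝ)) * hermiteN (lower l i) x)) i
    ((moderate_hermiteN m).mul (moderate_hermiteN l))
    ((((moderate_hermiteN _).const_mul _).mul (moderate_hermiteN l)).add
      ((moderate_hermiteN m).mul ((moderate_hermiteN _).const_mul _)))
    (fun x => by
      have := HasDerivAt.fun_mul (hasLineDerivAt_hermiteN m i x) (hasLineDerivAt_hermiteN l i x)
      unfold HasLineDerivAt
      simpa only [zero_smul, add_zero] using this)
  have e : ∀ x, √(2 * (m i : ℝ)) * hermiteN (lower m i) x * hermiteN l x +
      hermiteN m x * (√(2 * (l i : ℝ)) * hermiteN (lower l i) x) -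
      2 * x i * (hermiteN m x * hermiteN l x) =
      √(2 * (l i : ℝ)) * (hermiteN m x * hermiteN (lower l i) x) -
      √(2 * (k i : ℝ)) * (hermiteN k x * hermiteN l x) := by
    intro x
    have h := hermiteN_raise m i x
    rw [hr, hk1] at h
    linear_combination hermiteN l x * h
  simp only [e] at hIBP
  rw [integral_sub (((moderate_hermiteN m).mul (moderate_hermiteN _)).const_mul _).integrable
    (((moderate_hermiteN k).mul (moderate_hermiteN l)).const_mul _).integrable,
    integral_const_mul, integral_const_mul] at hIBP
  linarith

/-- Orthonormality of the normalized Hermite polynomials in `L²(μ)`. -/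
theorem integral_hermiteN_mul (k l : Fin d → ℕ) :
    ∫ x, hermiteN k x * hermiteN l x ∂mu d = if k = l then 1 else 0 := by
  obtain ⟨n, hn⟩ : ∃ n, ∑ i, k i = n := ⟨_, rfl⟩
  induction n using Nat.strong_induction_on generalizing k l with
  | _ n ih =>
  by_cases hk : k = 0
  · subst hk
    by_cases hl : l = 0
    · subst hl
      simp [hermiteN_zero]
    · obtain ⟨i, hi⟩ : ∃ i, l i ≠ 0 := by
        by_contra! h
        exact hl (funext h)
      have h := integral_hermiteN_mul_lower l 0 i hi
      have h0 : √(2 * (l i : ℝ)) ≠ 0 := by positivity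
      simp only [Pi.zero_apply, Nat.cast_zero, mul_zero, Real.sqrt_zero, zero_mul,
        mul_eq_zero, h0, false_or] at h
      rw [if_neg (Ne.symm hl), ← h]
      simp only [mul_comm]
  · obtain ⟨i, hi⟩ : ∃ i, k i ≠ 0 := by
      by_contra! h
      exact hk (funext h)
    have h := integral_hermiteN_mul_lower k l i hi
    have h0 : √(2 * (k i : ℝ)) ≠ 0 := by positivity
    by_cases hl : l i = 0
    · simp only [hl, Nat.cast_zero, mul_zero, Real.sqrt_zero, zero_mul, mul_eq_zero, h0,
        false_or] at h
      rw [h, if_neg]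
      rintro rfl
      exact hi hl
    · have hlt : ∑ j, lower k i j < n := by
        rw [← hn]
        refine Finset.sum_lt_sum (fun j _ => ?_) ⟨i, Finset.mem_univ i, ?_⟩
        · by_cases hj : j = i
          · subst hj; simp [lower]
          · simp [lower, hj]
        · simp only [lower, Function.update_self]
          omega
      rw [ih _ hlt (lower k i) (lower l i) rfl] at h
      by_cases hkl : k = l
      · subst hkl
        rw [if_pos rfl, mul_one] at h
        rw [if_pos rfl]
        exact mul_left_cancel₀ h0 (by rw [h, mul_one])
      · rw [if_neg fun e => hkl (lower_inj hi hl e), mul_zero, mul_eq_zero] at h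
        rw [if_neg hkl]
        exact h.resolve_left h0

/-- The Hermite polynomial `H̃_k` as an element of `L²(μ)`. -/
noncomputable def hermiteL2 (k : Fin d → ℕ) : Lp ℝ 2 (mu d) :=
  ((moderate_hermiteN k).memLp ENNReal.ofNat_ne_top).toLp (hermiteN k)

theorem coeFn_hermiteL2 (k : Fin d → ℕ) : hermiteL2 k =ᵐ[mu d] hermiteN k :=
  MemLp.coeFn_toLp _

theorem inner_hermiteL2 (f : Lp ℝ 2 (mu d)) (k : Fin d → ℕ) :
    inner ℝ (hermiteL2 k) f = ∫ x, f x * hermiteN k x ∂mu d := by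
  rw [L2.inner_def]
  refine integral_congr_ae ?_
  filter_upwards [coeFn_hermiteL2 k] with x hx
  simp [hx]

theorem orthonormal_hermiteL2 : Orthonormal ℝ (hermiteL2 : (Fin d → ℕ) → Lp ℝ 2 (mu d)) := by
  rw [orthonormal_iff_ite]
  intro k l
  rw [inner_hermiteL2, ← integral_hermiteN_mul]
  refine integral_congr_ae ?_
  filter_upwards [coeFn_hermiteL2 l] with x hx
  rw [hx, mul_comm]

theorem eigenvalue_pos {k : Fin d → ℕ} (hk : k ≠ 0) : 0 < eigenvalue k := by
  obtain ⟨i, hi⟩ : ∃ i, k i ≠ 0 := by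
    by_contra! h
    exact hk (funext h)
  have h1 : (k i : ℝ) ≤ ∑ j, (k j : ℝ) :=
    Finset.single_le_sum (f := fun j => (k j : ℝ)) (fun _ _ => by positivity) (Finset.mem_univ i)
  have h2 : (0 : ℝ) < k i := by positivity
  unfold eigenvalue
  linarith

theorem two_mul_le_eigenvalue (k : Fin d → ℕ) (i : Fin d) : 2 * (k i : ℝ) ≤ eigenvalue k := by
  have h1 : (k i : ℝ) ≤ ∑ j, (k j : ℝ) :=
    Finset.single_le_sum (f := fun j => (k j : ℝ)) (fun _ _ => by positivity) (Finset.mem_univ i)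
  unfold eigenvalue
  linarith

theorem eigenvalue_nonneg (k : Fin d → ℕ) : 0 ≤ eigenvalue k := by
  unfold eigenvalue
  positivity

theorem eigenvalue_lower {k : Fin d → ℕ} {i : Fin d} (h : k i ≠ 0) :
    eigenvalue (lower k i) + 2 = eigenvalue k := by
  have h1 : ∑ j, (k j : ℝ) = (k i : ℝ) + ∑ j ∈ Finset.univ.erase i, (k j : ℝ) :=
    (Finset.add_sum_erase _ _ (Finset.mem_univ i)).symm
  have h2 : ∑ j, (lower k i j : ℝ) =
      (lower k i i : ℝ) + ∑ j ∈ Finset.univ.erase i, (lower k i j : ℝ) :=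
    (Finset.add_sum_erase _ _ (Finset.mem_univ i)).symm
  have h3 : ∑ j ∈ Finset.univ.erase i, (lower k i j : ℝ) =
      ∑ j ∈ Finset.univ.erase i, (k j : ℝ) :=
    Finset.sum_congr rfl fun j hj => by
      rw [lower, Function.update_of_ne (Finset.ne_of_mem_erase hj)]
  have h4 : (lower k i i : ℝ) + 1 = k i := by
    simp only [lower, Function.update_self]
    exact_mod_cast Nat.succ_pred_eq_of_ne_zero h
  rw [eigenvalue, eigenvalue, h1, h2, h3]
  linarith

/-- Every partial sum of the Riesz transform series is a contraction of `L²(μ)`: the functions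
`∂ᵢ H̃_k` are orthogonal with norms `√(2 kᵢ) ≤ √λ_k`, so this is Bessel's inequality. -/
theorem eLpNorm_rieszPartialSum_le {f : (Fin d → ℝ) → ℝ} (hf : MemLp f 2 (mu d)) (i : Fin d)
    (s : Finset {k : Fin d → ℕ // k ≠ 0}) :
    eLpNorm (rieszPartialSum f i s) 2 (mu d) ≤ eLpNorm f 2 (mu d) := by
  classical
  set F : Lp ℝ 2 (mu d) := hf.toLp f with hF
  set a : (Fin d → ℕ) → ℝ := fun k => ∫ y, f y * hermiteN k y ∂mu d with ha
  have haF : ∀ k, a k = inner ℝ (hermiteL2 k) F := by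
    intro k
    rw [inner_hermiteL2]
    refine integral_congr_ae ?_
    filter_upwards [hf.coeFn_toLp] with x hx
    rw [hF, hx]
  set b : (Fin d → ℕ) → ℝ := fun k => eigenvalue k ^ (-(1 / 2 : ℝ)) * a k * √(2 * (k i : ℝ))
    with hb
  set s' := s.filter fun k => k.1 i ≠ 0 with hs'
  set G : Lp ℝ 2 (mu d) := ∑ k ∈ s', b k.1 • hermiteL2 (lower k.1 i) with hG
  have hGae : G =ᵐ[mu d] rieszPartialSum f i s := by
    have h1 : ⇑G =ᵐ[mu d] ∑ k ∈ s', ⇑(b k.1 • hermiteL2 (lower k.1 i)) := by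
      rw [hG]
      exact Lp.coeFn_finsetSum _ _
    refine h1.trans ?_
    have h2 : ∀ᵐ x ∂mu d, ∀ k ∈ s', (b k.1 • hermiteL2 (lower k.1 i) : Lp ℝ 2 (mu d)) x =
        b k.1 * hermiteN (lower k.1 i) x := by
      rw [Finset.eventually_all]
      intro k _
      filter_upwards [Lp.coeFn_smul (b k.1) (hermiteL2 (lower k.1 i)),
        coeFn_hermiteL2 (lower k.1 i)] with x h1 h2
      rw [h1, Pi.smul_apply, h2, smul_eq_mul]
    filter_upwards [h2] with x hx
    rw [Finset.sum_apply, Finset.sum_congr rfl hx, rieszPartialSum, hs', Finset.sum_filter]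
    refine Finset.sum_congr rfl fun k _ => ?_
    rw [delta_hermiteN_eq]
    split_ifs with hk
    · rw [hb, ha]
      ring
    · have h0 : k.1 i = 0 := not_not.1 hk
      simp [h0]
  have hnorm : ‖G‖ ^ 2 ≤ ‖F‖ ^ 2 := by
    have hinj : Set.InjOn (fun k : {k : Fin d → ℕ // k ≠ 0} => lower k.1 i) s' := by
      intro k hk l hl h
      rw [hs', Finset.mem_coe, Finset.mem_filter] at hk hl
      exact Subtype.ext (lower_inj hk.2 hl.2 h)
    have horth : ‖G‖ ^ 2 = ∑ k ∈ s', b k.1 ^ 2 := by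
      have ho : Orthonormal ℝ fun k : s' => (hermiteL2 (lower k.1.1 i) : Lp ℝ 2 (mu d)) :=
        orthonormal_hermiteL2.comp (fun k : s' => lower k.1.1 i) fun k l h =>
          Subtype.ext (hinj k.2 l.2 h)
      have hG' : G = ∑ k : s', b k.1.1 • hermiteL2 (lower k.1.1 i) := by
        rw [hG, ← Finset.sum_coe_sort]
      rw [← real_inner_self_eq_norm_sq, hG', ho.inner_sum, ← Finset.sum_coe_sort s']
      exact Finset.sum_congr rfl fun k _ => by simp [sq]
    rw [horth]
    calc ∑ k ∈ s', b k.1 ^ 2 ≤ ∑ k ∈ s', ‖inner ℝ (hermiteL2 k.1) F‖ ^ 2 := by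
          refine Finset.sum_le_sum fun k _ => ?_
          rw [← haF, Real.norm_eq_abs, sq_abs, hb]
          have hp := eigenvalue_pos k.2
          have e1 : (eigenvalue k.1 ^ (-(1 / 2 : ℝ))) ^ 2 = (eigenvalue k.1)⁻¹ := by
            rw [← Real.rpow_natCast, ← Real.rpow_mul hp.le]
            norm_num
            exact Real.rpow_neg_one _
          have e2 : √(2 * (k.1 i : ℝ)) ^ 2 = 2 * (k.1 i : ℝ) := Real.sq_sqrt (by positivity)
          rw [mul_pow, mul_pow, e1, e2]
          have e3 : (eigenvalue k.1)⁻¹ * (2 * (k.1 i : ℝ)) ≤ 1 := by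
            rw [inv_mul_le_iff₀ hp, mul_one]
            exact two_mul_le_eigenvalue _ _
          nlinarith [sq_nonneg (a k.1)]
      _ = ∑ k ∈ s'.map (Function.Embedding.subtype _), ‖inner ℝ (hermiteL2 k) F‖ ^ 2 := by
          rw [Finset.sum_map]
          rfl
      _ ≤ ‖F‖ ^ 2 := orthonormal_hermiteL2.sum_inner_products_le F
  have h1 : ‖G‖ ≤ ‖F‖ := abs_le_of_sq_le_sq' hnorm (norm_nonneg _) |>.2
  rw [← eLpNorm_congr_ae hGae, ← Lp.enorm_def, ← eLpNorm_congr_ae hf.coeFn_toLp, ← Lp.enorm_def]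
  exact enorm_le_iff_norm_le.2 h1

/-! ### Hessian estimates and the calculus of functions of time and space -/

/-- Lower bound for the Hessian of the coupling term `v z`, where `z = √(u² + w²)` and `w = v^r`,
for `u = |ζ|` and `v = |η|` in the direction `(ζ', η')`: `X = |ζ'|²`, `Y = |η'|²`, and `α`, `β` are
the components of `ζ'`, `η'` along `ζ`, `η`. Only the mixed term in `α β` can be negative. -/
theorem hess_sqrt_lower {r u v w z X Y α β : ℝ} (hr : 0 < r) (hr1 : r ≤ 1) (hu : 0 ≤ u) (hv : 0 < v)
    (hw : 0 < w) (hz : 0 < z) (hzz : z ^ 2 = u ^ 2 + w ^ 2) (hβ : β ^ 2 ≤ Y) :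
    v / z * (X - α ^ 2) + v * w ^ 2 / z ^ 3 * α ^ 2 - 2 * (u / z) * |α * β| ≤
      (Y - β ^ 2) / v * z + 2 * β * ((u * α + r * (w ^ 2 / v) * β) / z) +
      v * ((X + r * (w ^ 2 / v ^ 2) * (Y - (2 - 2 * r) * β ^ 2)) / z -
        (u * α + r * (w ^ 2 / v) * β) ^ 2 / z ^ 3) := by
  have key : (Y - β ^ 2) / v * z + 2 * β * ((u * α + r * (w ^ 2 / v) * β) / z) +
      v * ((X + r * (w ^ 2 / v ^ 2) * (Y - (2 - 2 * r) * β ^ 2)) / z -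
        (u * α + r * (w ^ 2 / v) * β) ^ 2 / z ^ 3) -
      (v / z * (X - α ^ 2) + v * w ^ 2 / z ^ 3 * α ^ 2 - 2 * (u / z) * |α * β|) =
      ((Y - β ^ 2) * (z ^ 4 + r * w ^ 2 * z ^ 2) / v +
        β ^ 2 * (r * (2 * r + 1) * w ^ 2 * u ^ 2 + r * (1 + r) * w ^ 4) / v +
        2 * u * (z ^ 2 * (|α * β| + α * β) - r * w ^ 2 * (α * β))) / z ^ 3 := by
    field_simp
    rw [hzz]
    ring
  have h1 : 0 ≤ z ^ 2 * (|α * β| + α * β) - r * w ^ 2 * (α * β) := by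
    have hrw : r * w ^ 2 ≤ z ^ 2 := by nlinarith [sq_nonneg u, sq_nonneg w]
    rcases le_total 0 (α * β) with h | h
    · rw [abs_of_nonneg h]
      nlinarith [mul_le_mul_of_nonneg_right hrw h, mul_nonneg (sq_nonneg z) h]
    · rw [abs_of_nonpos h]
      nlinarith [mul_nonneg (mul_nonneg hr.le (sq_nonneg w)) (neg_nonneg.2 h)]
  have h2 : 0 ≤ Y - β ^ 2 := by linarith
  have h3 : 0 ≤ ((Y - β ^ 2) * (z ^ 4 + r * w ^ 2 * z ^ 2) / v +
        β ^ 2 * (r * (2 * r + 1) * w ^ 2 * u ^ 2 + r * (1 + r) * w ^ 4) / v +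
        2 * u * (z ^ 2 * (|α * β| + α * β) - r * w ^ 2 * (α * β))) / z ^ 3 := by
    positivity
  linarith

/-- Lower bound for the Hessian of the whole Bellman function, in the notation of `hess_sqrt_lower`
and with `P = u^{p-2}`. A multiple of `(v / w) X` comes from `u^p` where `w ≤ u` (there
`P ≥ v / w`), and from the coupling term where `u ≤ w`. -/
theorem hess_bellman_lower {p r u v w z P X Y α β : ℝ} (hp : 2 ≤ p) (hr : 0 < r) (hr1 : r ≤ 1)
    (hu : 0 ≤ u) (hv : 0 < v) (hw : 0 < w) (hz : 0 < z) (hzz : z ^ 2 = u ^ 2 + w ^ 2)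
    (hP : 0 ≤ P) (hPw : w ≤ u → v / w ≤ P) (hα : α ^ 2 ≤ X) (hβ : β ^ 2 ≤ Y) :
    r / 9 * (v / w / 4 * X + Y / (v / w / 4)) ≤
      r / 12 * P * (X + (p - 2) * α ^ 2) + w / v * (Y - (1 - r) * β ^ 2) +
      r / 6 * ((Y - β ^ 2) / v * z + 2 * β * ((u * α + r * (w ^ 2 / v) * β) / z) +
        v * ((X + r * (w ^ 2 / v ^ 2) * (Y - (2 - 2 * r) * β ^ 2)) / z -
        (u * α + r * (w ^ 2 / v) * β) ^ 2 / z ^ 3)) := by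
  have h0 := hess_sqrt_lower (X := X) (α := α) hr hr1 hu hv hw hz hzz hβ
  set κ := v / w with hκ
  set θ := w / z with hθ
  have hκ0 : 0 < κ := div_pos hv hw
  have hθ0 : 0 < θ := div_pos hw hz
  set m := u / z with hm
  have hm0 : 0 ≤ m := div_nonneg hu hz.le
  have hmθ : m ^ 2 + θ ^ 2 = 1 := by
    rw [hm, hθ, div_pow, div_pow, ← add_div, ← hzz, div_self (by positivity)]
  have e1 : v / z = κ * θ := by rw [hκ, hθ]; field_simp
  have e2 : v * w ^ 2 / z ^ 3 = κ * θ ^ 3 := by rw [hκ, hθ]; field_simp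
  have e3 : w / v = κ⁻¹ := by rw [hκ, inv_div]
  have e4 : Y / (κ / 4) = 4 * (κ⁻¹ * Y) := by field_simp
  rw [e1, e2] at h0
  rw [e3, e4]
  have hκi : 0 < κ⁻¹ := inv_pos.2 hκ0
  have hY : r * Y ≤ Y - (1 - r) * β ^ 2 := by
    linarith [mul_le_mul_of_nonneg_left hβ (sub_nonneg.2 hr1)]
  have hY' := mul_le_mul_of_nonneg_left hY hκi.le
  -- Young's inequality for the mixed term
  have hyoung : r / 3 * (m * |α * β|) ≤
      5 / 9 * (r * (κ⁻¹ * β ^ 2)) + r / 20 * (κ * (m ^ 2 * α ^ 2)) := by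
    have hs : 0 ≤ κ⁻¹ * (10 * |β| - 3 * (κ * (m * |α|))) ^ 2 := by positivity
    have hs2 : κ⁻¹ * (10 * |β| - 3 * (κ * (m * |α|))) ^ 2 =
        100 * (κ⁻¹ * β ^ 2) - 60 * (m * |α * β|) + 9 * (κ * (m ^ 2 * α ^ 2)) := by
      rw [abs_mul, ← sq_abs α, ← sq_abs β]
      field_simp
      ring
    rw [hs2] at hs
    have := mul_le_mul_of_nonneg_left hs hr.le
    linarith
  have hβY := mul_le_mul_of_nonneg_left hβ (mul_pos hr hκi).le
  have hα0 := sq_nonneg α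
  have hX0 : 0 ≤ X - α ^ 2 := by linarith
  have hmain : κ / 36 * X ≤ 1 / 12 * P * (X + (p - 2) * α ^ 2) +
      1 / 6 * (κ * θ * (X - α ^ 2) + κ * θ ^ 3 * α ^ 2) - 1 / 20 * (κ * (m ^ 2 * α ^ 2)) := by
    have hPp : 0 ≤ P * ((p - 2) * α ^ 2) :=
      mul_nonneg hP (mul_nonneg (by linarith) hα0)
    have hX : 0 ≤ X := by linarith
    rcases le_total w u with h | h
    · have hPκ := mul_le_mul_of_nonneg_right (hPw h) hX
      have hm1 : m ^ 2 ≤ 1 := by linarith [sq_nonneg θ]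
      have h2 : κ * (m ^ 2 * α ^ 2) ≤ κ * X := by
        refine mul_le_mul_of_nonneg_left ?_ hκ0.le
        linarith [mul_le_mul_of_nonneg_right hm1 hα0]
      have h3 : 0 ≤ κ * θ * (X - α ^ 2) + κ * θ ^ 3 * α ^ 2 := by positivity
      have h4 : 0 ≤ κ * X := by positivity
      linarith
    · have hθ2 : 1 / 2 ≤ θ ^ 2 := by
        have : m ≤ θ := by rw [hm, hθ]; gcongr
        have := mul_self_le_mul_self hm0 this
        linarith
      have hθ7 : 7 / 10 ≤ θ := by
        by_contra! h'
        have := mul_self_lt_mul_self hθ0.le h'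
        linarith
      have h3 : 7 / 20 ≤ θ ^ 3 := by
        have := mul_le_mul hθ2 hθ7 (by norm_num) (sq_nonneg θ)
        linarith
      have hPX : 0 ≤ P * X := mul_nonneg hP hX
      have a1 : 0 ≤ κ * (X - α ^ 2) * (θ / 6 - 1 / 36) :=
        mul_nonneg (by positivity) (by linarith)
      have a2 : 0 ≤ κ * α ^ 2 * (θ ^ 3 / 6 - m ^ 2 / 20 - 1 / 36) :=
        mul_nonneg (by positivity) (by linarith)
      linarith
  have hmain' := mul_le_mul_of_nonneg_left hmain hr.le
  have h0' := mul_le_mul_of_nonneg_left h0 (by positivity : 0 ≤ r / 6)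
  linarith

/-- The coordinate directions of `ℝ × ℝ^d`: `none` is the time direction. -/
def dir : Option (Fin d) → ℝ × (Fin d → ℝ)
  | none => (1, 0)
  | some i => (0, Pi.single i 1)

/-- Continuous functions of time and space of at most exponential growth in space, uniformly for
times in `(-1, ∞)`. The interval contains a neighbourhood of the initial time `0`. -/
abbrev Tame (f : ℝ × (Fin d → ℝ) → ℝ) : Prop :=
  ExpGrowth {z : ℝ × (Fin d → ℝ) | -1 < z.1} Prod.snd f

/-- `f' j` and `f'' j` are the first and second partial derivatives of `f` in the direction `dir j`
(no mixed derivatives), and all these functions are tame. -/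
structure TameJet (f : ℝ × (Fin d → ℝ) → ℝ) (f' f'' : Option (Fin d) → ℝ × (Fin d → ℝ) → ℝ) :
    Prop where
  tame : Tame f
  tame1 : ∀ j, Tame (f' j)
  tame2 : ∀ j, Tame (f'' j)
  deriv1 : ∀ j z, HasLineDerivAt ℝ f (f' j z) z (dir j)
  deriv2 : ∀ j z, HasLineDerivAt ℝ (f' j) (f'' j z) z (dir j)

section LineDeriv

variable {E : Type*} [AddCommGroup E] [Module ℝ E] {f g : E → ℝ} {a b : ℝ} {z v : E}

theorem lineDeriv_mul (hf : HasLineDerivAt ℝ f a z v) (hg : HasLineDerivAt ℝ g b z v) :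
    HasLineDerivAt ℝ (fun z => f z * g z) (a * g z + f z * b) z v := by
  have := HasDerivAt.fun_mul hf hg
  unfold HasLineDerivAt
  simpa only [zero_smul, add_zero] using this

theorem lineDeriv_rpow (hf : HasLineDerivAt ℝ f a z v) (h0 : f z ≠ 0) (e : ℝ) :
    HasLineDerivAt ℝ (fun z => f z ^ e) (e * f z ^ (e - 1) * a) z v := by
  have h := HasDerivAt.rpow_const (p := e) hf (Or.inl (by simpa using h0))
  unfold HasLineDerivAt
  simp only [zero_smul, add_zero] at h
  exact h.congr_deriv (by ring)

end LineDeriv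

namespace TameJet

variable {f g : ℝ × (Fin d → ℝ) → ℝ} {f' f'' g' g'' : Option (Fin d) → ℝ × (Fin d → ℝ) → ℝ}

theorem const (a : ℝ) : TameJet (fun _ : ℝ × (Fin d → ℝ) => a) (fun _ _ => 0) (fun _ _ => 0) where
  tame := .const a
  tame1 _ := .const 0
  tame2 _ := .const 0
  deriv1 _ _ := hasDerivAt_const _ _
  deriv2 _ _ := hasDerivAt_const _ _

theorem add (hf : TameJet f f' f'') (hg : TameJet g g' g'') :
    TameJet (fun z => f z + g z) (fun j z => f' j z + g' j z) (fun j z => f'' j z + g'' j z) where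
  tame := hf.tame.add hg.tame
  tame1 j := (hf.tame1 j).add (hg.tame1 j)
  tame2 j := (hf.tame2 j).add (hg.tame2 j)
  deriv1 j z := HasDerivAt.fun_add (hf.deriv1 j z) (hg.deriv1 j z)
  deriv2 j z := HasDerivAt.fun_add (hf.deriv2 j z) (hg.deriv2 j z)

theorem mul (hf : TameJet f f' f'') (hg : TameJet g g' g'') :
    TameJet (fun z => f z * g z) (fun j z => f' j z * g z + f z * g' j z)
      (fun j z => (f'' j z * g z + f' j z * g' j z) + (f' j z * g' j z + f z * g'' j z)) where
  tame := hf.tame.mul hg.tame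
  tame1 j := ((hf.tame1 j).mul hg.tame).add (hf.tame.mul (hg.tame1 j))
  tame2 j := (((hf.tame2 j).mul hg.tame).add ((hf.tame1 j).mul (hg.tame1 j))).add
    (((hf.tame1 j).mul (hg.tame1 j)).add (hf.tame.mul (hg.tame2 j)))
  deriv1 j z := lineDeriv_mul (hf.deriv1 j z) (hg.deriv1 j z)
  deriv2 j z := HasDerivAt.fun_add (lineDeriv_mul (hf.deriv2 j z) (hg.deriv1 j z))
    (lineDeriv_mul (hf.deriv1 j z) (hg.deriv2 j z))

theorem const_mul (a : ℝ) (hf : TameJet f f' f'') :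
    TameJet (fun z => a * f z) (fun j z => a * f' j z) (fun j z => a * f'' j z) where
  tame := hf.tame.const_mul a
  tame1 j := (hf.tame1 j).const_mul a
  tame2 j := (hf.tame2 j).const_mul a
  deriv1 j z := HasDerivAt.const_mul a (hf.deriv1 j z)
  deriv2 j z := HasDerivAt.const_mul a (hf.deriv2 j z)

theorem rpow (hf : TameJet f f' f'') {m : ℝ} (hm : 0 < m) (hfm : ∀ z, m ≤ f z) (a : ℝ) :
    TameJet (fun z => f z ^ a) (fun j z => a * f z ^ (a - 1) * f' j z)
      (fun j z => a * ((a - 1) * f z ^ (a - 1 - 1) * f' j z) * f' j z +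
        a * f z ^ (a - 1) * f'' j z) where
  tame := hf.tame.rpow hm hfm a
  tame1 j := ((hf.tame.rpow hm hfm _).const_mul _).mul (hf.tame1 j)
  tame2 j := (((((hf.tame.rpow hm hfm _).const_mul _).mul (hf.tame1 j)).const_mul a).mul
    (hf.tame1 j)).add (((hf.tame.rpow hm hfm _).const_mul _).mul (hf.tame2 j))
  deriv1 j z := lineDeriv_rpow (hf.deriv1 j z) (hm.trans_le (hfm z)).ne' a
  deriv2 j z := lineDeriv_mul (HasDerivAt.const_mul a
    (lineDeriv_rpow (hf.deriv1 j z) (hm.trans_le (hfm z)).ne' (a - 1))) (hf.deriv2 j z)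

theorem sum {ι : Type*} (t : Finset ι) {F : ι → ℝ × (Fin d → ℝ) → ℝ}
    {F' F'' : ι → Option (Fin d) → ℝ × (Fin d → ℝ) → ℝ} (h : ∀ i ∈ t, TameJet (F i) (F' i) (F'' i)) :
    TameJet (fun z => ∑ i ∈ t, F i z) (fun j z => ∑ i ∈ t, F' i j z)
      (fun j z => ∑ i ∈ t, F'' i j z) := by
  classical
  induction t using Finset.induction_on with
  | empty => simpa using const 0
  | insert a t ha ih =>
    simp only [Finset.sum_insert ha]
    exact (h a (Finset.mem_insert_self a t)).add
      (ih fun i hi => h i (Finset.mem_insert_of_mem hi))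

end TameJet

/-- A Bellman function `Φ(S, T)` of the squared lengths `S = |ζ|²` and `T = |η|²`, with partial
derivatives `ΦS` and `ΦT`. The field `jet` gives the second derivatives of `Φ(S, T)` along
coordinate lines together with their lower bound: `X` and `Y` stand for `|∂ⱼζ|²` and `|∂ⱼη|²`, and
`S'' - 2X` and `T'' - 2Y` are the contributions of the second derivatives of `ζ` and `η`. -/
structure IsBellman (d : ℕ) (p q c : ℝ) (Φ ΦS ΦT τ : ℝ → ℝ → ℝ) : Prop where
  tau_pos : ∀ {S T}, 0 < S → 0 < T → 0 < τ S T
  gradS_nonneg : ∀ {S T}, 0 < S → 0 < T → 0 ≤ ΦS S T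
  gradT_nonneg : ∀ {S T}, 0 < S → 0 < T → 0 ≤ ΦT S T
  nonneg : ∀ {S T}, 0 < S → 0 < T → 0 ≤ Φ S T
  le : ∃ a b, 0 ≤ a ∧ 0 ≤ b ∧ a + b ≤ 4 / 3 ∧
    ∀ {S T}, 0 < S → 0 < T → Φ S T ≤ a * S ^ (p / 2) + b * T ^ (q / 2)
  jet : ∀ {S T : ℝ × (Fin d → ℝ) → ℝ} {S' S'' T' T'' : Option (Fin d) → ℝ × (Fin d → ℝ) → ℝ}
    {m : ℝ}, TameJet S S' S'' → TameJet T T' T'' → 0 < m → (∀ z, m ≤ S z) → (∀ z, m ≤ T z) →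
    ∃ H'' : Option (Fin d) → ℝ × (Fin d → ℝ) → ℝ,
      TameJet (fun z => Φ (S z) (T z))
        (fun j z => ΦS (S z) (T z) * S' j z + ΦT (S z) (T z) * T' j z) H'' ∧
      ∀ j z X Y, S' j z ^ 2 ≤ 4 * S z * X → T' j z ^ 2 ≤ 4 * T z * Y →
        c * (τ (S z) (T z) * X + Y / τ (S z) (T z)) + ΦS (S z) (T z) * (S'' j z - 2 * X) +
          ΦT (S z) (T z) * (T'' j z - 2 * Y) ≤ H'' j z

theorem IsBellman.swap {p q c : ℝ} {Φ ΦS ΦT τ : ℝ → ℝ → ℝ} (h : IsBellman d p q c Φ ΦS ΦT τ) :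
    IsBellman d q p c (fun S T => Φ T S) (fun S T => ΦT T S) (fun S T => ΦS T S)
      (fun S T => (τ T S)⁻¹) where
  tau_pos hS hT := inv_pos.2 (h.tau_pos hT hS)
  gradS_nonneg hS hT := h.gradT_nonneg hT hS
  gradT_nonneg hS hT := h.gradS_nonneg hT hS
  nonneg hS hT := h.nonneg hT hS
  le := by
    obtain ⟨a, b, ha, hb, hab, H⟩ := h.le
    exact ⟨b, a, hb, ha, by linarith, fun hS hT => by linarith [H hT hS]⟩
  jet hS hT hm hmS hmT := by
    obtain ⟨H'', h1, h2⟩ := h.jet hT hS hm hmT hmS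
    refine ⟨H'', by simpa only [add_comm] using h1, fun j z X Y hX hY => ?_⟩
    have := h2 j z Y X hY hX
    rw [div_inv_eq_mul, inv_mul_eq_div]
    linarith

/-! ### The Bellman function -/

/-- The Bellman function in terms of the squared lengths `S = u²`, `T = v²`, for `p ≥ 2` and
`r = 1 / (p - 1)`: a multiple of `u^p`, a multiple of `v^{p/(p-1)}`, and the coupling term
`v * √(u² + v^{2r})`. -/
noncomputable def bellman (p r S T : ℝ) : ℝ :=
  r / (12 * p) * S ^ (p / 2) + (1 + r)⁻¹ * T ^ ((1 + r) / 2) +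
    r / 6 * (T ^ (1 / 2 : ℝ) * (S + T ^ r) ^ (1 / 2 : ℝ))

/-- The derivative of `bellman` in `S`. -/
noncomputable def bellmanS (p r S T : ℝ) : ℝ :=
  r / 24 * S ^ (p / 2 - 1) + r / 12 * (T ^ (1 / 2 : ℝ) * (S + T ^ r) ^ (1 / 2 - 1 : ℝ))

/-- The derivative of `bellman` in `T`. -/
noncomputable def bellmanT (r S T : ℝ) : ℝ :=
  1 / 2 * T ^ ((1 + r) / 2 - 1) +
    r / 12 * (T ^ (1 / 2 - 1 : ℝ) * (S + T ^ r) ^ (1 / 2 : ℝ) +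
      T ^ (1 / 2 : ℝ) * (S + T ^ r) ^ (1 / 2 - 1 : ℝ) * (r * T ^ (r - 1)))

/-- The weight that balances the two diagonal parts of the Hessian of `bellman`. -/
noncomputable def bellmanTau (r _S T : ℝ) : ℝ := T ^ ((1 - r) / 2) / 4

theorem bellman_hess_lower {p r S T S1 T1 S2 T2 X Y : ℝ} (hp : 2 ≤ p) (hpr : r * (p - 1) = 1)
    (hS : 0 < S) (hT : 0 < T) (hX : S1 ^ 2 ≤ 4 * S * X) (hY : T1 ^ 2 ≤ 4 * T * Y) :
    r / 9 * (bellmanTau r S T * X + Y / bellmanTau r S T) + bellmanS p r S T * (S2 - 2 * X) +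
      bellmanT r S T * (T2 - 2 * Y) ≤
    r / (12 * p) * (p / 2 * ((p / 2 - 1) * S ^ (p / 2 - 1 - 1) * S1) * S1 +
        p / 2 * S ^ (p / 2 - 1) * S2) +
      (1 + r)⁻¹ * ((1 + r) / 2 * (((1 + r) / 2 - 1) * T ^ ((1 + r) / 2 - 1 - 1) * T1) * T1 +
        (1 + r) / 2 * T ^ ((1 + r) / 2 - 1) * T2) +
      r / 6 * (((1 / 2 * ((1 / 2 - 1) * T ^ (1 / 2 - 1 - 1 : ℝ) * T1) * T1 +
            1 / 2 * T ^ (1 / 2 - 1 : ℝ) * T2) * (S + T ^ r) ^ (1 / 2 : ℝ) +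
          1 / 2 * T ^ (1 / 2 - 1 : ℝ) * T1 *
            (1 / 2 * (S + T ^ r) ^ (1 / 2 - 1 : ℝ) * (S1 + r * T ^ (r - 1) * T1))) +
        (1 / 2 * T ^ (1 / 2 - 1 : ℝ) * T1 *
            (1 / 2 * (S + T ^ r) ^ (1 / 2 - 1 : ℝ) * (S1 + r * T ^ (r - 1) * T1)) +
          T ^ (1 / 2 : ℝ) *
            (1 / 2 * ((1 / 2 - 1) * (S + T ^ r) ^ (1 / 2 - 1 - 1 : ℝ) *
              (S1 + r * T ^ (r - 1) * T1)) * (S1 + r * T ^ (r - 1) * T1) +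
            1 / 2 * (S + T ^ r) ^ (1 / 2 - 1 : ℝ) *
              (S2 + (r * ((r - 1) * T ^ (r - 1 - 1) * T1) * T1 + r * T ^ (r - 1) * T2))))) := by
  have hr : 0 < r := by
    by_contra! h
    nlinarith
  have hr1 : r ≤ 1 := by nlinarith
  obtain ⟨u, hu, rfl⟩ : ∃ u, 0 < u ∧ S = u ^ 2 := ⟨√S, by positivity, (Real.sq_sqrt hS.le).symm⟩
  obtain ⟨v, hv, rfl⟩ : ∃ v, 0 < v ∧ T = v ^ 2 := ⟨√T, by positivity, (Real.sq_sqrt hT.le).symm⟩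
  have hpow : ∀ {a : ℝ}, 0 < a → ∀ e : ℝ, (a ^ 2) ^ e = a ^ (2 * e) := by
    intro a ha e
    rw [← Real.rpow_natCast, ← Real.rpow_mul ha.le]
    norm_num
  set w := v ^ r with hw
  have hw0 : 0 < w := Real.rpow_pos_of_pos hv r
  set P := u ^ (p - 2) with hP
  have hP0 : 0 < P := Real.rpow_pos_of_pos hu _
  have eS : (u ^ 2 : ℝ) ^ (p / 2) = P * u ^ 2 := by
    rw [hpow hu, hP, ← Real.rpow_natCast, ← Real.rpow_add hu]
    congr 1
    push_cast
    ring
  have eT : (v ^ 2 : ℝ) ^ ((1 + r) / 2) = v * w := by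
    rw [hpow hv, mul_div_cancel₀ _ two_ne_zero, Real.rpow_add hv, Real.rpow_one]
  have eTr : (v ^ 2 : ℝ) ^ r = w ^ 2 := by
    rw [hpow hv, hw, two_mul, Real.rpow_add hv, sq]
  have eh : ∀ {a : ℝ}, 0 < a → (a ^ 2 : ℝ) ^ (1 / 2 : ℝ) = a := by
    intro a ha
    rw [hpow ha]
    norm_num
  have eτ : bellmanTau r (u ^ 2) (v ^ 2) = v / w / 4 := by
    rw [bellmanTau, hpow hv, mul_div_cancel₀ _ two_ne_zero, Real.rpow_sub hv, Real.rpow_one]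
  have hZ : 0 < u ^ 2 + w ^ 2 := by positivity
  obtain ⟨z, hz, hzz⟩ : ∃ z, 0 < z ∧ u ^ 2 + w ^ 2 = z ^ 2 :=
    ⟨√(u ^ 2 + w ^ 2), by positivity, (Real.sq_sqrt hZ.le).symm⟩
  have hPw : w ≤ u → v / w ≤ P := by
    intro h
    have h1 : v / w = w ^ (p - 2) := by
      have h2 : v / w = v ^ (1 - r) := by rw [Real.rpow_sub hv, Real.rpow_one]
      rw [h2, hw, ← Real.rpow_mul hv.le]
      congr 1
      linarith
    rw [h1]
    exact Real.rpow_le_rpow hw0.le h (by linarith)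
  obtain ⟨α, rfl⟩ : ∃ α, S1 = 2 * u * α := ⟨S1 / (2 * u), by field_simp⟩
  obtain ⟨β, rfl⟩ : ∃ β, T1 = 2 * v * β := ⟨T1 / (2 * v), by field_simp⟩
  have hα : α ^ 2 ≤ X := by
    have : 0 < 4 * u ^ 2 := by positivity
    exact le_of_mul_le_mul_left (by linarith : 4 * u ^ 2 * α ^ 2 ≤ 4 * u ^ 2 * X) this
  have hβ : β ^ 2 ≤ Y := by
    have : 0 < 4 * v ^ 2 := by positivity
    exact le_of_mul_le_mul_left (by linarith : 4 * v ^ 2 * β ^ 2 ≤ 4 * v ^ 2 * Y) this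
  have key := hess_bellman_lower (p := p) (r := r) hp hr hr1 hu.le hv hw0 hz hzz.symm hP0.le hPw
    hα hβ
  have hu2 : (u ^ 2 : ℝ) ≠ 0 := by positivity
  have hv2 : (v ^ 2 : ℝ) ≠ 0 := by positivity
  have hz2 : (z ^ 2 : ℝ) ≠ 0 := by positivity
  have hp0 : p ≠ 0 := by linarith
  have h1r : 1 + r ≠ 0 := by positivity
  rw [eτ]
  simp only [bellmanS, bellmanT, eTr, hzz, Real.rpow_sub_one hu2, Real.rpow_sub_one hv2,
    Real.rpow_sub_one hz2, eS, eT, eh hv, eh hz]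
  rw [add_assoc, ← le_sub_iff_add_le]
  refine key.trans (le_of_eq ?_)
  field_simp
  ring

theorem bellman_nonneg {p r S T : ℝ} (hp : 0 < p) (hr : 0 < r) (hS : 0 < S) (hT : 0 < T) :
    0 ≤ bellman p r S T := by
  unfold bellman
  positivity

theorem bellman_le {p r S T : ℝ} (hp : 2 ≤ p) (hpr : r * (p - 1) = 1) (hS : 0 < S) (hT : 0 < T) :
    bellman p r S T ≤ 1 / 8 * S ^ (p / 2) + 1 * T ^ ((1 + r) / 2) := by
  have hr : 0 < r := by
    by_contra! h
    nlinarith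
  have hr1 : r ≤ 1 := by nlinarith
  set u := S ^ (1 / 2 : ℝ) with hu
  set v := T ^ (1 / 2 : ℝ) with hv
  have hu0 : 0 ≤ u := by positivity
  have hv0 : 0 ≤ v := by positivity
  have eS : S ^ (p / 2) = u ^ p := by rw [hu, ← Real.rpow_mul hS.le]; congr 1; ring
  have eT : T ^ ((1 + r) / 2) = v ^ (1 + r) := by
    rw [hv, ← Real.rpow_mul hT.le]; congr 1; ring
  have hpq : p.HolderConjugate (1 + r) := by
    rw [Real.holderConjugate_iff]
    refine ⟨by linarith, ?_⟩
    have : p ≠ 0 := by linarith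
    have : 1 + r ≠ 0 := by linarith
    field_simp
    linarith
  have hyoung := Real.young_inequality_of_nonneg hu0 hv0 hpq
  have hz : (S + T ^ r) ^ (1 / 2 : ℝ) ≤ u + v ^ r := by
    have := Real.rpow_add_le_add_rpow hS.le (Real.rpow_pos_of_pos hT r).le
      (by norm_num : (0 : ℝ) ≤ 1 / 2) (by norm_num)
    refine this.trans (le_of_eq ?_)
    rw [hu, hv, ← Real.rpow_mul hT.le, ← Real.rpow_mul hT.le, mul_comm r]
  have hvv : v * v ^ r = v ^ (1 + r) := by
    have : 0 < v := by positivity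
    rw [Real.rpow_add this, Real.rpow_one]
  have h1 : v * (S + T ^ r) ^ (1 / 2 : ℝ) ≤ u ^ p / p + v ^ (1 + r) / (1 + r) + v ^ (1 + r) := by
    have := mul_le_mul_of_nonneg_left hz hv0
    rw [mul_add, hvv] at this
    linarith
  have hU : 0 ≤ u ^ p := by positivity
  have hV : 0 ≤ v ^ (1 + r) := by positivity
  rw [bellman, eS, eT]
  have h2 := mul_le_mul_of_nonneg_left h1 (by positivity : 0 ≤ r / 6)
  have c1 : r / (12 * p) + r / 6 / p ≤ 1 / 8 := by
    rw [div_div, div_add_div _ _ (by positivity) (by positivity), div_le_div_iff₀ (by positivity)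
      (by norm_num)]
    nlinarith [mul_le_mul hr1 hp (by norm_num) zero_le_one]
  have c2 : (1 + r)⁻¹ + r / 6 * (1 / (1 + r) + 1) ≤ 1 := by
    have : 0 < 1 + r := by positivity
    field_simp
    nlinarith
  have k1 := mul_le_mul_of_nonneg_right c1 hU
  have k2 := mul_le_mul_of_nonneg_right c2 hV
  have e1 : (r / (12 * p) + r / 6 / p) * u ^ p = r / (12 * p) * u ^ p + r / 6 * (u ^ p / p) := by
    ring
  have e2 : ((1 + r)⁻¹ + r / 6 * (1 / (1 + r) + 1)) * v ^ (1 + r) =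
    (1 + r)⁻¹ * v ^ (1 + r) + r / 6 * (v ^ (1 + r) / (1 + r) + v ^ (1 + r)) := by ring
  rw [e1] at k1
  rw [e2] at k2
  linarith

theorem isBellman_bellman {p r : ℝ} (hp : 2 ≤ p) (hpr : r * (p - 1) = 1) :
    IsBellman d p (1 + r) (r / 9) (bellman p r) (bellmanS p r) (bellmanT r) (bellmanTau r) := by
  have hr : 0 < r := by
    by_contra! h
    nlinarith
  have hp0 : p ≠ 0 := by linarith
  have h1r : 1 + r ≠ 0 := by positivity
  refine ⟨fun {S T} hS hT => ?_, fun {S T} hS hT => ?_, fun {S T} hS hT => ?_,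
    fun {S T} hS hT => bellman_nonneg (by linarith) hr hS hT,
    ⟨1 / 8, 1, by norm_num, by norm_num, by norm_num, fun {S T} hS hT => bellman_le hp hpr hS hT⟩,
    fun {S T S' S'' T' T'' m} hS hT hm hmS hmT => ?_⟩
  · unfold bellmanTau
    positivity
  · unfold bellmanS
    positivity
  · unfold bellmanT
    positivity
  · have hZ : ∀ z, m ≤ S z + T z ^ r := fun z => by
      have : 0 ≤ T z ^ r := Real.rpow_nonneg (hm.le.trans (hmT z)) r
      linarith [hmS z]
    have J := (((hS.rpow hm hmS (p / 2)).const_mul (r / (12 * p))).add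
      ((hT.rpow hm hmT ((1 + r) / 2)).const_mul (1 + r)⁻¹)).add
      (((hT.rpow hm hmT (1 / 2)).mul ((hS.add (hT.rpow hm hmT r)).rpow hm hZ (1 / 2))).const_mul
        (r / 6))
    refine ⟨_, ?_, fun j z X Y hX hY => bellman_hess_lower (S1 := S' j z) (T1 := T' j z) hp hpr
      (hm.trans_le (hmS z)) (hm.trans_le (hmT z)) hX hY⟩
    convert J using 3
    · rfl
    · unfold bellmanS bellmanT
      field_simp
      ring

/-! ### Harmonic extensions of Hermite polynomials -/

/-- The function `e^{-tω} H̃_k(x)` of time and space. -/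
noncomputable def mode (ω : ℝ) (k : Fin d → ℕ) (z : ℝ × (Fin d → ℝ)) : ℝ :=
  Real.exp (-(z.1 * ω)) * hermiteN k z.2

theorem tame_mode {ω : ℝ} (hω : 0 ≤ ω) (k : Fin d → ℕ) : Tame (mode ω k) := by
  have hk := moderate_hermiteN k
  obtain ⟨c, hc, hb⟩ := hk.bound
  refine ⟨?_, ω + c, by positivity, fun z hz => ?_⟩
  · have := hk.continuous
    unfold mode
    fun_prop
  · have hz' : -1 < z.1 := hz
    rw [mode, abs_mul, Real.abs_exp, add_mul, Real.exp_add]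
    refine mul_le_mul (Real.exp_le_exp.2 ?_) (hb z.2 trivial) (abs_nonneg _) (Real.exp_pos _).le
    nlinarith [mul_nonneg hω (norm_nonneg z.2)]

/-- The partial derivatives of `mode ω k`. -/
noncomputable def modeDeriv (ω : ℝ) (k : Fin d → ℕ) : Option (Fin d) → ℝ × (Fin d → ℝ) → ℝ
  | none => fun z => -ω * mode ω k z
  | some i => fun z => √(2 * (k i : ℝ)) * mode ω (lower k i) z

/-- The second partial derivatives of `mode ω k`. -/
noncomputable def modeDeriv2 (ω : ℝ) (k : Fin d → ℕ) : Option (Fin d) → ℝ × (Fin d → ℝ) → ℝ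
  | none => fun z => -ω * modeDeriv ω k none z
  | some i => fun z => √(2 * (k i : ℝ)) * modeDeriv ω (lower k i) (some i) z

theorem hasLineDerivAt_mode (ω : ℝ) (k : Fin d → ℕ) (j : Option (Fin d))
    (z : ℝ × (Fin d → ℝ)) : HasLineDerivAt ℝ (mode ω k) (modeDeriv ω k j z) z (dir j) := by
  obtain ⟨t, x⟩ := z
  cases j with
  | none =>
    have h1 : HasDerivAt (fun s : ℝ => Real.exp (-((t + s) * ω)))
        (Real.exp (-((t + 0) * ω)) * -(1 * ω)) 0 :=
      ((((hasDerivAt_id' (0 : ℝ)).const_add t).mul_const ω).fun_neg).exp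
    have h2 := h1.mul_const (hermiteN k x)
    unfold HasLineDerivAt
    simp only [mode, dir, Prod.smul_mk, Prod.mk_add_mk, smul_eq_mul, mul_one, smul_zero, add_zero]
    refine h2.congr_deriv ?_
    simp only [modeDeriv, mode, add_zero]
    ring
  | some i =>
    have h2 := HasDerivAt.const_mul (Real.exp (-(t * ω))) (hasLineDerivAt_hermiteN k i x)
    unfold HasLineDerivAt
    simp only [mode, dir, Prod.smul_mk, Prod.mk_add_mk, smul_zero, add_zero]
    refine h2.congr_deriv ?_
    simp only [modeDeriv, mode]
    ring

theorem tameJet_mode {ω : ℝ} (hω : 0 ≤ ω) (k : Fin d → ℕ) :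
    TameJet (mode ω k) (modeDeriv ω k) (modeDeriv2 ω k) where
  tame := tame_mode hω k
  tame1
    | none => (tame_mode hω k).const_mul _
    | some _ => (tame_mode hω _).const_mul _
  tame2
    | none => ((tame_mode hω k).const_mul _).const_mul _
    | some _ => ((tame_mode hω _).const_mul _).const_mul _
  deriv1 := hasLineDerivAt_mode ω k
  deriv2
    | none => fun z => HasDerivAt.const_mul (-ω) (hasLineDerivAt_mode ω k none z)
    | some i => fun z => HasDerivAt.const_mul _ (hasLineDerivAt_mode ω (lower k i) (some i) z)

/-- `(∂_t² - L) (e^{-tω} H̃_k) = (ω² - λ_k) e^{-tω} H̃_k`. -/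
theorem mode_equation (ω : ℝ) (k : Fin d → ℕ) (z : ℝ × (Fin d → ℝ)) :
    modeDeriv2 ω k none z +
      ∑ i, (modeDeriv2 ω k (some i) z - 2 * z.2 i * modeDeriv ω k (some i) z) =
      (ω ^ 2 - eigenvalue k) * mode ω k z := by
  have h : ∀ i, modeDeriv2 ω k (some i) z - 2 * z.2 i * modeDeriv ω k (some i) z =
      -(2 * (k i : ℝ)) * mode ω k z := by
    intro i
    simp only [modeDeriv2, modeDeriv, mode]
    by_cases hk : k i = 0
    · simp [hk]
    · have hk1 : ((lower k i) i : ℝ) + 1 = k i := by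
        simp only [lower, Function.update_self]
        exact_mod_cast Nat.succ_pred_eq_of_ne_zero hk
      have hr := hermiteN_raise (lower k i) i z.2
      rw [raise_lower hk, hk1] at hr
      have hs : √(2 * (k i : ℝ)) ^ 2 = 2 * (k i : ℝ) := Real.sq_sqrt (by positivity)
      linear_combination (Real.exp (-(z.1 * ω)) * √(2 * (k i : ℝ))) * hr -
        Real.exp (-(z.1 * ω)) * hermiteN k z.2 * hs
  simp only [h]
  rw [← Finset.sum_mul, modeDeriv2, modeDeriv, eigenvalue, Finset.sum_neg_distrib,
    ← Finset.mul_sum]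
  ring

/-- The Hermite polynomial `∑_k a_k H̃_k`. -/
noncomputable def hermiteSum (a : (Fin d → ℕ) →₀ ℝ) (x : Fin d → ℝ) : ℝ :=
  a.sum fun k c => c * hermiteN k x

/-- The Riesz transform `R_i` of `∑_k a_k H̃_k`. -/
noncomputable def rieszSum (a : (Fin d → ℕ) →₀ ℝ) (i : Fin d) (x : Fin d → ℝ) : ℝ :=
  a.sum fun k c => c * (eigenvalue k ^ (-(1 / 2 : ℝ)) * (√(2 * (k i : ℝ)) *
    hermiteN (lower k i) x))

/-- The extension `e^{-t √(L + κ)} (∑_k a_k H̃_k)` to positive times. -/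
noncomputable def poisson (κ : ℝ) (a : (Fin d → ℕ) →₀ ℝ) (z : ℝ × (Fin d → ℝ)) : ℝ :=
  a.sum fun k c => c * mode (√(eigenvalue k + κ)) k z

/-- The partial derivatives of `poisson κ a`. -/
noncomputable def poissonDeriv (κ : ℝ) (a : (Fin d → ℕ) →₀ ℝ) (j : Option (Fin d))
    (z : ℝ × (Fin d → ℝ)) : ℝ :=
  a.sum fun k c => c * modeDeriv (√(eigenvalue k + κ)) k j z

/-- The second partial derivatives of `poisson κ a`. -/
noncomputable def poissonDeriv2 (κ : ℝ) (a : (Fin d → ℕ) →₀ ℝ) (j : Option (Fin d))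
    (z : ℝ × (Fin d → ℝ)) : ℝ :=
  a.sum fun k c => c * modeDeriv2 (√(eigenvalue k + κ)) k j z

theorem tameJet_poisson (κ : ℝ) (a : (Fin d → ℕ) →₀ ℝ) :
    TameJet (poisson κ a) (poissonDeriv κ a) (poissonDeriv2 κ a) :=
  TameJet.sum a.support fun k _ => (tameJet_mode (Real.sqrt_nonneg _) k).const_mul (a k)

theorem poisson_zero_time (κ : ℝ) (a : (Fin d → ℕ) →₀ ℝ) (x : Fin d → ℝ) :
    poisson κ a (0, x) = hermiteSum a x := by
  simp [poisson, hermiteSum, mode]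

/-- `(∂_t² - L) u = κ u` for `u = e^{-t √(L + κ)} f`. -/
theorem poisson_equation {κ : ℝ} (hκ : 0 ≤ κ) (a : (Fin d → ℕ) →₀ ℝ) (z : ℝ × (Fin d → ℝ)) :
    poissonDeriv2 κ a none z +
      ∑ i, (poissonDeriv2 κ a (some i) z - 2 * z.2 i * poissonDeriv κ a (some i) z) =
      κ * poisson κ a z := by
  simp only [poissonDeriv2, poissonDeriv, poisson, Finsupp.sum, Finset.mul_sum,
    ← Finset.sum_sub_distrib]
  rw [Finset.sum_comm, ← Finset.sum_add_distrib]
  refine Finset.sum_congr rfl fun k _ => ?_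
  have h := mode_equation (√(eigenvalue k + κ)) k z
  rw [Real.sq_sqrt (add_nonneg (eigenvalue_nonneg k) hκ)] at h
  have e : ∀ i, a k * modeDeriv2 (√(eigenvalue k + κ)) k (some i) z -
      2 * z.2 i * (a k * modeDeriv (√(eigenvalue k + κ)) k (some i) z) =
      a k * (modeDeriv2 (√(eigenvalue k + κ)) k (some i) z -
        2 * z.2 i * modeDeriv (√(eigenvalue k + κ)) k (some i) z) := fun i => by ring
  simp only [e]
  rw [← Finset.mul_sum, ← mul_add, h]
  ring

theorem Tame.slice {f : ℝ × (Fin d → ℝ) → ℝ} (hf : Tame f) {t : ℝ} (ht : -1 < t) :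
    Moderate fun x => f (t, x) := by
  obtain ⟨c, hc, hb⟩ := hf.bound
  exact ⟨hf.continuous.comp (by fun_prop), c, hc, fun x _ => hb (t, x) ht⟩

theorem hasDerivAt_integral_tame {f f' : ℝ × (Fin d → ℝ) → ℝ} (hf : Tame f) (hf' : Tame f')
    (h : ∀ z, HasLineDerivAt ℝ f (f' z) z (dir none)) {t : ℝ} (ht : -1 < t) :
    HasDerivAt (fun s => ∫ x, f (s, x) ∂mu d) (∫ x, f' (t, x) ∂mu d) t := by
  obtain ⟨c, hc, hb⟩ := hf'.bound
  refine (hasDerivAt_integral_of_dominated_loc_of_deriv_le (F := fun s x => f (s, x))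
    (F' := fun s x => f' (s, x)) (bound := fun x => Real.exp (c * (1 + ‖x‖)))
    (Ioi_mem_nhds ht) ?_ (Tame.slice hf ht).integrable
    (Tame.slice hf' ht).continuous.aestronglyMeasurable
    (ae_of_all _ fun x s hs => hb (s, x) hs) (integrable_exp_norm c)
    (ae_of_all _ fun x s _ => ?_)).2
  · filter_upwards [Ioi_mem_nhds ht] with s hs
    exact (Tame.slice hf hs).continuous.aestronglyMeasurable
  · have h1 := h (s, x)
    unfold HasLineDerivAt at h1
    simp only [dir, Prod.smul_mk, Prod.mk_add_mk, smul_eq_mul, mul_one, smul_zero, add_zero] at h1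
    have h2 := HasDerivAt.comp_add_const (f := fun t => f (s + t, x)) s (-s) (by simpa using h1)
    simpa using h2

/-- Integrating `∂_t² H - L H` over space leaves only the time derivative. -/
theorem TameJet.integral_eq {H : ℝ × (Fin d → ℝ) → ℝ}
    {H' H'' : Option (Fin d) → ℝ × (Fin d → ℝ) → ℝ} (hH : TameJet H H' H'') {t : ℝ}
    (ht : -1 < t) :
    ∫ x, (H'' none (t, x) + ∑ i, (H'' (some i) (t, x) - 2 * x i * H' (some i) (t, x))) ∂mu d =
      ∫ x, H'' none (t, x) ∂mu d := by
  have h1 : ∀ i : Fin d, Moderate fun x => H'' (some i) (t, x) - 2 * x i * H' (some i) (t, x) :=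
    fun i => (Tame.slice (hH.tame2 _) ht).sub
      (((ExpGrowth.coord i).const_mul 2).mul (Tame.slice (hH.tame1 _) ht))
  rw [integral_add (Tame.slice (hH.tame2 _) ht).integrable
    (ExpGrowth.integrable (ExpGrowth.sum _ fun i _ => h1 i)),
    integral_finsetSum _ fun i _ => (h1 i).integrable, Finset.sum_eq_zero, add_zero]
  intro i _
  refine integral_deriv_sub_eq_zero i (Tame.slice (hH.tame1 _) ht) (Tame.slice (hH.tame2 _) ht)
    fun x => ?_
  have h2 := hH.deriv2 (some i) (t, x)
  unfold HasLineDerivAt at h2 ⊢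
  simpa only [dir, Prod.smul_mk, Prod.mk_add_mk, smul_zero, add_zero] using h2

/-- A convex function on `[0, ∞)` that is bounded above is maximal at `0`. -/
theorem le_of_convexOn_of_bddAbove {N : ℝ → ℝ} (hN : ConvexOn ℝ (Set.Ici 0) N) {M : ℝ}
    (hM : ∀ t, 0 ≤ t → N t ≤ M) {t : ℝ} (ht : 0 ≤ t) : N t ≤ N 0 := by
  by_contra! h
  obtain ⟨n, hn⟩ := exists_nat_gt ((M - N 0) / (N t - N 0))
  have hpos : 0 < N t - N 0 := by linarith
  rw [div_lt_iff₀ hpos] at hn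
  have hn1 : (0 : ℝ) < n + 1 := by positivity
  have ha : 0 ≤ 1 - 1 / ((n : ℝ) + 1) := by
    rw [sub_nonneg, div_le_one hn1]
    linarith [(Nat.cast_nonneg n : (0 : ℝ) ≤ n)]
  have hmem : ((n : ℝ) + 1) * t ∈ Set.Ici (0 : ℝ) := Set.mem_Ici.2 (by positivity)
  have hc := hN.2 (Set.mem_Ici.2 le_rfl) hmem ha
    (by positivity : 0 ≤ 1 / ((n : ℝ) + 1)) (by ring)
  simp only [smul_eq_mul, mul_zero, zero_add] at hc
  rw [show 1 / ((n : ℝ) + 1) * ((n + 1) * t) = t by field_simp] at hc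
  have hb := hM ((n + 1) * t) (by positivity)
  have h3 : 1 / ((n : ℝ) + 1) * N ((n + 1) * t) ≤ 1 / ((n : ℝ) + 1) * M :=
    mul_le_mul_of_nonneg_left hb (by positivity)
  have h4 : N t - N 0 ≤ 1 / ((n : ℝ) + 1) * (M - N 0) := by linarith
  rw [one_div, ← div_eq_inv_mul, le_div_iff₀ hn1] at h4
  nlinarith

/-! ### The bilinear estimate by convexity along the flow -/

theorem integral_sum_hermiteN_mul (s : Finset (Fin d → ℕ)) (α : (Fin d → ℕ) → ℝ)
    (σ : (Fin d → ℕ) → Fin d → ℕ) (b : (Fin d → ℕ) →₀ ℝ) (β : (Fin d → ℕ) → ℝ) :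
    ∫ x, (∑ k ∈ s, α k * hermiteN (σ k) x) * (b.sum fun l c => c * (β l * hermiteN l x)) ∂mu d =
      ∑ k ∈ s, α k * (b (σ k) * β (σ k)) := by
  simp only [Finsupp.sum, Finset.sum_mul_sum]
  have hm : ∀ k l, Moderate fun x => α k * hermiteN (σ k) x * (b l * (β l * hermiteN l x)) :=
    fun k l => ((moderate_hermiteN _).const_mul _).mul
      (((moderate_hermiteN _).const_mul _).const_mul _)
  rw [integral_finsetSum _ fun k _ => (ExpGrowth.sum _ fun l _ => hm k l).integrable]
  refine Finset.sum_congr rfl fun k _ => ?_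
  rw [integral_finsetSum _ fun l _ => (hm k l).integrable]
  have e : ∀ l, ∫ x, α k * hermiteN (σ k) x * (b l * (β l * hermiteN l x)) ∂mu d =
      if σ k = l then α k * (b l * β l) else 0 := by
    intro l
    have : ∀ x, α k * hermiteN (σ k) x * (b l * (β l * hermiteN l x)) =
        α k * (b l * β l) * (hermiteN (σ k) x * hermiteN l x) := fun x => by ring
    simp only [this]
    rw [integral_const_mul, integral_hermiteN_mul]
    split_ifs <;> simp
  simp only [e, Finset.sum_ite_eq]
  split_ifs with h
  · rfl
  · rw [Finsupp.notMem_support_iff.1 h]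
    ring

/-- The contribution of the `k`-th coefficient of `f = ∑ a_k H̃_k` to `∑ᵢ ⟨R_i f, g_i⟩`, where `g_i`
has the coefficients `b i`. -/
noncomputable def rieszCoeff (a : (Fin d → ℕ) →₀ ℝ) (b : Fin d → (Fin d → ℕ) →₀ ℝ)
    (k : Fin d → ℕ) : ℝ :=
  a k * (eigenvalue k ^ (-(1 / 2 : ℝ)) * ∑ i, √(2 * (k i : ℝ)) * b i (lower k i))

theorem moderate_hermiteSum (a : (Fin d → ℕ) →₀ ℝ) : Moderate (hermiteSum a) :=
  ExpGrowth.sum _ fun _ _ => (moderate_hermiteN _).const_mul _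

theorem moderate_rieszSum (a : (Fin d → ℕ) →₀ ℝ) (i : Fin d) : Moderate (rieszSum a i) :=
  ExpGrowth.sum _ fun _ _ => (((moderate_hermiteN _).const_mul _).const_mul _).const_mul _

theorem integral_rieszSum_mul (a : (Fin d → ℕ) →₀ ℝ) (b : Fin d → (Fin d → ℕ) →₀ ℝ) :
    ∑ i, ∫ x, rieszSum a i x * hermiteSum (b i) x ∂mu d = ∑ k ∈ a.support, rieszCoeff a b k := by
  have e : ∀ i, ∫ x, rieszSum a i x * hermiteSum (b i) x ∂mu d =
      ∑ k ∈ a.support, a k * (eigenvalue k ^ (-(1 / 2 : ℝ)) * √(2 * (k i : ℝ))) *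
        (b i (lower k i) * 1) := by
    intro i
    rw [← integral_sum_hermiteN_mul a.support _ (fun k => lower k i) (b i) fun _ => 1]
    simp only [rieszSum, hermiteSum, Finsupp.sum, one_mul, mul_assoc]
  simp only [e]
  rw [Finset.sum_comm]
  refine Finset.sum_congr rfl fun k _ => ?_
  rw [rieszCoeff, Finset.mul_sum, Finset.mul_sum]
  exact Finset.sum_congr rfl fun i _ => by ring

theorem rieszCoeff_zero (a : (Fin d → ℕ) →₀ ℝ) (b : Fin d → (Fin d → ℕ) →₀ ℝ) :
    rieszCoeff a b 0 = 0 := by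
  simp [rieszCoeff]

theorem integral_poissonDeriv_mul (a : (Fin d → ℕ) →₀ ℝ) (b : Fin d → (Fin d → ℕ) →₀ ℝ) (t : ℝ) :
    ∑ i, ∫ x, poissonDeriv 0 a (some i) (t, x) * poissonDeriv 2 (b i) none (t, x) ∂mu d =
      -∑ k ∈ a.support, eigenvalue k * rieszCoeff a b k *
        Real.exp (-(t * (2 * √(eigenvalue k)))) := by
  have e : ∀ i, ∫ x, poissonDeriv 0 a (some i) (t, x) * poissonDeriv 2 (b i) none (t, x) ∂mu d =
      ∑ k ∈ a.support, a k * (√(2 * (k i : ℝ)) * Real.exp (-(t * √(eigenvalue k)))) *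
        (b i (lower k i) * (-√(eigenvalue (lower k i) + 2) *
          Real.exp (-(t * √(eigenvalue (lower k i) + 2))))) := by
    intro i
    rw [← integral_sum_hermiteN_mul a.support _ (fun k => lower k i) (b i)
      fun l => -√(eigenvalue l + 2) * Real.exp (-(t * √(eigenvalue l + 2)))]
    simp only [poissonDeriv, modeDeriv, mode, Finsupp.sum, mul_assoc, add_zero]
  simp only [e]
  rw [Finset.sum_comm, ← Finset.sum_neg_distrib]
  refine Finset.sum_congr rfl fun k _ => ?_
  by_cases hk0 : k = 0
  · subst hk0
    simp [rieszCoeff_zero]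
  have hp := eigenvalue_pos hk0
  have hs : eigenvalue k * eigenvalue k ^ (-(1 / 2 : ℝ)) = √(eigenvalue k) := by
    rw [Real.sqrt_eq_rpow, ← Real.rpow_one_add' hp.le (by norm_num)]
    norm_num
  have e2 : ∀ i, a k * (√(2 * (k i : ℝ)) * Real.exp (-(t * √(eigenvalue k)))) *
        (b i (lower k i) * (-√(eigenvalue (lower k i) + 2) *
          Real.exp (-(t * √(eigenvalue (lower k i) + 2))))) =
      -(a k * √(eigenvalue k) * Real.exp (-(t * (2 * √(eigenvalue k))))) *
        (√(2 * (k i : ℝ)) * b i (lower k i)) := by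
    intro i
    by_cases hk : k i = 0
    · simp [hk]
    · rw [eigenvalue_lower hk, show -(t * (2 * √(eigenvalue k))) =
        -(t * √(eigenvalue k)) + -(t * √(eigenvalue k)) by ring, Real.exp_add]
      ring
  simp only [e2]
  rw [← Finset.mul_sum, rieszCoeff, ← hs]
  ring

/-- The pointwise differential inequality for a Bellman function along the two flows. The second
flow is driven by `L + 2`, whose zeroth order term only helps since `ΦT ≥ 0`. -/
theorem IsBellman.flow {p q c : ℝ} {Φ ΦS ΦT τ : ℝ → ℝ → ℝ} (hB : IsBellman d p q c Φ ΦS ΦT τ)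
    (hc : 0 < c) (a : (Fin d → ℕ) →₀ ℝ) (b : Fin d → (Fin d → ℕ) →₀ ℝ) {ε₁ ε₂ : ℝ} (h₁ : 0 < ε₁)
    (h₂ : 0 < ε₂) :
    ∃ H' H'' : Option (Fin d) → ℝ × (Fin d → ℝ) → ℝ,
      TameJet (fun z => Φ (poisson 0 a z * poisson 0 a z + ε₁ ^ 2)
        (∑ l, poisson 2 (b l) z * poisson 2 (b l) z + ε₂ ^ 2)) H' H'' ∧
      ∀ z, 2 * c * |∑ i, poissonDeriv 0 a (some i) z * poissonDeriv 2 (b i) none z| ≤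
        H'' none z + ∑ i, (H'' (some i) z - 2 * z.2 i * H' (some i) z) := by
  have JF := tameJet_poisson 0 a
  have JG := fun l => tameJet_poisson 2 (b l)
  have JS := (JF.mul JF).add (TameJet.const (ε₁ ^ 2))
  have JT := (TameJet.sum Finset.univ fun l _ => (JG l).mul (JG l)).add (TameJet.const (ε₂ ^ 2))
  have hm : 0 < min (ε₁ ^ 2) (ε₂ ^ 2) := lt_min (by positivity) (by positivity)
  obtain ⟨H'', hH, hlow⟩ := hB.jet JS JT hm
    (fun z => (min_le_left _ _).trans (le_add_of_nonneg_left (mul_self_nonneg _)))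
    (fun z => (min_le_right _ _).trans
      (le_add_of_nonneg_left (Finset.sum_nonneg fun _ _ => mul_self_nonneg _)))
  refine ⟨_, H'', hH, fun z => ?_⟩
  have hFeq := poisson_equation le_rfl a z
  have hGeq := fun l => poisson_equation zero_le_two (b l) z
  set F := poisson 0 a z with hF
  set F' := fun j => poissonDeriv 0 a j z with hF'
  set F'' := fun j => poissonDeriv2 0 a j z with hF''
  set G := fun l => poisson 2 (b l) z with hG
  set G' := fun l j => poissonDeriv 2 (b l) j z with hG'
  set G'' := fun l j => poissonDeriv2 2 (b l) j z with hG''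
  have hS0 : 0 < F * F + ε₁ ^ 2 :=
    add_pos_of_nonneg_of_pos (mul_self_nonneg _) (by positivity)
  have hT0 : 0 < ∑ l, G l * G l + ε₂ ^ 2 :=
    add_pos_of_nonneg_of_pos (Finset.sum_nonneg fun _ _ => mul_self_nonneg _) (by positivity)
  set S := F * F + ε₁ ^ 2 with hS
  set T := ∑ l, G l * G l + ε₂ ^ 2 with hT
  have hτ := hB.tau_pos hS0 hT0
  have hgS := hB.gradS_nonneg hS0 hT0
  have hgT := hB.gradT_nonneg hS0 hT0
  set θ := τ S T with hθ
  have low : ∀ j, c * (θ * F' j ^ 2 + (∑ l, G' l j ^ 2) / θ) + ΦS S T * (2 * F * F'' j) +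
      ΦT S T * ∑ l, 2 * G l * G'' l j ≤ H'' j z := by
    intro j
    have hX : (F' j * F + F * F' j + 0) ^ 2 ≤ 4 * S * F' j ^ 2 := by
      rw [hS]
      nlinarith [mul_nonneg (sq_nonneg ε₁) (sq_nonneg (F' j))]
    have hY : ((∑ l, (G' l j * G l + G l * G' l j)) + 0) ^ 2 ≤ 4 * T * ∑ l, G' l j ^ 2 := by
      have e : ∑ l, (G' l j * G l + G l * G' l j) = 2 * ∑ l, G l * G' l j := by
        rw [Finset.mul_sum]
        exact Finset.sum_congr rfl fun l _ => by ring
      have h1 := Finset.sum_mul_sq_le_sq_mul_sq Finset.univ G fun l => G' l j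
      have h2 : ∑ l, G l ^ 2 = T - ε₂ ^ 2 := by
        rw [hT, add_sub_cancel_right]
        exact Finset.sum_congr rfl fun l _ => by ring
      have h3 : 0 ≤ ∑ l, G' l j ^ 2 := Finset.sum_nonneg fun _ _ => sq_nonneg _
      rw [e]
      rw [h2] at h1
      nlinarith [mul_nonneg (sq_nonneg ε₂) h3]
    have h := hlow j z _ _ hX hY
    refine le_trans (le_of_eq ?_) h
    congr 2
    · congr 1
      ring
    · rw [Finset.mul_sum, add_zero, ← Finset.sum_sub_distrib]
      exact Finset.sum_congr rfl fun l _ => by ring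
  have hFi : F'' none + ∑ i, (F'' (some i) - 2 * z.2 i * F' (some i)) = 0 := by
    simpa using hFeq
  have hGi : ∀ l, G'' l none + ∑ i, (G'' l (some i) - 2 * z.2 i * G' l (some i)) = 2 * G l := hGeq
  have hsum := Finset.sum_le_sum fun (i : Fin d) (_ : i ∈ Finset.univ) =>
    sub_le_sub_right (low (some i)) (2 * z.2 i * (ΦS S T * (2 * F * F' (some i)) +
      ΦT S T * ∑ l, 2 * G l * G' l (some i)))
  have hsplit : ∑ i : Fin d, (c * (θ * F' (some i) ^ 2 + (∑ l, G' l (some i) ^ 2) / θ) +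
      ΦS S T * (2 * F * F'' (some i)) + ΦT S T * ∑ l, 2 * G l * G'' l (some i) -
      2 * z.2 i * (ΦS S T * (2 * F * F' (some i)) + ΦT S T * ∑ l, 2 * G l * G' l (some i))) =
      ∑ i : Fin d, c * (θ * F' (some i) ^ 2 + (∑ l, G' l (some i) ^ 2) / θ) +
      ΦS S T * (2 * F * ∑ i, (F'' (some i) - 2 * z.2 i * F' (some i))) +
      ΦT S T * ∑ l, 2 * G l * ∑ i, (G'' l (some i) - 2 * z.2 i * G' l (some i)) := by
    simp only [Finset.mul_sum]
    rw [Finset.sum_comm (s := Finset.univ) (t := Finset.univ)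
      (f := fun l i => ΦT S T * (2 * G l * (G'' l (some i) - 2 * z.2 i * G' l (some i)))),
      ← Finset.sum_add_distrib, ← Finset.sum_add_distrib]
    refine Finset.sum_congr rfl fun i _ => ?_
    have : ∑ l, ΦT S T * (2 * G l * (G'' l (some i) - 2 * z.2 i * G' l (some i))) =
        ∑ l, ΦT S T * (2 * G l * G'' l (some i)) -
          2 * z.2 i * ∑ l, ΦT S T * (2 * G l * G' l (some i)) := by
      rw [Finset.mul_sum, ← Finset.sum_sub_distrib]
      exact Finset.sum_congr rfl fun l _ => by ring
    rw [this]
    ring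
  have hH' : ∀ i : Fin d, ΦS S T * (F' (some i) * F + F * F' (some i) + 0) +
      ΦT S T * (∑ l, (G' l (some i) * G l + G l * G' l (some i)) + 0) =
      ΦS S T * (2 * F * F' (some i)) + ΦT S T * ∑ l, 2 * G l * G' l (some i) := by
    intro i
    congr 2
    · ring
    · rw [add_zero]
      exact Finset.sum_congr rfl fun l _ => by ring
  have hGsum : ∑ l, 2 * G l * G'' l none +
      ∑ l, 2 * G l * ∑ i, (G'' l (some i) - 2 * z.2 i * G' l (some i)) =
      ∑ l, 4 * (G l * G l) := by
    rw [← Finset.sum_add_distrib]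
    refine Finset.sum_congr rfl fun l _ => ?_
    rw [← mul_add, hGi]
    ring
  have hGpos : 0 ≤ ΦT S T * ∑ l, 4 * (G l * G l) :=
    mul_nonneg hgT (Finset.sum_nonneg fun _ _ => mul_nonneg zero_le_four (mul_self_nonneg _))
  rw [← hGsum, mul_add] at hGpos
  have hFzero : ΦS S T * (2 * F * F'' none) +
      ΦS S T * (2 * F * ∑ i, (F'' (some i) - 2 * z.2 i * F' (some i))) = 0 := by
    rw [← mul_add, ← mul_add, hFi]
    ring
  have hnone := low none
  have hcross : 2 * c * |∑ i, F' (some i) * G' i none| ≤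
      c * (θ * F' none ^ 2 + (∑ l, G' l none ^ 2) / θ) +
      ∑ i : Fin d, c * (θ * F' (some i) ^ 2 + (∑ l, G' l (some i) ^ 2) / θ) := by
    have h1 : 2 * |∑ i, F' (some i) * G' i none| ≤
        ∑ i, (θ * F' (some i) ^ 2 + G' i none ^ 2 / θ) := by
      calc 2 * |∑ i, F' (some i) * G' i none| ≤ 2 * ∑ i, |F' (some i) * G' i none| := by
            gcongr
            exact Finset.abs_sum_le_sum_abs _ _
        _ ≤ _ := by
            rw [Finset.mul_sum]
            refine Finset.sum_le_sum fun i _ => ?_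
            have h2 : 0 ≤ (θ * |F' (some i)| - |G' i none|) ^ 2 / θ := by positivity
            have h3 : (θ * |F' (some i)| - |G' i none|) ^ 2 / θ =
                θ * |F' (some i)| ^ 2 - 2 * (|F' (some i)| * |G' i none|) +
                  |G' i none| ^ 2 / θ := by
              field_simp
              ring
            rw [h3, sq_abs, sq_abs, ← abs_mul] at h2
            linarith
    have h2 : 0 ≤ ∑ i : Fin d, (∑ l, G' l (some i) ^ 2) / θ :=
      Finset.sum_nonneg fun _ _ => div_nonneg (Finset.sum_nonneg fun _ _ => sq_nonneg _) hτ.le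
    have h3 : 0 ≤ θ * F' none ^ 2 := by positivity
    rw [Finset.sum_add_distrib, ← Finset.sum_div] at h1
    rw [← Finset.mul_sum, ← mul_add, Finset.sum_add_distrib, mul_comm 2 c, mul_assoc]
    exact mul_le_mul_of_nonneg_left (by linarith) hc.le
  rw [hsplit] at hsum
  have hlast : 2 * c * |∑ i, F' (some i) * G' i none| ≤
      H'' none z + ∑ i, (H'' (some i) z - 2 * z.2 i *
        (ΦS S T * (F' (some i) * F + F * F' (some i) + 0) +
          ΦT S T * (∑ l, (G' l (some i) * G l + G l * G' l (some i)) + 0))) := by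
    simp only [hH']
    linarith
  exact hlast

/-- The bilinear estimate: the Riesz transform is controlled by the integral of a Bellman function.
For `N(t) = (2 / c) ∫ Φ(P_t f, Q_t g) dμ - ⟨R P_t f, Q_t g⟩` the differential inequality gives
`N'' ≥ 0`. Being bounded and convex, `N` is nonincreasing, and it is nonnegative in the limit. -/
theorem IsBellman.riesz_le {p q c : ℝ} {Φ ΦS ΦT τ : ℝ → ℝ → ℝ}
    (hB : IsBellman d p q c Φ ΦS ΦT τ) (hc : 0 < c) (a : (Fin d → ℕ) →₀ ℝ)
    (b : Fin d → (Fin d → ℕ) →₀ ℝ) {ε₁ ε₂ : ℝ} (h₁ : 0 < ε₁) (h₂ : 0 < ε₂) :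
    ∑ i, ∫ x, rieszSum a i x * hermiteSum (b i) x ∂mu d ≤
      2 / c * ∫ x, Φ (hermiteSum a x * hermiteSum a x + ε₁ ^ 2)
        (∑ l, hermiteSum (b l) x * hermiteSum (b l) x + ε₂ ^ 2) ∂mu d := by
  obtain ⟨H', H'', hH, hlow⟩ := hB.flow hc a b h₁ h₂
  set H := fun z => Φ (poisson 0 a z * poisson 0 a z + ε₁ ^ 2)
    (∑ l, poisson 2 (b l) z * poisson 2 (b l) z + ε₂ ^ 2) with hHdef
  have hHnn : ∀ z, 0 ≤ H z := fun z =>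
    hB.nonneg (add_pos_of_nonneg_of_pos (mul_self_nonneg _) (by positivity))
      (add_pos_of_nonneg_of_pos (Finset.sum_nonneg fun _ _ => mul_self_nonneg _) (by positivity))
  set W : ℝ → ℝ := fun t =>
    ∑ k ∈ a.support, rieszCoeff a b k * Real.exp (-(t * (2 * √(eigenvalue k)))) with hW
  set W' : ℝ → ℝ := fun t => ∑ k ∈ a.support,
    rieszCoeff a b k * (Real.exp (-(t * (2 * √(eigenvalue k)))) * -(2 * √(eigenvalue k))) with hW'
  set W'' : ℝ → ℝ := fun t => ∑ k ∈ a.support,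
    rieszCoeff a b k * (Real.exp (-(t * (2 * √(eigenvalue k)))) * -(2 * √(eigenvalue k)) *
      -(2 * √(eigenvalue k))) with hW''
  have hexp : ∀ (ω t : ℝ), HasDerivAt (fun t : ℝ => Real.exp (-(t * ω)))
      (Real.exp (-(t * ω)) * -ω) t := fun ω t => by
    have := ((hasDerivAt_id' t).mul_const ω).fun_neg.exp
    simpa using this
  have hW1 : ∀ t, HasDerivAt W (W' t) t := fun t =>
    HasDerivAt.fun_sum fun k _ => (hexp _ t).const_mul _
  have hW2 : ∀ t, HasDerivAt W' (W'' t) t := fun t =>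
    HasDerivAt.fun_sum fun k _ => ((hexp _ t).mul_const _).const_mul _
  set N : ℝ → ℝ := fun t => 2 / c * ∫ x, H (t, x) ∂mu d - W t with hN
  set N' : ℝ → ℝ := fun t => 2 / c * ∫ x, H' none (t, x) ∂mu d - W' t with hN'
  have hN1 : ∀ t, -1 < t → HasDerivAt N (N' t) t := fun t ht =>
    ((hasDerivAt_integral_tame hH.tame (hH.tame1 none) (hH.deriv1 none) ht).const_mul _).sub
      (hW1 t)
  have hN2 : ∀ t, -1 < t → HasDerivAt N' (2 / c * ∫ x, H'' none (t, x) ∂mu d - W'' t) t :=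
    fun t ht => ((hasDerivAt_integral_tame (hH.tame1 none) (hH.tame2 none) (hH.deriv2 none)
      ht).const_mul _).sub (hW2 t)
  have hpos : ∀ t, -1 < t → 0 ≤ 2 / c * ∫ x, H'' none (t, x) ∂mu d - W'' t := by
    intro t ht
    have m1 : ∀ i : Fin d, Moderate fun x =>
        poissonDeriv 0 a (some i) (t, x) * poissonDeriv 2 (b i) none (t, x) := fun i =>
      (Tame.slice ((tameJet_poisson 0 a).tame1 _) ht).mul
        (Tame.slice ((tameJet_poisson 2 (b i)).tame1 _) ht)
    have m2 : ∀ i : Fin d, Moderate fun x =>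
        H'' (some i) (t, x) - 2 * x i * H' (some i) (t, x) :=
      fun i => (Tame.slice (hH.tame2 _) ht).sub
        (((ExpGrowth.coord i).const_mul 2).mul (Tame.slice (hH.tame1 _) ht))
    have m3 : Moderate fun x => H'' none (t, x) +
        ∑ i, (H'' (some i) (t, x) - 2 * x i * H' (some i) (t, x)) :=
      (Tame.slice (hH.tame2 none) ht).add (ExpGrowth.sum _ fun i _ => m2 i)
    have m4 : Moderate fun x =>
        ∑ i, poissonDeriv 0 a (some i) (t, x) * poissonDeriv 2 (b i) none (t, x) :=
      ExpGrowth.sum _ fun i _ => m1 i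
    have i1 : W'' t = -4 * ∫ x, ∑ i,
        poissonDeriv 0 a (some i) (t, x) * poissonDeriv 2 (b i) none (t, x) ∂mu d := by
      rw [integral_finsetSum _ fun i _ => (m1 i).integrable, integral_poissonDeriv_mul, hW'']
      simp only [neg_mul_neg, Finset.mul_sum]
      refine Finset.sum_congr rfl fun k _ => ?_
      have hs : √(eigenvalue k) * √(eigenvalue k) = eigenvalue k :=
        Real.mul_self_sqrt (eigenvalue_nonneg k)
      linear_combination
        (4 * rieszCoeff a b k * Real.exp (-(t * (2 * √(eigenvalue k))))) * hs
    have i2 : 2 * c * |∫ x, ∑ i,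
        poissonDeriv 0 a (some i) (t, x) * poissonDeriv 2 (b i) none (t, x) ∂mu d| ≤
        ∫ x, H'' none (t, x) ∂mu d := by
      rw [← hH.integral_eq ht]
      calc _ ≤ 2 * c * ∫ x, |∑ i, poissonDeriv 0 a (some i) (t, x) *
            poissonDeriv 2 (b i) none (t, x)| ∂mu d := by
            gcongr
            exact abs_integral_le_integral_abs
        _ = ∫ x, 2 * c * |∑ i, poissonDeriv 0 a (some i) (t, x) *
            poissonDeriv 2 (b i) none (t, x)| ∂mu d := (integral_const_mul _ _).symm
        _ ≤ _ := integral_mono (m4.integrable.abs.const_mul _) m3.integrable fun x => hlow (t, x)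
    rw [i1]
    have i3 := mul_le_mul_of_nonneg_left i2 (by positivity : 0 ≤ 2 / c)
    rw [← mul_assoc, show 2 / c * (2 * c) = 4 by field_simp; norm_num] at i3
    linarith [neg_abs_le (∫ x, ∑ i,
      poissonDeriv 0 a (some i) (t, x) * poissonDeriv 2 (b i) none (t, x) ∂mu d)]
  have hconv : ConvexOn ℝ (Set.Ici 0) N := by
    have hm : ∀ t ∈ Set.Ici (0 : ℝ), -1 < t := fun t ht => by
      have : 0 ≤ t := ht
      linarith
    refine convexOn_of_hasDerivWithinAt2_nonneg (f' := N')
      (f'' := fun t => 2 / c * ∫ x, H'' none (t, x) ∂mu d - W'' t) (convex_Ici 0)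
      (fun t ht => (hN1 t (hm t ht)).continuousAt.continuousWithinAt)
      (fun t ht => (hN1 t (hm t (interior_subset ht))).hasDerivWithinAt)
      (fun t ht => (hN2 t (hm t (interior_subset ht))).hasDerivWithinAt)
      fun t ht => hpos t (hm t (interior_subset ht))
  obtain ⟨M, hM⟩ : ∃ M, ∀ t, 0 ≤ t → N t ≤ M := by
    obtain ⟨e, he, hb⟩ := hH.tame.bound
    refine ⟨2 / c * ∫ x : Fin d → ℝ, Real.exp (e * (1 + ‖x‖)) ∂mu d +
      ∑ k ∈ a.support, |rieszCoeff a b k|, fun t ht => ?_⟩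
    have ht' : -1 < t := by linarith
    have b1 : ∫ x, H (t, x) ∂mu d ≤ ∫ x : Fin d → ℝ, Real.exp (e * (1 + ‖x‖)) ∂mu d :=
      integral_mono (Tame.slice hH.tame ht').integrable (integrable_exp_norm e)
        fun x => (le_abs_self _).trans (hb (t, x) ht')
    have b2 : -W t ≤ ∑ k ∈ a.support, |rieszCoeff a b k| := by
      rw [hW, ← Finset.sum_neg_distrib]
      refine Finset.sum_le_sum fun k _ => ?_
      have h3 : Real.exp (-(t * (2 * √(eigenvalue k)))) ≤ 1 :=
        Real.exp_le_one_iff.2 (neg_nonpos.2 (by positivity))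
      calc -(rieszCoeff a b k * Real.exp (-(t * (2 * √(eigenvalue k))))) ≤
          |rieszCoeff a b k| * Real.exp (-(t * (2 * √(eigenvalue k)))) := by
            rw [← neg_mul]
            exact mul_le_mul_of_nonneg_right (neg_le_abs _) (Real.exp_pos _).le
        _ ≤ |rieszCoeff a b k| := mul_le_of_le_one_right (abs_nonneg _) h3
    have b3 := mul_le_mul_of_nonneg_left b1 (by positivity : 0 ≤ 2 / c)
    rw [hN]
    linarith
  have hWlim : Tendsto W atTop (𝓝 0) := by
    rw [← Finset.sum_const_zero (s := a.support)]
    refine tendsto_finsetSum _ fun k _ => ?_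
    by_cases hk : k = 0
    · subst hk
      simp [rieszCoeff_zero]
    · have hω : 0 < 2 * √(eigenvalue k) := by
        have := eigenvalue_pos hk
        positivity
      have h3 : Tendsto (fun t : ℝ => Real.exp (-(t * (2 * √(eigenvalue k))))) atTop (𝓝 0) :=
        Real.tendsto_exp_neg_atTop_nhds_zero.comp (tendsto_id.atTop_mul_const hω)
      simpa using h3.const_mul (rieszCoeff a b k)
  have hfin : ∀ t, 0 ≤ t → -W t ≤ N 0 := fun t ht => by
    refine le_trans ?_ (le_of_convexOn_of_bddAbove hconv hM ht)
    have : 0 ≤ 2 / c * ∫ x, H (t, x) ∂mu d :=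
      mul_nonneg (by positivity) (integral_nonneg fun x => hHnn _)
    rw [hN]
    linarith
  have hN0 : 0 ≤ N 0 := by
    have := le_of_tendsto hWlim.neg (eventually_atTop.2 ⟨0, hfin⟩)
    simpa using this
  have hW0 : W 0 = ∑ i, ∫ x, rieszSum a i x * hermiteSum (b i) x ∂mu d := by
    rw [integral_rieszSum_mul, hW]
    simp
  simp only [hN, hW0, hHdef, poisson_zero_time] at hN0
  linarith

/-! ### Density of polynomials in `L^r(μ)` -/

/-- The real vector space of polynomial functions on `ℝ^d`, as the span of the Hermite
polynomials. -/
noncomputable def polySpace (d : ℕ) : Submodule ℝ ((Fin d → ℝ) → ℝ) :=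
  Submodule.span ℝ (Set.range hermiteN)

theorem mem_polySpace_iff {f : (Fin d → ℝ) → ℝ} : f ∈ polySpace d ↔ ∃ a, hermiteSum a = f := by
  rw [polySpace, Finsupp.mem_span_range_iff_exists_finsupp]
  refine exists_congr fun a => ?_
  have : (a.sum fun k c => c • hermiteN k) = hermiteSum a := by
    funext x
    simp [hermiteSum, Finsupp.sum]
  rw [this]

theorem moderate_of_mem_polySpace {f : (Fin d → ℝ) → ℝ} (hf : f ∈ polySpace d) : Moderate f := by
  obtain ⟨a, rfl⟩ := mem_polySpace_iff.1 hf
  exact moderate_hermiteSum a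

theorem one_mem_polySpace : (fun _ => 1) ∈ polySpace d :=
  Submodule.subset_span ⟨0, funext hermiteN_zero⟩

theorem coord_mul_mem_polySpace {f : (Fin d → ℝ) → ℝ} (hf : f ∈ polySpace d) (i : Fin d) :
    (fun x => x i * f x) ∈ polySpace d := by
  induction hf using Submodule.span_induction with
  | mem f hf =>
    obtain ⟨k, rfl⟩ := hf
    have : (fun x => x i * hermiteN k x) =
        (√(2 * ((k i : ℝ) + 1)) / 2) • hermiteN (raise k i) +
          (√(2 * (k i : ℝ)) / 2) • hermiteN (lower k i) := by
      funext x
      simp only [Pi.add_apply, Pi.smul_apply, smul_eq_mul]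
      linear_combination (-1 / 2 : ℝ) * hermiteN_raise k i x
    rw [this]
    exact add_mem (Submodule.smul_mem _ _ (Submodule.subset_span ⟨_, rfl⟩))
      (Submodule.smul_mem _ _ (Submodule.subset_span ⟨_, rfl⟩))
  | zero =>
    have : (fun x : Fin d → ℝ => x i * (0 : (Fin d → ℝ) → ℝ) x) = 0 := by
      funext x
      simp
    rw [this]
    exact zero_mem _
  | add f g _ _ hf hg =>
    have : (fun x => x i * (f + g) x) = (fun x => x i * f x) + fun x => x i * g x := by
      funext x
      simp [mul_add]
    rw [this]
    exact add_mem hf hg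
  | smul c f _ hf =>
    have : (fun x => x i * (c • f) x) = c • fun x => x i * f x := by
      funext x
      simp only [Pi.smul_apply, smul_eq_mul]
      ring
    rw [this]
    exact Submodule.smul_mem _ _ hf

theorem coord_pow_mul_mem_polySpace {f : (Fin d → ℝ) → ℝ} (hf : f ∈ polySpace d) (i : Fin d)
    (n : ℕ) : (fun x => x i ^ n * f x) ∈ polySpace d := by
  induction n with
  | zero => simpa using hf
  | succ n ih =>
    have := coord_mul_mem_polySpace ih i
    refine (congrArg (· ∈ polySpace d) (funext fun x => ?_)).mp this
    ring

/-- `f` is a limit of polynomials in `L^r(μ)`. -/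
def PolyApprox (r : ℝ≥0∞) (f : (Fin d → ℝ) → ℝ) : Prop :=
  ∀ ε : ℝ≥0∞, ε ≠ 0 → ∃ P ∈ polySpace d, eLpNorm (fun x => f x - P x) r (mu d) ≤ ε

namespace PolyApprox

variable {r : ℝ≥0∞} {f g : (Fin d → ℝ) → ℝ}

theorem of_mem (hf : f ∈ polySpace d) : PolyApprox r f := fun ε _ => ⟨f, hf, by simp⟩

theorem of_near (hr : 1 ≤ r) (hf : AEStronglyMeasurable f (mu d))
    (h : ∀ ε : ℝ≥0∞, ε ≠ 0 → ∃ g, AEStronglyMeasurable g (mu d) ∧ PolyApprox r g ∧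
      eLpNorm (fun x => f x - g x) r (mu d) ≤ ε) : PolyApprox r f := by
  intro ε hε
  have hε2 : ε / 2 ≠ 0 := by simpa using hε
  obtain ⟨g, hgm, hg, hfg⟩ := h (ε / 2) hε2
  obtain ⟨P, hP, hgP⟩ := hg (ε / 2) hε2
  refine ⟨P, hP, ?_⟩
  have hPm := (moderate_of_mem_polySpace hP).continuous.aestronglyMeasurable (μ := mu d)
  calc eLpNorm (fun x => f x - P x) r (mu d)
      = eLpNorm ((fun x => f x - g x) + fun x => g x - P x) r (mu d) := by
        congr 1
        funext x
        simp
    _ ≤ _ := eLpNorm_add_le (hf.sub hgm) (hgm.sub hPm) hr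
    _ ≤ ε / 2 + ε / 2 := add_le_add hfg hgP
    _ = ε := ENNReal.add_halves ε

theorem add (hr : 1 ≤ r) (hfm : Continuous f) (hgm : Continuous g) (hf : PolyApprox r f)
    (hg : PolyApprox r g) : PolyApprox r fun x => f x + g x := by
  intro ε hε
  have hε2 : ε / 2 ≠ 0 := by simpa using hε
  obtain ⟨P, hP, hfP⟩ := hf (ε / 2) hε2
  obtain ⟨Q, hQ, hgQ⟩ := hg (ε / 2) hε2
  refine ⟨P + Q, add_mem hP hQ, ?_⟩
  have hPm := (moderate_of_mem_polySpace hP).continuous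
  have hQm := (moderate_of_mem_polySpace hQ).continuous
  calc eLpNorm (fun x => f x + g x - (P + Q) x) r (mu d)
      = eLpNorm ((fun x => f x - P x) + fun x => g x - Q x) r (mu d) := by
        congr 1
        funext x
        simp only [Pi.add_apply]
        ring
    _ ≤ _ := eLpNorm_add_le (hfm.sub hPm).aestronglyMeasurable
        (hgm.sub hQm).aestronglyMeasurable hr
    _ ≤ ε / 2 + ε / 2 := add_le_add hfP hgQ
    _ = ε := ENNReal.add_halves ε

/-- Dominated convergence in `L^r(μ)`. -/
theorem of_dominated (hr : 1 ≤ r) (hr' : r ≠ ∞) (hf : Continuous f) {F : ℕ → (Fin d → ℝ) → ℝ}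
    (hF : ∀ n, Continuous (F n)) (hFa : ∀ n, PolyApprox r (F n)) (hg : Moderate g)
    (hb : ∀ n x, |F n x| ≤ g x) (hlim : ∀ x, Tendsto (fun n => F n x) atTop (𝓝 (f x))) :
    PolyApprox r f := by
  have hr0 : r ≠ 0 := (zero_lt_one.trans_le hr).ne'
  have hrp : 0 < r.toReal := ENNReal.toReal_pos hr0 hr'
  have hfb : ∀ x, |f x| ≤ g x := fun x =>
    le_of_tendsto (hlim x).abs (Eventually.of_forall fun n => hb n x)
  have hd : ∀ n x, ‖f x - F n x‖ ≤ ‖2 * g x‖ := by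
    intro n x
    have := abs_sub (f x) (F n x)
    rw [Real.norm_eq_abs, Real.norm_eq_abs]
    refine le_trans ?_ (le_abs_self _)
    linarith [hfb x, hb n x]
  have hg2 := (hg.const_mul 2).memLp hr'
  have hmem : ∀ n, MemLp (fun x => f x - F n x) r (mu d) := fun n =>
    hg2.mono (hf.sub (hF n)).aestronglyMeasurable (ae_of_all _ (hd n))
  have hI : Tendsto (fun n => ∫ x, ‖f x - F n x‖ ^ r.toReal ∂mu d) atTop (𝓝 0) := by
    have h0 : ∫ _ : Fin d → ℝ, (0 : ℝ) ∂mu d = 0 := by simp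
    rw [← h0]
    refine tendsto_integral_of_dominated_convergence (fun x => ‖2 * g x‖ ^ r.toReal)
      (fun n => ((hf.sub (hF n)).norm.rpow_const fun _ => Or.inr hrp.le).aestronglyMeasurable)
      (hg2.integrable_norm_rpow hr0 hr') (fun n => ae_of_all _ fun x => ?_)
      (ae_of_all _ fun x => ?_)
    · rw [Real.norm_of_nonneg (by positivity)]
      exact Real.rpow_le_rpow (norm_nonneg _) (hd n x) hrp.le
    · have h1 : Tendsto (fun n => ‖f x - F n x‖) atTop (𝓝 0) := by
        have := ((hlim x).const_sub (f x)).norm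
        simpa using this
      have h2 := h1.rpow_const (p := r.toReal) (Or.inr hrp.le)
      rwa [Real.zero_rpow hrp.ne'] at h2
  have hN : Tendsto (fun n => eLpNorm (fun x => f x - F n x) r (mu d)) atTop (𝓝 0) := by
    have h1 := (hI.rpow_const (p := r.toReal⁻¹) (Or.inr (inv_nonneg.2 hrp.le)))
    rw [Real.zero_rpow (inv_pos.2 hrp).ne'] at h1
    have h2 := ENNReal.tendsto_ofReal h1
    rw [ENNReal.ofReal_zero] at h2
    refine h2.congr fun n => ?_
    rw [(hmem n).eLpNorm_eq_integral_rpow_norm hr0 hr']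
  refine of_near hr hf.aestronglyMeasurable fun ε hε => ?_
  obtain ⟨n, hn⟩ := (hN.eventually (ge_mem_nhds (pos_iff_ne_zero.2 hε))).exists
  exact ⟨F n, (hF n).aestronglyMeasurable, hFa n, hn⟩

end PolyApprox

/-- Products of a sine of a coordinate with a polynomial are limits of polynomials in `L^r(μ)`,
as the power series of the sine is dominated by an exponential. -/
theorem polyApprox_sin_mul {r : ℝ≥0∞} (hr : 1 ≤ r) (hr' : r ≠ ∞) (i : Fin d) (s : ℝ)
    {P : (Fin d → ℝ) → ℝ} (hP : P ∈ polySpace d) :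
    PolyApprox r fun x => Real.sin (s * x i) * P x := by
  have hPm := moderate_of_mem_polySpace hP
  set c : ℕ → ℝ := fun n => (-1) ^ n * s ^ (2 * n + 1) / ((2 * n + 1).factorial : ℝ) with hc
  have hterm : ∀ (x : Fin d → ℝ) n,
      (-1) ^ n * (s * x i) ^ (2 * n + 1) / ((2 * n + 1).factorial : ℝ) =
        c n * x i ^ (2 * n + 1) := by
    intro x n
    rw [hc, mul_pow]
    ring
  have hFmem : ∀ N, (fun x => (∑ n ∈ Finset.range N, c n * x i ^ (2 * n + 1)) * P x) ∈
      polySpace d := by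
    intro N
    have : (fun x => (∑ n ∈ Finset.range N, c n * x i ^ (2 * n + 1)) * P x) =
        ∑ n ∈ Finset.range N, c n • fun x => x i ^ (2 * n + 1) * P x := by
      funext x
      simp only [Finset.sum_apply, Pi.smul_apply, smul_eq_mul, Finset.sum_mul, mul_assoc]
    rw [this]
    exact sum_mem fun n _ => Submodule.smul_mem _ _ (coord_pow_mul_mem_polySpace hP i _)
  have hexp : Moderate fun x : Fin d → ℝ => Real.exp (|s| * |x i|) := by
    refine ⟨by fun_prop, |s|, abs_nonneg s, fun x _ => ?_⟩
    rw [Real.abs_exp, Real.exp_le_exp]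
    have h2 : ‖x i‖ ≤ ‖x‖ := norm_le_pi_norm x i
    rw [Real.norm_eq_abs] at h2
    simp only [id]
    gcongr
    linarith
  have hPabs : Moderate fun x => |P x| := by
    obtain ⟨e, he, hb⟩ := hPm.bound
    exact ⟨hPm.continuous.abs, e, he, fun x hx => by rw [abs_abs]; exact hb x hx⟩
  refine PolyApprox.of_dominated hr hr' (by have := hPm.continuous; fun_prop)
    (F := fun N x => (∑ n ∈ Finset.range N, c n * x i ^ (2 * n + 1)) * P x)
    (fun N => (moderate_of_mem_polySpace (hFmem N)).continuous)
    (fun N => PolyApprox.of_mem (hFmem N)) (hexp.mul hPabs) (fun N x => ?_) fun x => ?_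
  · rw [abs_mul]
    refine mul_le_mul_of_nonneg_right ?_ (abs_nonneg _)
    have h1 := Real.hasSum_sinh (|s| * |x i|)
    calc |∑ n ∈ Finset.range N, c n * x i ^ (2 * n + 1)|
        ≤ ∑ n ∈ Finset.range N, |c n * x i ^ (2 * n + 1)| := Finset.abs_sum_le_sum_abs _ _
      _ = ∑ n ∈ Finset.range N, (|s| * |x i|) ^ (2 * n + 1) / ((2 * n + 1).factorial : ℝ) := by
        refine Finset.sum_congr rfl fun n _ => ?_
        rw [← hterm, abs_div, abs_mul, abs_pow, abs_neg, abs_one, one_pow, one_mul, abs_pow,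
          abs_mul, Nat.abs_cast]
      _ ≤ Real.sinh (|s| * |x i|) := sum_le_hasSum _ (fun n _ => by positivity) h1
      _ ≤ Real.exp (|s| * |x i|) := by
        rw [Real.sinh_eq]
        linarith [Real.exp_pos (|s| * |x i|), Real.exp_pos (-(|s| * |x i|))]
  · have h1 := (Real.hasSum_sin (s * x i)).tendsto_sum_nat
    simp only [hterm] at h1
    exact h1.mul_const (P x)

/-- The bounded continuous functions whose products with all polynomials are limits of polynomials
in `L^r(μ)`. -/
noncomputable def multiplierAlgebra (d : ℕ) {r : ℝ≥0∞} (hr : 1 ≤ r) :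
    Subalgebra ℝ C(Fin d → ℝ, ℝ) where
  carrier := {h | (∃ C, ∀ x, |h x| ≤ C) ∧ ∀ P ∈ polySpace d, PolyApprox r fun x => h x * P x}
  mul_mem' := by
    rintro h k ⟨⟨C, hC⟩, hh⟩ ⟨⟨D, hD⟩, hk⟩
    refine ⟨⟨C * D, fun x => ?_⟩, fun P hP => ?_⟩
    · rw [ContinuousMap.mul_apply, abs_mul]
      exact mul_le_mul (hC x) (hD x) (abs_nonneg _) ((abs_nonneg _).trans (hC x))
    · have hPc := (moderate_of_mem_polySpace hP).continuous
      refine PolyApprox.of_near hr (by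
        simp only [ContinuousMap.mul_apply]
        exact ((h.continuous.mul k.continuous).mul hPc).aestronglyMeasurable) fun ε hε => ?_
      have hC0 : 0 ≤ C := (abs_nonneg _).trans (hC 0)
      have hδ : ε / ENNReal.ofReal (C + 1) ≠ 0 := by simpa using hε
      obtain ⟨Q, hQ, hkQ⟩ := hk P hP _ hδ
      refine ⟨fun x => h x * Q x,
        (h.continuous.mul (moderate_of_mem_polySpace hQ).continuous).aestronglyMeasurable,
        hh Q hQ, ?_⟩
      calc eLpNorm (fun x => (h * k) x * P x - h x * Q x) r (mu d)
          ≤ ENNReal.ofReal (C + 1) * eLpNorm (fun x => k x * P x - Q x) r (mu d) := by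
            refine eLpNorm_le_mul_eLpNorm_of_ae_le_mul (ae_of_all _ fun x => ?_) r
            rw [ContinuousMap.mul_apply, mul_assoc, ← mul_sub, norm_mul]
            exact mul_le_mul_of_nonneg_right ((hC x).trans (by linarith)) (norm_nonneg _)
        _ ≤ ENNReal.ofReal (C + 1) * (ε / ENNReal.ofReal (C + 1)) := by gcongr
        _ = ε := ENNReal.mul_div_cancel (by simpa using by linarith) ENNReal.ofReal_ne_top
  add_mem' := by
    rintro h k ⟨⟨C, hC⟩, hh⟩ ⟨⟨D, hD⟩, hk⟩
    refine ⟨⟨C + D, fun x => (abs_add_le _ _).trans (add_le_add (hC x) (hD x))⟩, fun P hP => ?_⟩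
    have hPc := (moderate_of_mem_polySpace hP).continuous
    simp only [ContinuousMap.add_apply, add_mul]
    exact PolyApprox.add hr (h.continuous.mul hPc) (k.continuous.mul hPc) (hh P hP) (hk P hP)
  algebraMap_mem' c := by
    refine ⟨⟨|c|, fun x => le_rfl⟩, fun P hP => ?_⟩
    exact PolyApprox.of_mem (Submodule.smul_mem _ c hP)

theorem mem_multiplierAlgebra {r : ℝ≥0∞} {hr : 1 ≤ r} {h : C(Fin d → ℝ, ℝ)} :
    h ∈ multiplierAlgebra d hr ↔
      (∃ C, ∀ x, |h x| ≤ C) ∧ ∀ P ∈ polySpace d, PolyApprox r fun x => h x * P x :=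
  Iff.rfl

/-- Continuous functions of a multiplier are limits of polynomials, by Weierstrass' theorem. -/
theorem polyApprox_comp {r : ℝ≥0∞} (hr : 1 ≤ r) {h : C(Fin d → ℝ, ℝ)}
    (hh : h ∈ multiplierAlgebra d hr) {φ : ℝ → ℝ} (hφ : Continuous φ) :
    PolyApprox r fun x => φ (h x) := by
  obtain ⟨C, hC⟩ := (mem_multiplierAlgebra.1 hh).1
  refine PolyApprox.of_near hr (hφ.comp h.continuous).aestronglyMeasurable fun ε hε => ?_
  obtain ⟨δ, hδ, hδε⟩ := ENNReal.lt_iff_exists_nnreal_btwn.1 (pos_iff_ne_zero.2 hε)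
  have hδ0 : (0 : ℝ) < δ := by exact_mod_cast hδ
  obtain ⟨p, hp⟩ := exists_polynomial_near_of_continuousOn (-C) C φ hφ.continuousOn δ hδ0
  have hmem : Polynomial.aeval h p ∈ multiplierAlgebra d hr := by
    have := (Polynomial.aeval (⟨h, hh⟩ : multiplierAlgebra d hr) p).2
    rwa [Polynomial.aeval_subalgebra_coe] at this
  have heval : ∀ x, (Polynomial.aeval h p) x = p.eval (h x) := fun x => by
    rw [Polynomial.aeval_continuousMap_apply]
  refine ⟨fun x => p.eval (h x), (p.continuous.comp h.continuous).aestronglyMeasurable, ?_, ?_⟩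
  · have := (mem_multiplierAlgebra.1 hmem).2 _ one_mem_polySpace
    simpa only [mul_one, heval] using this
  · refine le_trans (eLpNorm_le_of_ae_bound (C := δ) (ae_of_all _ fun x => ?_)) ?_
    · rw [Real.norm_eq_abs, abs_sub_comm]
      exact (hp (h x) ⟨neg_le_of_abs_le (hC x), le_of_abs_le (hC x)⟩).le
    · simpa using hδε.le

theorem sin_mem_multiplierAlgebra {r : ℝ≥0∞} (hr : 1 ≤ r) (hr' : r ≠ ∞) (i : Fin d) (s : ℝ) :
    (⟨fun x => Real.sin (s * x i), by fun_prop⟩ : C(Fin d → ℝ, ℝ)) ∈ multiplierAlgebra d hr :=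
  ⟨⟨1, fun _ => Real.abs_sin_le_one _⟩, fun _ hP => polyApprox_sin_mul hr hr' i s hP⟩

/-- Multipliers approximate continuous functions uniformly on compact sets. -/
theorem exists_multiplier_near {r : ℝ≥0∞} (hr : 1 ≤ r) (hr' : r ≠ ∞) {f : (Fin d → ℝ) → ℝ}
    (hf : Continuous f) {K : Set (Fin d → ℝ)} (hK : IsCompact K) {η : ℝ} (hη : 0 < η) :
    ∃ h ∈ multiplierAlgebra d hr, ∀ x ∈ K, |h x - f x| < η := by
  have hsep : (multiplierAlgebra d hr).SeparatesPoints := by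
    intro x y hxy
    obtain ⟨i, hi⟩ : ∃ i, x i ≠ y i := by
      by_contra! h
      exact hxy (funext h)
    -- the sine is injective on `[-π/2, π/2]`, which contains the scaled coordinates
    set M := |x i| + |y i| + 1 with hM
    have hM0 : 0 < M := by positivity
    set s := Real.pi / (2 * M) with hs
    have hs0 : 0 < s := by positivity
    have hsM : s * M = Real.pi / 2 := by rw [hs]; field_simp
    have hrange : ∀ t : ℝ, |t| ≤ M → s * t ∈ Set.Icc (-(Real.pi / 2)) (Real.pi / 2) := by
      intro t ht
      rw [← hsM]
      have := abs_le.1 ht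
      constructor <;> nlinarith
    refine ⟨_, ⟨_, sin_mem_multiplierAlgebra hr hr' i s, rfl⟩, fun h => hi ?_⟩
    have := Real.injOn_sin (hrange _ (by rw [hM]; linarith [abs_nonneg (y i)]))
      (hrange _ (by rw [hM]; linarith [abs_nonneg (x i)])) h
    exact mul_left_cancel₀ hs0.ne' this
  exact ContinuousMap.exists_mem_subalgebra_near_continuous_of_isCompact_of_separatesPoints
    hsep ⟨f, hf⟩ hK hη

theorem polyApprox_of_bounded {r : ℝ≥0∞} (hr : 1 ≤ r) (hr' : r ≠ ∞) {f : (Fin d → ℝ) → ℝ}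
    (hf : Continuous f) {M : ℝ} (hM : ∀ x, |f x| ≤ M) : PolyApprox r f := by
  have hM0 : 0 ≤ M := (abs_nonneg _).trans (hM 0)
  choose h hh hhf using fun n : ℕ => exists_multiplier_near hr hr' hf
    (isCompact_closedBall (0 : Fin d → ℝ) n) (Nat.one_div_pos_of_nat (α := ℝ) (n := n))
  -- truncation at height `M` keeps the approximations bounded away from the ball
  set φ : ℝ → ℝ := fun y => max (-M) (min M y) with hφ
  have hφc : Continuous φ := by fun_prop
  have hφf : ∀ x, φ (f x) = f x := fun x => by
    have := abs_le.1 (hM x)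
    rw [hφ]
    simp only
    rw [min_eq_right this.2, max_eq_right this.1]
  refine PolyApprox.of_dominated hr hr' hf (F := fun n x => φ (h n x))
    (fun n => hφc.comp (h n).continuous) (fun n => polyApprox_comp hr (hh n) hφc)
    (ExpGrowth.const M) (fun n x => ?_) fun x => ?_
  · rw [abs_le]
    exact ⟨le_max_left _ _, max_le (by linarith) (min_le_left _ _)⟩
  · have h1 : Tendsto (fun n => h n x) atTop (𝓝 (f x)) := by
      obtain ⟨m, hm⟩ := exists_nat_ge ‖x‖
      refine tendsto_iff_norm_sub_tendsto_zero.2 (squeeze_zero' (Eventually.of_forall fun n =>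
        norm_nonneg _) ?_ tendsto_one_div_add_atTop_nhds_zero_nat)
      filter_upwards [eventually_ge_atTop m] with n hn
      refine (hhf n x ?_).le
      rw [mem_closedBall_zero_iff]
      exact hm.trans (by exact_mod_cast hn)
    have h2 := (hφc.tendsto (f x)).comp h1
    rwa [hφf] at h2

/-- The polynomials are dense in `L^r(μ)` for `1 ≤ r < ∞`. -/
theorem exists_hermiteSum_eLpNorm_sub_le {r : ℝ≥0∞} (hr : 1 ≤ r) (hr' : r ≠ ∞)
    {f : (Fin d → ℝ) → ℝ} (hf : MemLp f r (mu d)) {ε : ℝ≥0∞} (hε : ε ≠ 0) :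
    ∃ a, eLpNorm (fun x => f x - hermiteSum a x) r (mu d) ≤ ε := by
  have : PolyApprox r f := by
    refine PolyApprox.of_near hr hf.1 fun ε hε => ?_
    obtain ⟨g, hg, hgm⟩ := hf.exists_boundedContinuous_eLpNorm_sub_le hr' hε
    exact ⟨g, hgm.1, polyApprox_of_bounded hr hr' g.continuous fun x => g.norm_coe_le_norm x, hg⟩
  obtain ⟨P, hP, hPf⟩ := this ε hε
  obtain ⟨a, rfl⟩ := mem_polySpace_iff.1 hP
  exact ⟨a, hPf⟩

/-! ### The bilinear estimate in `L^p` -/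

/-- Bellman functions exist for all conjugate exponents. For `p < 2` the two variables exchange their
roles, which is why the constant depends on `p* = max(p, q)`. -/
theorem exists_isBellman {p q : ℝ} (h : p.HolderConjugate q) :
    ∃ Φ ΦS ΦT τ, IsBellman d p q (1 / (9 * (pStar p - 1))) Φ ΦS ΦT τ ∧ 0 < pStar p - 1 := by
  have hp := h.lt
  have hq := h.symm.lt
  have hmul : (p - 1) * (q - 1) = 1 := by linear_combination h.mul_eq_add
  have hqe : p / (p - 1) = q := h.conjugate_eq.symm
  rcases le_total 2 p with h2 | h2
  · have hs : pStar p = p := by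
      rw [pStar, hqe]
      exact max_eq_left (by nlinarith)
    have hB := isBellman_bellman (d := d) (r := q - 1) h2 (by linarith)
    rw [add_sub_cancel] at hB
    have hc : (q - 1) / 9 = 1 / (9 * (pStar p - 1)) := by
      have : p - 1 ≠ 0 := by linarith
      rw [hs]
      field_simp
      linarith
    rw [hc] at hB
    exact ⟨_, _, _, _, hB, by rw [hs]; linarith⟩
  · have hq2 : 2 ≤ q := by nlinarith
    have hs : pStar p = q := by
      rw [pStar, hqe]
      exact max_eq_right (by nlinarith)
    have hB := (isBellman_bellman (d := d) (r := p - 1) hq2 (by linarith)).swap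
    rw [add_sub_cancel] at hB
    have hc : (p - 1) / 9 = 1 / (9 * (pStar p - 1)) := by
      have : q - 1 ≠ 0 := by linarith
      rw [hs]
      field_simp
      linarith
    rw [hc] at hB
    exact ⟨_, _, _, _, hB, by rw [hs]; linarith⟩

theorem integral_norm_rpow_eq {E : Type*} [NormedAddCommGroup E] {G : (Fin d → ℝ) → E} {p : ℝ≥0∞}
    (hp0 : p ≠ 0) (hp' : p ≠ ∞) (hG : MemLp G p (mu d)) :
    ∫ x, ‖G x‖ ^ p.toReal ∂mu d = (eLpNorm G p (mu d)).toReal ^ p.toReal := by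
  have hI : 0 ≤ ∫ x, ‖G x‖ ^ p.toReal ∂mu d := integral_nonneg fun x => by positivity
  rw [hG.eLpNorm_eq_integral_rpow_norm hp0 hp', ENNReal.toReal_ofReal (by positivity),
    Real.rpow_inv_rpow hI (ENNReal.toReal_pos hp0 hp').ne']

/-- Minkowski's inequality, via `(|G|² + δ²)^{1/2} ≤ |G| + δ`. -/
theorem integral_sq_add_rpow_le {E : Type*} [NormedAddCommGroup E] {G : (Fin d → ℝ) → E}
    {p : ℝ≥0∞} (hp : 1 ≤ p) (hp' : p ≠ ∞) (hG : MemLp G p (mu d)) {δ : ℝ} (hδ : 0 < δ) :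
    Integrable (fun x => (‖G x‖ ^ 2 + δ ^ 2) ^ (p.toReal / 2)) (mu d) ∧
    ∫ x, (‖G x‖ ^ 2 + δ ^ 2) ^ (p.toReal / 2) ∂mu d ≤
      ((eLpNorm G p (mu d)).toReal + δ) ^ p.toReal := by
  have hp0 : p ≠ 0 := (zero_lt_one.trans_le hp).ne'
  have hpp : 0 < p.toReal := ENNReal.toReal_pos hp0 hp'
  have hk : MemLp (fun x => ‖G x‖ + δ) p (mu d) := hG.norm.add (memLp_const δ)
  have hpt : ∀ x, (‖G x‖ ^ 2 + δ ^ 2) ^ (p.toReal / 2) ≤ ‖‖G x‖ + δ‖ ^ p.toReal := by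
    intro x
    have hn := norm_nonneg (G x)
    rw [Real.norm_of_nonneg (by positivity)]
    calc (‖G x‖ ^ 2 + δ ^ 2) ^ (p.toReal / 2) ≤ ((‖G x‖ + δ) ^ 2) ^ (p.toReal / 2) := by
          gcongr
          nlinarith
      _ = (‖G x‖ + δ) ^ p.toReal := by
          rw [← Real.rpow_natCast, ← Real.rpow_mul (by positivity)]
          congr 1
          push_cast
          ring
  have hint := hk.integrable_norm_rpow hp0 hp'
  have hnn : ∀ x, 0 ≤ (‖G x‖ ^ 2 + δ ^ 2) ^ (p.toReal / 2) := fun x => by positivity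
  have hint' : Integrable (fun x => (‖G x‖ ^ 2 + δ ^ 2) ^ (p.toReal / 2)) (mu d) := by
    refine hint.mono' ?_ (ae_of_all _ fun x => ?_)
    · exact (((hG.1.norm.aemeasurable.pow_const 2).add_const _).pow_const _).aestronglyMeasurable
    · rw [Real.norm_of_nonneg (hnn x)]
      exact hpt x
  refine ⟨hint', (integral_mono hint' hint hpt).trans ?_⟩
  rw [integral_norm_rpow_eq hp0 hp' hk]
  refine Real.rpow_le_rpow ENNReal.toReal_nonneg ?_ hpp.le
  have h1 : eLpNorm (fun x => ‖G x‖ + δ) p (mu d) ≤ eLpNorm G p (mu d) + ENNReal.ofReal δ := by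
    refine (eLpNorm_add_le hG.1.norm aestronglyMeasurable_const hp).trans ?_
    rw [eLpNorm_norm, eLpNorm_const δ hp0 (IsProbabilityMeasure.ne_zero _)]
    simp [Real.enorm_eq_ofReal hδ.le]
  have h2 := ENNReal.toReal_mono (by simp [hG.2.ne]) h1
  rwa [ENNReal.toReal_add hG.2.ne ENNReal.ofReal_ne_top, ENNReal.toReal_ofReal hδ.le] at h2

/-- The vector field on `ℝ^d` whose components are Hermite polynomials with coefficients `b i`. -/
noncomputable def hermiteVec (b : Fin d → (Fin d → ℕ) →₀ ℝ) (x : Fin d → ℝ) :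
    EuclideanSpace ℝ (Fin d) :=
  WithLp.toLp 2 fun i => hermiteSum (b i) x

/-- The vector of Riesz transforms of the Hermite polynomial with coefficients `a`. -/
noncomputable def rieszVec (a : (Fin d → ℕ) →₀ ℝ) (x : Fin d → ℝ) : EuclideanSpace ℝ (Fin d) :=
  WithLp.toLp 2 fun i => rieszSum a i x

theorem memLp_hermiteSum (a : (Fin d → ℕ) →₀ ℝ) {p : ℝ≥0∞} (hp : p ≠ ∞) :
    MemLp (hermiteSum a) p (mu d) := (moderate_hermiteSum a).memLp hp

theorem memLp_hermiteVec (b : Fin d → (Fin d → ℕ) →₀ ℝ) {p : ℝ≥0∞} (hp : p ≠ ∞) :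
    MemLp (hermiteVec b) p (mu d) :=
  memLp_piLp_iff.2 fun i => memLp_hermiteSum (b i) hp

theorem memLp_rieszVec (a : (Fin d → ℕ) →₀ ℝ) {p : ℝ≥0∞} (hp : p ≠ ∞) :
    MemLp (rieszVec a) p (mu d) :=
  memLp_piLp_iff.2 fun i => (moderate_rieszSum a i).memLp hp

theorem hermiteSum_add (a b : (Fin d → ℕ) →₀ ℝ) (x : Fin d → ℝ) :
    hermiteSum (a + b) x = hermiteSum a x + hermiteSum b x :=
  Finsupp.sum_add_index' (by simp) (by intros; ring)

theorem hermiteSum_smul (c : ℝ) (a : (Fin d → ℕ) →₀ ℝ) (x : Fin d → ℝ) :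
    hermiteSum (c • a) x = c * hermiteSum a x := by
  rw [hermiteSum, Finsupp.sum_smul_index' (by simp), hermiteSum, Finsupp.mul_sum]
  simp only [smul_eq_mul, mul_assoc]

theorem rieszSum_add (a b : (Fin d → ℕ) →₀ ℝ) (i : Fin d) (x : Fin d → ℝ) :
    rieszSum (a + b) i x = rieszSum a i x + rieszSum b i x :=
  Finsupp.sum_add_index' (by simp) (by intros; ring)

theorem rieszSum_smul (c : ℝ) (a : (Fin d → ℕ) →₀ ℝ) (i : Fin d) (x : Fin d → ℝ) :
    rieszSum (c • a) i x = c * rieszSum a i x := by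
  rw [rieszSum, Finsupp.sum_smul_index' (by simp), rieszSum, Finsupp.mul_sum]
  simp only [smul_eq_mul, mul_assoc]

theorem norm_hermiteVec_sq (b : Fin d → (Fin d → ℕ) →₀ ℝ) (x : Fin d → ℝ) :
    ‖hermiteVec b x‖ ^ 2 = ∑ i, hermiteSum (b i) x * hermiteSum (b i) x := by
  rw [EuclideanSpace.real_norm_sq_eq]
  exact Finset.sum_congr rfl fun i _ => sq _

/-- The bilinear estimate in normalized form. -/
theorem riesz_le_of_normalized {p q : ℝ≥0∞} (h : p.toReal.HolderConjugate q.toReal) (hp : 1 ≤ p)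
    (hp' : p ≠ ∞) (hq : 1 ≤ q) (hq' : q ≠ ∞) (a : (Fin d → ℕ) →₀ ℝ)
    (b : Fin d → (Fin d → ℕ) →₀ ℝ) {ε₁ ε₂ : ℝ} (h₁ : 0 < ε₁) (h₂ : 0 < ε₂)
    (ha : (eLpNorm (hermiteSum a) p (mu d)).toReal + ε₁ ≤ 1)
    (hb : (eLpNorm (hermiteVec b) q (mu d)).toReal + ε₂ ≤ 1) :
    ∑ i, ∫ x, rieszSum a i x * hermiteSum (b i) x ∂mu d ≤ 24 * (pStar p.toReal - 1) := by
  obtain ⟨Φ, ΦS, ΦT, τ, hB, hps⟩ := exists_isBellman (d := d) h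
  obtain ⟨A, B, hA, hB0, hAB, hle⟩ := hB.le
  have key := hB.riesz_le (by positivity) a b h₁ h₂
  obtain ⟨i1, j1⟩ := integral_sq_add_rpow_le hp hp' (memLp_hermiteSum a hp') h₁
  obtain ⟨i2, j2⟩ := integral_sq_add_rpow_le hq hq' (memLp_hermiteVec b hq') h₂
  have k1 : ((eLpNorm (hermiteSum a) p (mu d)).toReal + ε₁) ^ p.toReal ≤ 1 :=
    Real.rpow_le_one (by positivity) ha ENNReal.toReal_nonneg
  have k2 : ((eLpNorm (hermiteVec b) q (mu d)).toReal + ε₂) ^ q.toReal ≤ 1 :=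
    Real.rpow_le_one (by positivity) hb ENNReal.toReal_nonneg
  have hS : ∀ x, 0 < hermiteSum a x * hermiteSum a x + ε₁ ^ 2 := fun x =>
    add_pos_of_nonneg_of_pos (mul_self_nonneg _) (by positivity)
  have hT : ∀ x, 0 < ∑ l, hermiteSum (b l) x * hermiteSum (b l) x + ε₂ ^ 2 := fun x =>
    add_pos_of_nonneg_of_pos (Finset.sum_nonneg fun _ _ => mul_self_nonneg _) (by positivity)
  have hint : ∫ x, Φ (hermiteSum a x * hermiteSum a x + ε₁ ^ 2)
      (∑ l, hermiteSum (b l) x * hermiteSum (b l) x + ε₂ ^ 2) ∂mu d ≤ A + B := by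
    calc _ ≤ ∫ x, (A * (‖hermiteSum a x‖ ^ 2 + ε₁ ^ 2) ^ (p.toReal / 2) +
          B * (‖hermiteVec b x‖ ^ 2 + ε₂ ^ 2) ^ (q.toReal / 2)) ∂mu d := by
          refine integral_mono_of_nonneg (ae_of_all _ fun x => hB.nonneg (hS x) (hT x))
            ((i1.const_mul A).add (i2.const_mul B)) (ae_of_all _ fun x => ?_)
          have := hle (hS x) (hT x)
          simp only
          rw [norm_hermiteVec_sq, Real.norm_eq_abs, sq_abs, sq (hermiteSum a x)]
          exact this
      _ ≤ A * 1 + B * 1 := by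
          rw [integral_add (i1.const_mul A) (i2.const_mul B), integral_const_mul,
            integral_const_mul]
          gcongr
          · exact j1.trans k1
          · exact j2.trans k2
      _ = A + B := by ring
  have hc : 2 / (1 / (9 * (pStar p.toReal - 1))) = 18 * (pStar p.toReal - 1) := by
    field_simp
    ring
  rw [hc] at key
  -- the constant of the theorem arises as `24 = 18 * (4 / 3)`
  have := mul_le_mul_of_nonneg_left (hint.trans hAB) (by positivity : 0 ≤ 18 * (pStar p.toReal - 1))
  linarith

/-- The bilinear estimate, from its normalized form by homogeneity. -/
theorem sum_integral_rieszSum_mul_le {p q : ℝ≥0∞} (h : p.toReal.HolderConjugate q.toReal)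
    (hp : 1 ≤ p) (hp' : p ≠ ∞) (hq : 1 ≤ q) (hq' : q ≠ ∞) (a : (Fin d → ℕ) →₀ ℝ)
    (b : Fin d → (Fin d → ℕ) →₀ ℝ) :
    ∑ i, ∫ x, rieszSum a i x * hermiteSum (b i) x ∂mu d ≤ 24 * (pStar p.toReal - 1) *
      ((eLpNorm (hermiteSum a) p (mu d)).toReal * (eLpNorm (hermiteVec b) q (mu d)).toReal) := by
  set α := (eLpNorm (hermiteSum a) p (mu d)).toReal with hα
  set β := (eLpNorm (hermiteVec b) q (mu d)).toReal with hβ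
  have hα0 : 0 ≤ α := ENNReal.toReal_nonneg
  have hβ0 : 0 ≤ β := ENNReal.toReal_nonneg
  have key : ∀ δ : ℝ, 0 < δ → ∑ i, ∫ x, rieszSum a i x * hermiteSum (b i) x ∂mu d ≤
      24 * (pStar p.toReal - 1) * ((α + δ) * (β + δ)) := by
    intro δ hδ
    have hαδ : 0 < α + δ := by positivity
    have hβδ : 0 < β + δ := by positivity
    have e1 : hermiteSum ((α + δ)⁻¹ • a) = (α + δ)⁻¹ • hermiteSum a := by
      funext x
      rw [hermiteSum_smul, Pi.smul_apply, smul_eq_mul]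
    have e2 : hermiteVec (fun i => (β + δ)⁻¹ • b i) = (β + δ)⁻¹ • hermiteVec b := by
      funext x
      ext i
      simp [hermiteVec, hermiteSum_smul]
    have hn := riesz_le_of_normalized h hp hp' hq hq' ((α + δ)⁻¹ • a) (fun i => (β + δ)⁻¹ • b i)
      (ε₁ := δ / (α + δ)) (ε₂ := δ / (β + δ)) (by positivity) (by positivity)
      (by
        rw [e1, eLpNorm_const_smul, ENNReal.toReal_mul, ← hα, toReal_enorm, norm_inv,
          Real.norm_of_nonneg hαδ.le]
        refine le_of_eq ?_
        field_simp)
      (by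
        rw [e2, eLpNorm_const_smul, ENNReal.toReal_mul, ← hβ, toReal_enorm, norm_inv,
          Real.norm_of_nonneg hβδ.le]
        refine le_of_eq ?_
        field_simp)
    have e3 : ∑ i, ∫ x, rieszSum ((α + δ)⁻¹ • a) i x * hermiteSum ((β + δ)⁻¹ • b i) x ∂mu d =
        ((α + δ) * (β + δ))⁻¹ * ∑ i, ∫ x, rieszSum a i x * hermiteSum (b i) x ∂mu d := by
      rw [Finset.mul_sum]
      refine Finset.sum_congr rfl fun i _ => ?_
      rw [← integral_const_mul]
      congr 1
      funext x
      rw [rieszSum_smul, hermiteSum_smul, mul_inv]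
      ring
    rw [e3, inv_mul_le_iff₀ (by positivity)] at hn
    linarith
  have hlim : Tendsto (fun δ : ℝ => 24 * (pStar p.toReal - 1) * ((α + δ) * (β + δ))) (𝓝[>] 0)
      (𝓝 (24 * (pStar p.toReal - 1) * ((α + 0) * (β + 0)))) :=
    Tendsto.mono_left (Continuous.tendsto (by fun_prop) 0) nhdsWithin_le_nhds
  rw [add_zero, add_zero] at hlim
  exact ge_of_tendsto hlim (eventually_mem_nhdsWithin.mono fun δ hδ => key δ hδ)

/-! ### Duality -/

theorem norm_le_sum_abs (v : EuclideanSpace ℝ (Fin d)) : ‖v‖ ≤ ∑ i, |v i| := by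
  rw [EuclideanSpace.norm_eq]
  refine Real.sqrt_le_iff.2 ⟨Finset.sum_nonneg fun _ _ => abs_nonneg _, ?_⟩
  exact Finset.sum_sq_le_sq_sum_of_nonneg fun i _ => abs_nonneg (v i)

theorem exists_hermiteVec_eLpNorm_sub_le {r : ℝ≥0∞} (hr : 1 ≤ r) (hr' : r ≠ ∞)
    {g : (Fin d → ℝ) → EuclideanSpace ℝ (Fin d)} (hg : MemLp g r (mu d)) {ε : ℝ≥0∞} (hε : ε ≠ 0) :
    ∃ b, eLpNorm (fun x => g x - hermiteVec b x) r (mu d) ≤ ε := by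
  have hε' : ε / (d + 1) ≠ 0 := ENNReal.div_ne_zero.2 ⟨hε, by finiteness⟩
  choose b hb using fun i : Fin d => exists_hermiteSum_eLpNorm_sub_le hr hr'
    (memLp_piLp_iff.1 hg i) hε'
  refine ⟨b, ?_⟩
  have hm : ∀ i, MemLp (fun x => g x i - hermiteSum (b i) x) r (mu d) := fun i =>
    (memLp_piLp_iff.1 hg i).sub (memLp_hermiteSum (b i) hr')
  calc eLpNorm (fun x => g x - hermiteVec b x) r (mu d)
      ≤ eLpNorm (∑ i, fun x => |g x i - hermiteSum (b i) x|) r (mu d) := by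
        refine eLpNorm_mono_real fun x => ?_
        rw [Finset.sum_apply]
        exact norm_le_sum_abs _
    _ ≤ ∑ i, eLpNorm (fun x => |g x i - hermiteSum (b i) x|) r (mu d) :=
        eLpNorm_sum_le (fun i _ => (hm i).1.norm) hr
    _ ≤ ∑ _i : Fin d, ε / (d + 1) := by
        refine Finset.sum_le_sum fun i _ => ?_
        refine le_trans (le_of_eq ?_) (hb i)
        exact eLpNorm_norm fun x => g x i - hermiteSum (b i) x
    _ ≤ (d + 1) * (ε / (d + 1)) := by
        rw [Finset.sum_const, Finset.card_univ, Fintype.card_fin, nsmul_eq_mul]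
        gcongr
        exact le_self_add
    _ ≤ ε := ENNReal.mul_div_le

theorem pStar_sub_one_nonneg {p q : ℝ} (h : p.HolderConjugate q) : 0 ≤ pStar p - 1 :=
  (exists_isBellman (d := 0) h).choose_spec.choose_spec.choose_spec.choose_spec.2.le

/-- By density of the polynomials the bilinear estimate holds against every `L^q` vector field. -/
theorem integral_inner_rieszVec_le {p q : ℝ≥0∞} [p.HolderConjugate q] (hp' : p ≠ ∞) (hq' : q ≠ ∞)
    (a : (Fin d → ℕ) →₀ ℝ) {g : (Fin d → ℝ) → EuclideanSpace ℝ (Fin d)} (hg : MemLp g q (mu d)) :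
    ∫ x, inner ℝ (rieszVec a x) (g x) ∂mu d ≤ 24 * (pStar p.toReal - 1) *
      ((eLpNorm (hermiteSum a) p (mu d)).toReal * (eLpNorm g q (mu d)).toReal) := by
  have hp : 1 ≤ p := ENNReal.HolderConjugate.one_le p q
  have hq : 1 ≤ q := ENNReal.HolderConjugate.one_le q p
  have : Fact (1 ≤ p) := ⟨hp⟩
  have : Fact (1 ≤ q) := ⟨hq⟩
  have hconj := ENNReal.HolderConjugate.toReal_of_ne_top hp' hq'
  set C := 24 * (pStar p.toReal - 1)
  set α := (eLpNorm (hermiteSum a) p (mu d)).toReal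
  set Λ : Lp (EuclideanSpace ℝ (Fin d)) q (mu d) →L[ℝ] ℝ :=
    (innerSL ℝ).lpPairing (mu d) p q ((memLp_rieszVec a hp').toLp _)
  have hΛ : ∀ {u : (Fin d → ℝ) → EuclideanSpace ℝ (Fin d)} (hu : MemLp u q (mu d)),
      Λ (hu.toLp u) = ∫ x, inner ℝ (rieszVec a x) (u x) ∂mu d := by
    intro u hu
    rw [ContinuousLinearMap.lpPairing_eq_integral]
    refine integral_congr_ae ?_
    filter_upwards [(memLp_rieszVec a hp').coeFn_toLp, hu.coeFn_toLp] with x h1 h2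
    rw [h1, h2, innerSL_apply_apply]
  have hclosed : IsClosed {u : Lp (EuclideanSpace ℝ (Fin d)) q (mu d) | Λ u ≤ C * (α * ‖u‖)} :=
    isClosed_le (by fun_prop) (by fun_prop)
  have hmem : hg.toLp g ∈ {u : Lp (EuclideanSpace ℝ (Fin d)) q (mu d) | Λ u ≤ C * (α * ‖u‖)} := by
    refine hclosed.closure_subset (EMetric.mem_closure_iff.2 fun ε hε => ?_)
    obtain ⟨δ, hδ, hδε⟩ := exists_between hε
    obtain ⟨b, hb⟩ := exists_hermiteVec_eLpNorm_sub_le hq hq' hg hδ.ne'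
    refine ⟨(memLp_hermiteVec b hq').toLp _, ?_, ?_⟩
    · rw [Set.mem_ofPred_eq, hΛ, Lp.norm_toLp]
      refine le_trans (le_of_eq ?_) (sum_integral_rieszSum_mul_le hconj hp hp' hq hq' a b)
      rw [← integral_finsetSum]
      · refine integral_congr_ae (ae_of_all _ fun x => ?_)
        simp [PiLp.inner_apply, rieszVec, hermiteVec, mul_comm]
      · exact fun i _ => ((moderate_rieszSum a i).mul (moderate_hermiteSum (b i))).integrable
    · rw [Lp.edist_toLp_toLp]
      exact hb.trans_lt hδε
  rw [Set.mem_ofPred_eq, hΛ, Lp.norm_toLp] at hmem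
  exact hmem

/-- The a priori bound for polynomials, by testing the bilinear estimate on the field
`‖h‖^{p-2} h` that is dual to `h = rieszVec a`. -/
theorem eLpNorm_rieszVec_le {p : ℝ≥0∞} (hp : 1 < p) (hp' : p ≠ ∞) (a : (Fin d → ℕ) →₀ ℝ) :
    (eLpNorm (rieszVec a) p (mu d)).toReal ≤
      24 * (pStar p.toReal - 1) * (eLpNorm (hermiteSum a) p (mu d)).toReal := by
  have := ENNReal.HolderConjugate.conjExponent hp.le
  set q := p.conjExponent
  have hq' : q ≠ ∞ := ((ENNReal.HolderConjugate.lt_top_iff_one_lt q p).2 hp).ne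
  have hq : 1 ≤ q := ENNReal.HolderConjugate.one_le q p
  have hp0 : p ≠ 0 := (zero_lt_one.trans hp).ne'
  have hq0 : q ≠ 0 := (zero_lt_one.trans_le hq).ne'
  have hconj := ENNReal.HolderConjugate.toReal_of_ne_top hp' hq'
  have hm := memLp_rieszVec a hp'
  have h1 : 0 < p.toReal - 1 := by linarith [hconj.lt]
  set g : (Fin d → ℝ) → EuclideanSpace ℝ (Fin d) :=
    fun x => ‖rieszVec a x‖ ^ (p.toReal - 2) • rieszVec a x
  have hgn : ∀ x, ‖g x‖ ^ q.toReal = ‖rieszVec a x‖ ^ p.toReal := by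
    intro x
    have : ‖g x‖ = ‖rieszVec a x‖ ^ (p.toReal - 1) := by
      rw [norm_smul, Real.norm_of_nonneg (by positivity)]
      rcases (norm_nonneg (rieszVec a x)).eq_or_lt with h | h
      · rw [← h, mul_zero, Real.zero_rpow h1.ne']
      · rw [← Real.rpow_add_one h.ne']
        ring_nf
    rw [this, ← Real.rpow_mul (norm_nonneg _)]
    congr 1
    linear_combination hconj.mul_eq_add
  have hgi : ∀ x, inner ℝ (rieszVec a x) (g x) = ‖rieszVec a x‖ ^ p.toReal := by
    intro x
    rw [inner_smul_right, real_inner_self_eq_norm_sq]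
    rcases (norm_nonneg (rieszVec a x)).eq_or_lt with h | h
    · rw [← h, Real.zero_rpow hconj.pos.ne']
      simp
    · rw [← Real.rpow_natCast, ← Real.rpow_add h]
      norm_num
  have hgm : MemLp g q (mu d) := by
    have hs : AEStronglyMeasurable g (mu d) :=
      (hm.1.norm.aemeasurable.pow_const _).aestronglyMeasurable.smul hm.1
    rw [← integrable_norm_rpow_iff hs hq0 hq']
    simp only [hgn]
    exact (integrable_norm_rpow_iff hm.1 hp0 hp').2 hm
  have key := integral_inner_rieszVec_le hp' hq' a hgm
  have e1 := integral_norm_rpow_eq hp0 hp' hm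
  have e2 := integral_norm_rpow_eq hq0 hq' hgm
  simp only [hgn] at e2
  simp only [hgi] at key
  have hK := pStar_sub_one_nonneg hconj
  set N := (eLpNorm (rieszVec a) p (mu d)).toReal
  set M := (eLpNorm g q (mu d)).toReal
  set α := (eLpNorm (hermiteSum a) p (mu d)).toReal
  have hN : 0 ≤ N := ENNReal.toReal_nonneg
  have hM : 0 ≤ M := ENNReal.toReal_nonneg
  have hα : 0 ≤ α := ENNReal.toReal_nonneg
  rcases hN.eq_or_lt with h0 | h0
  · rw [← h0]
    positivity
  have hMN : M = N ^ (p.toReal - 1) := by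
    have : M = (M ^ q.toReal) ^ (q.toReal)⁻¹ := (Real.rpow_rpow_inv hM hconj.symm.pos.ne').symm
    rw [this, ← e2, e1, ← Real.rpow_mul hN]
    congr 1
    have := hconj.symm.pos
    field_simp
    linear_combination -hconj.mul_eq_add
  have hNp : N ^ p.toReal = N * N ^ (p.toReal - 1) := by
    rw [mul_comm, ← Real.rpow_add_one h0.ne', sub_add_cancel]
  rw [e1, hNp, hMN, ← mul_assoc] at key
  have := le_of_mul_le_mul_right (a := N ^ (p.toReal - 1)) (b := N)
    (c := 24 * (pStar p.toReal - 1) * α) (by linarith) (by positivity)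
  exact this

/-! ### The Riesz transforms on `L^p` -/

theorem integral_hermiteSum_mul (a : (Fin d → ℕ) →₀ ℝ) (k : Fin d → ℕ) :
    ∫ x, hermiteSum a x * hermiteN k x ∂mu d = a k := by
  classical
  simp only [hermiteSum, Finsupp.sum, Finset.sum_mul, mul_assoc]
  rw [integral_finsetSum _ fun l _ =>
    (((moderate_hermiteN l).mul (moderate_hermiteN k)).const_mul (a l)).integrable]
  simp only [integral_const_mul, integral_hermiteN_mul, mul_ite, mul_one, mul_zero]
  rw [Finset.sum_ite_eq', ite_eq_left_iff]
  exact fun h => (Finsupp.notMem_support_iff.1 h).symm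

/-- On polynomials the defining series of the Riesz transform is a finite sum. -/
theorem rieszPartialSum_hermiteSum (a : (Fin d → ℕ) →₀ ℝ) (i : Fin d) :
    ∀ᶠ s in atTop, rieszPartialSum (hermiteSum a) i s = rieszSum a i := by
  classical
  filter_upwards [eventually_ge_atTop (a.support.subtype (· ≠ 0))] with s hs
  funext x
  simp only [rieszPartialSum, integral_hermiteSum_mul, delta_hermiteN_eq, rieszSum, Finsupp.sum]
  set F : (Fin d → ℕ) → ℝ := fun k => a k * (eigenvalue k ^ (-(1 / 2 : ℝ)) *
    (√(2 * (k i : ℝ)) * hermiteN (lower k i) x)) with hF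
  have h1 : ∀ k : {k : Fin d → ℕ // k ≠ 0}, eigenvalue k.1 ^ (-(1 / 2 : ℝ)) * a k.1 *
      (√(2 * (k.1 i : ℝ)) * hermiteN (lower k.1 i) x) = F k.1 := by
    intro k
    rw [hF]
    ring
  simp only [h1]
  rw [← Finset.sum_subset hs, Finset.sum_subtype_eq_sum_filter (p := (· ≠ 0))]
  · refine Finset.sum_subset (Finset.filter_subset _ _) fun k hk hk' => ?_
    have h0 : k = 0 := by
      by_contra h
      exact hk' (Finset.mem_filter.2 ⟨hk, h⟩)
    simp [hF, h0]
  · intro k _ hk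
    have h0 : a k.1 = 0 := by
      by_contra h
      exact hk (Finset.mem_subtype.2 (Finsupp.mem_support_iff.2 h))
    simp [hF, h0]

theorem rieszPartialSum_congr {f g : (Fin d → ℝ) → ℝ} (h : f =ᵐ[mu d] g) (i : Fin d)
    (s : Finset {k : Fin d → ℕ // k ≠ 0}) : rieszPartialSum f i s = rieszPartialSum g i s := by
  funext x
  refine Finset.sum_congr rfl fun k _ => ?_
  have : ∫ y, f y * hermiteN k.1 y ∂mu d = ∫ y, g y * hermiteN k.1 y ∂mu d :=
    integral_congr_ae (h.mul (ae_eq_refl (hermiteN k.1)))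
  rw [this]

theorem rieszPartialSum_sub {f g : (Fin d → ℝ) → ℝ} (hf : MemLp f 2 (mu d)) (hg : MemLp g 2 (mu d))
    (i : Fin d) (s : Finset {k : Fin d → ℕ // k ≠ 0}) :
    rieszPartialSum (fun x => f x - g x) i s =
      fun x => rieszPartialSum f i s x - rieszPartialSum g i s x := by
  funext x
  simp only [rieszPartialSum]
  rw [← Finset.sum_sub_distrib]
  refine Finset.sum_congr rfl fun k _ => ?_
  have hk : MemLp (hermiteN k.1) 2 (mu d) := (moderate_hermiteN k.1).memLp (by simp)
  have : ∫ y, (f y - g y) * hermiteN k.1 y ∂mu d =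
      ∫ y, f y * hermiteN k.1 y ∂mu d - ∫ y, g y * hermiteN k.1 y ∂mu d := by
    simp only [sub_mul]
    exact integral_sub (hf.integrable_mul hk) (hg.integrable_mul hk)
  rw [this]
  ring

theorem continuous_rieszPartialSum (f : (Fin d → ℝ) → ℝ) (i : Fin d)
    (s : Finset {k : Fin d → ℕ // k ≠ 0}) : Continuous (rieszPartialSum f i s) := by
  have : rieszPartialSum f i s = fun x => ∑ k ∈ s, eigenvalue k.1 ^ (-(1 / 2 : ℝ)) *
      (∫ y, f y * hermiteN k.1 y ∂mu d) * (√(2 * (k.1 i : ℝ)) * hermiteN (lower k.1 i) x) := by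
    funext x
    simp only [rieszPartialSum, delta_hermiteN_eq]
  rw [this]
  exact continuous_finsetSum _ fun k _ => continuous_const.mul
    (continuous_const.mul (moderate_hermiteN (lower k.1 i)).continuous)

/-- A simultaneous `L²` limit of polynomials and of their Riesz transforms is a pair `f, R f`;
by Bessel's inequality the tail of the series is controlled uniformly in the partial sum. -/
theorem isRieszVector_of_approx {f : (Fin d → ℝ) → ℝ}
    {g : (Fin d → ℝ) → EuclideanSpace ℝ (Fin d)} (hf : MemLp f 2 (mu d)) (hg : MemLp g 2 (mu d))
    (h : ∀ ε : ℝ≥0∞, ε ≠ 0 → ∃ a, eLpNorm (fun x => f x - hermiteSum a x) 2 (mu d) ≤ ε ∧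
      eLpNorm (fun x => g x - rieszVec a x) 2 (mu d) ≤ ε) : IsRieszVector f g := by
  intro i
  rw [ENNReal.tendsto_nhds_zero]
  intro ε hε
  obtain ⟨a, ha, hga⟩ := h (ε / 2) (ENNReal.half_pos hε.ne').ne'
  have hh : MemLp (hermiteSum a) 2 (mu d) := memLp_hermiteSum a (by simp)
  have hr : MemLp (rieszVec a) 2 (mu d) := memLp_rieszVec a (by simp)
  filter_upwards [rieszPartialSum_hermiteSum a i] with s hs
  have e : (fun x => g x i - rieszPartialSum f i s x) = (fun x => g x i - rieszVec a x i) -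
      rieszPartialSum (fun x => f x - hermiteSum a x) i s := by
    rw [rieszPartialSum_sub hf hh, hs]
    funext x
    simp only [Pi.sub_apply, rieszVec]
    ring
  rw [e]
  calc _ ≤ eLpNorm (fun x => g x i - rieszVec a x i) 2 (mu d) +
        eLpNorm (rieszPartialSum (fun x => f x - hermiteSum a x) i s) 2 (mu d) :=
        eLpNorm_sub_le (memLp_piLp_iff.1 (hg.sub hr) i).1
          (continuous_rieszPartialSum _ i s).aestronglyMeasurable (by norm_num)
    _ ≤ ε / 2 + ε / 2 := by
        refine add_le_add ?_ ((eLpNorm_rieszPartialSum_le (hf.sub hh) i s).trans ha)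
        exact (eLpNorm_mono fun x => PiLp.norm_apply_le (g x - rieszVec a x) i).trans hga
    _ = ε := ENNReal.add_halves ε

/-- The series determines the Riesz transforms of a polynomial. -/
theorem IsRieszVector.ae_eq_rieszVec {f : (Fin d → ℝ) → ℝ}
    {g : (Fin d → ℝ) → EuclideanSpace ℝ (Fin d)} (hg : AEStronglyMeasurable g (mu d))
    (h : IsRieszVector f g) {a : (Fin d → ℕ) →₀ ℝ} (hf : f =ᵐ[mu d] hermiteSum a) :
    g =ᵐ[mu d] rieszVec a := by
  have hi : ∀ i, ∀ᵐ x ∂mu d, g x i = rieszSum a i x := by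
    intro i
    have h0 : eLpNorm (fun x => g x i - rieszSum a i x) 2 (mu d) = 0 := by
      refine tendsto_nhds_unique (tendsto_const_nhds.congr' ?_) (h i)
      filter_upwards [rieszPartialSum_hermiteSum a i] with s hs
      rw [rieszPartialSum_congr hf, hs]
    have hm : AEStronglyMeasurable (fun x => g x i - rieszSum a i x) (mu d) :=
      ((PiLp.continuous_apply 2 _ i).comp_aestronglyMeasurable hg).sub ((moderate_rieszSum a i).memLp (r := 2) (by simp)).1
    filter_upwards [(eLpNorm_eq_zero_iff hm (by norm_num)).1 h0] with x hx
    exact sub_eq_zero.1 hx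
  filter_upwards [ae_all_iff.2 hi] with x hx
  ext i
  exact hx i

section Extension

variable {p : ℝ≥0∞}

/-- The polynomial with given Hermite coefficients, as an element of `L^p`. -/
noncomputable def hermiteLp (hp' : p ≠ ∞) : ((Fin d → ℕ) →₀ ℝ) →ₗ[ℝ] Lp ℝ p (mu d) where
  toFun a := (memLp_hermiteSum a hp').toLp _
  map_add' a b := by
    rw [← MemLp.toLp_add]
    exact MemLp.toLp_congr _ _ (ae_of_all _ (hermiteSum_add a b))
  map_smul' c a := by
    rw [RingHom.id_apply, ← MemLp.toLp_const_smul]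
    exact MemLp.toLp_congr _ _ (ae_of_all _ (hermiteSum_smul c a))

/-- The vector of Riesz transforms of the polynomial with given Hermite coefficients, as an element
of `L^p`. -/
noncomputable def rieszLp (hp' : p ≠ ∞) :
    ((Fin d → ℕ) →₀ ℝ) →ₗ[ℝ] Lp (EuclideanSpace ℝ (Fin d)) p (mu d) where
  toFun a := (memLp_rieszVec a hp').toLp _
  map_add' a b := by
    rw [← MemLp.toLp_add]
    refine MemLp.toLp_congr _ _ (ae_of_all _ fun x => ?_)
    ext i
    exact rieszSum_add a b i x
  map_smul' c a := by
    rw [RingHom.id_apply, ← MemLp.toLp_const_smul]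
    refine MemLp.toLp_congr _ _ (ae_of_all _ fun x => ?_)
    ext i
    exact rieszSum_smul c a i x

theorem norm_rieszLp_le (hp : 1 < p) (hp' : p ≠ ∞) (a : (Fin d → ℕ) →₀ ℝ) :
    ‖rieszLp hp' a‖ ≤ 24 * (pStar p.toReal - 1) * ‖hermiteLp hp' a‖ := by
  simp only [rieszLp, hermiteLp, LinearMap.coe_mk, AddHom.coe_mk, Lp.norm_toLp]
  exact eLpNorm_rieszVec_le hp hp' a

variable [Fact (1 ≤ p)]

theorem denseRange_hermiteLp (hp' : p ≠ ∞) : DenseRange (hermiteLp hp' (d := d)) := by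
  intro f
  refine EMetric.mem_closure_iff.2 fun ε hε => ?_
  obtain ⟨δ, hδ, hδε⟩ := exists_between hε
  obtain ⟨a, ha⟩ := exists_hermiteSum_eLpNorm_sub_le Fact.out hp' (Lp.memLp f) hδ.ne'
  refine ⟨_, ⟨a, rfl⟩, lt_of_le_of_lt ?_ hδε⟩
  rw [Lp.edist_def]
  exact (eLpNorm_congr_ae
    ((ae_eq_refl f).sub (memLp_hermiteSum a hp').coeFn_toLp)).trans_le ha

/-- The continuous extension of the Riesz transforms from polynomials to `L^p`. -/
noncomputable def rieszOp (hp' : p ≠ ∞) :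
    Lp ℝ p (mu d) →L[ℝ] Lp (EuclideanSpace ℝ (Fin d)) p (mu d) :=
  (rieszLp hp').extendOfNorm (hermiteLp hp')

theorem norm_rieszOp_le (hp : 1 < p) (hp' : p ≠ ∞) (f : Lp ℝ p (mu d)) :
    ‖rieszOp hp' f‖ ≤ 24 * (pStar p.toReal - 1) * ‖f‖ :=
  LinearMap.norm_extendOfNorm_apply_le (denseRange_hermiteLp hp') _ (norm_rieszLp_le hp hp') f

theorem eLpNorm_rieszOp_sub_le (hp : 1 < p) (hp' : p ≠ ∞) (f : Lp ℝ p (mu d))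
    (a : (Fin d → ℕ) →₀ ℝ) :
    eLpNorm (fun x => rieszOp hp' f x - rieszVec a x) p (mu d) ≤
      ENNReal.ofReal (24 * (pStar p.toReal - 1)) *
        eLpNorm (fun x => f x - hermiteSum a x) p (mu d) := by
  have e1 : rieszOp hp' (hermiteLp hp' a) = rieszLp hp' (d := d) a :=
    LinearMap.extendOfNorm_eq (denseRange_hermiteLp hp') ⟨_, norm_rieszLp_le hp hp'⟩ a
  have h1 := norm_rieszOp_le hp hp' (f - hermiteLp hp' a)
  rw [map_sub, e1] at h1
  have h2 : ‖rieszOp hp' f - rieszLp hp' a‖ₑ ≤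
      ENNReal.ofReal (24 * (pStar p.toReal - 1)) * ‖f - hermiteLp hp' a‖ₑ := by
    rw [← ofReal_norm, ← ofReal_norm, ← ENNReal.ofReal_mul' (norm_nonneg _)]
    exact ENNReal.ofReal_le_ofReal h1
  rw [Lp.enorm_def, Lp.enorm_def] at h2
  refine le_trans (le_of_eq (eLpNorm_congr_ae ?_)) (h2.trans (le_of_eq ?_))
  · filter_upwards [Lp.coeFn_sub (rieszOp hp' f) (rieszLp hp' a),
      (memLp_rieszVec a hp').coeFn_toLp] with x h1 h2
    rw [h1, Pi.sub_apply, ← h2]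
    rfl
  · congr 1
    refine eLpNorm_congr_ae ?_
    filter_upwards [Lp.coeFn_sub f (hermiteLp hp' a),
      (memLp_hermiteSum a hp').coeFn_toLp] with x h1 h2
    rw [h1, Pi.sub_apply, ← h2]
    rfl

end Extension

theorem exists_ne_zero_mul_le {C ε : ℝ≥0∞} (hC : C ≠ ∞) (hε : ε ≠ 0) :
    ∃ δ ≠ 0, C * δ ≤ ε ∧ δ ≤ ε := by
  refine ⟨ε / (C + 1), ENNReal.div_ne_zero.2 ⟨hε, by finiteness⟩, ?_, ?_⟩
  · exact (mul_le_mul_left le_self_add _).trans ENNReal.mul_div_le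
  · exact ENNReal.div_le_of_le_mul (le_mul_of_one_le_right' le_add_self)

/-- The operators on `L^p` and on `L^r`, `r = max(p, 2)`, are limits along the same polynomials,
so they agree on `L^p ∩ L² = L^r`, and there the limit also holds in `L²`. -/
theorem isLpRiesz_rieszOp {p : ℝ≥0∞} [Fact (1 ≤ p)] (hp : 1 < p) (hp' : p ≠ ∞) :
    IsLpRiesz (d := d) p (rieszOp hp') := by
  intro f hf2
  set r := max p 2 with hr_def
  have hpr : p ≤ r := le_max_left _ _
  have h2r : 2 ≤ r := le_max_right _ _
  have hr : 1 < r := hp.trans_le hpr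
  have hr' : r ≠ ∞ := (max_lt hp'.lt_top (by simp)).ne
  have : Fact (1 ≤ r) := ⟨hr.le⟩
  have hfr : MemLp f r (mu d) := by
    rcases max_choice p 2 with h | h <;> rw [hr_def, h]
    exacts [Lp.memLp f, hf2]
  set F : Lp ℝ r (mu d) := hfr.toLp f
  set g : (Fin d → ℝ) → EuclideanSpace ℝ (Fin d) := ⇑(rieszOp hr' F)
  have hg : MemLp g r (mu d) := Lp.memLp _
  set C : ℝ≥0∞ := ENNReal.ofReal (24 * (pStar p.toReal - 1)) +
    ENNReal.ofReal (24 * (pStar r.toReal - 1))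
  have hC : C ≠ ∞ := by finiteness
  have happ : ∀ ε : ℝ≥0∞, ε ≠ 0 → ∃ a, eLpNorm (fun x => f x - hermiteSum a x) r (mu d) ≤ ε ∧
      C * eLpNorm (fun x => f x - hermiteSum a x) r (mu d) ≤ ε := by
    intro ε hε
    obtain ⟨δ, hδ, h1, h2⟩ := exists_ne_zero_mul_le hC hε
    obtain ⟨a, ha⟩ := exists_hermiteSum_eLpNorm_sub_le hr.le hr' hfr hδ
    exact ⟨a, ha.trans h2, (by gcongr : _ ≤ C * δ).trans h1⟩
  have hgr : ∀ a, eLpNorm (fun x => g x - rieszVec a x) r (mu d) ≤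
      ENNReal.ofReal (24 * (pStar r.toReal - 1)) *
        eLpNorm (fun x => f x - hermiteSum a x) r (mu d) := by
    intro a
    refine (eLpNorm_rieszOp_sub_le hr hr' F a).trans (le_of_eq ?_)
    congr 1
    exact eLpNorm_congr_ae (hfr.coeFn_toLp.sub (ae_eq_refl (hermiteSum a)))
  have hfa : ∀ a, AEStronglyMeasurable (fun x => f x - hermiteSum a x) (mu d) := fun a =>
    (hfr.sub (memLp_hermiteSum a hr')).1
  have hga : ∀ a, AEStronglyMeasurable (fun x => g x - rieszVec a x) (mu d) := fun a =>
    (hg.sub (memLp_rieszVec a hr')).1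
  have heq : rieszOp hp' f =ᵐ[mu d] g := by
    have h0 : eLpNorm (fun x => rieszOp hp' f x - g x) p (mu d) = 0 := by
      by_contra hne
      obtain ⟨ε, hε0, hε⟩ := exists_between (pos_iff_ne_zero.2 hne)
      obtain ⟨a, -, ha⟩ := happ ε hε0.ne'
      refine hε.not_ge (le_trans ?_ ha)
      have e : (fun x => rieszOp hp' f x - g x) = (fun x => rieszOp hp' f x - rieszVec a x) -
          fun x => g x - rieszVec a x := by
        funext x
        simp only [Pi.sub_apply]
        abel
      rw [e, add_mul]
      refine (eLpNorm_sub_le ((Lp.memLp _).sub (memLp_rieszVec a hp')).1 (hga a) hp.le).trans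
        (add_le_add ?_ ?_)
      · refine (eLpNorm_rieszOp_sub_le hp hp' f a).trans ?_
        gcongr
        exact eLpNorm_le_eLpNorm_of_exponent_le hpr (hfa a)
      · exact (eLpNorm_le_eLpNorm_of_exponent_le hpr (hga a)).trans (hgr a)
    have hm : AEStronglyMeasurable (fun x => rieszOp hp' f x - g x) (mu d) :=
      (Lp.aestronglyMeasurable _).sub hg.1
    filter_upwards [(eLpNorm_eq_zero_iff hm (zero_lt_one.trans hp).ne').1 h0] with x hx
    exact sub_eq_zero.1 hx
  have hgv : IsRieszVector f g := by
    refine isRieszVector_of_approx hf2 (hg.mono_exponent h2r) fun ε hε => ?_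
    obtain ⟨a, ha, hCa⟩ := happ ε hε
    refine ⟨a, (eLpNorm_le_eLpNorm_of_exponent_le h2r (hfa a)).trans ha,
      (eLpNorm_le_eLpNorm_of_exponent_le h2r (hga a)).trans ((hgr a).trans (le_trans ?_ hCa))⟩
    gcongr
    exact le_add_self
  intro i
  refine (hgv i).congr fun s => eLpNorm_congr_ae ?_
  filter_upwards [heq] with x hx
  rw [hx]

theorem IsLpRiesz.eq_rieszOp {p : ℝ≥0∞} [Fact (1 ≤ p)] (hp : 1 < p) (hp' : p ≠ ∞)
    {R : Lp ℝ p (mu d) →L[ℝ] Lp (EuclideanSpace ℝ (Fin d)) p (mu d)} (hR : IsLpRiesz p R) :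
    R = rieszOp hp' := by
  refine (LinearMap.extendOfNorm_unique (denseRange_hermiteLp hp') _ (norm_rieszLp_le hp hp') R
    ?_).symm
  refine LinearMap.ext fun a => ?_
  have hae : hermiteLp hp' a =ᵐ[mu d] hermiteSum a := (memLp_hermiteSum a hp').coeFn_toLp
  have h2 : MemLp (hermiteLp hp' a) 2 (mu d) := (memLp_hermiteSum a (by simp)).ae_eq hae.symm
  refine Lp.ext (((hR _ h2).ae_eq_rieszVec (Lp.aestronglyMeasurable _) hae).trans ?_)
  exact (memLp_rieszVec a hp').coeFn_toLp.symm

end HermiteRiesz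

theorem theorem5p1 (d : ℕ) (p : ℝ≥0∞) [Fact (1 ≤ p)] (hp : 1 < p) (hp_top : p ≠ ∞) :
    (∃! R : Lp ℝ p (HermiteRiesz.mu d) →L[ℝ]
        Lp (EuclideanSpace ℝ (Fin d)) p (HermiteRiesz.mu d), HermiteRiesz.IsLpRiesz p R) ∧
    ∀ R : Lp ℝ p (HermiteRiesz.mu d) →L[ℝ]
        Lp (EuclideanSpace ℝ (Fin d)) p (HermiteRiesz.mu d), HermiteRiesz.IsLpRiesz p R →
      ∀ f : Lp ℝ p (HermiteRiesz.mu d), ∫ y, f y ∂(HermiteRiesz.mu d) = 0 →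
        ‖R f‖ ≤ 24 * (HermiteRiesz.pStar p.toReal - 1) * ‖f‖ := by
  refine ⟨⟨HermiteRiesz.rieszOp hp_top, HermiteRiesz.isLpRiesz_rieszOp hp hp_top,
    fun R hR => hR.eq_rieszOp hp hp_top⟩, fun R hR f _ => ?_⟩
  rw [hR.eq_rieszOp hp hp_top]
  exact HermiteRiesz.norm_rieszOp_le hp hp_top f
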